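/- Let $n\in\mathbb{N}$ and $\hbar>0$. For a smooth $f:\mathbb{C}^n\to\mathbb{C}$, a point $p\in\mathbb{C}^n$, multi-indices $R,S$ and $0\le\ell\le 2^m-1$ define $h_{m,\ell,R,S}(f)\in[0,\infty]$ by $$h_{0,0,R,S}(f)=\sum_{N}\frac{(2\hbar)^{|R|+|S|+|N|}}{N!}\left|\frac{\partial^{|R|+|S|+|N|}f}{\partial z^R\,\partial\bar z^{N+S}}(p)\right|^2,$$ $$h_{m,\ell,R,S}(f)=\sum_N\frac1{N!}\Big(\sum_{I\le R}\sum_{J\le N+S}\binom RI\binom{N+S}J\,h_{m-1,\lfloor\ell/2\rfloor,I,J}(f)\Big)^2\quad(\ell\text{ even}),$$ and by the same formula with $h_{m-1,\lfloor\ell/2\rfloor,J,I}$ for $\ell$ odd. Let $\mathcal{A}_\hbar$ be the space of real-analytic functions $f$ on $\mathbb{C}^n$ such that all seminorms $\|f\|_{m,\ell,R,S}=h_{m,\ell,R,S}(f)^{1/2^{m+1}}$ are finite (the base point $p$ is arbitrary). It carries the Wick star product $$f\star g=\sum_N\frac{(2\hbar)^{|N|}}{N!}\frac{\partial^{|N|}f}{\partial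 z^N}\frac{\partial^{|N|}g}{\partial\bar z^N}$$ and the involution $f\mapsto\bar f$. Let $\mathsf H_n=\mathbb{C}^n\times\mathbb{R}$ be the Heisenberg group with $(w,c)(w',c')=(w+w',c+c'+\operatorname{Im}(\bar w w'))$, and let $$u_{(w,c)}(z)=e^{-\frac{i}{2\hbar}c-\frac{\bar w w}{4\hbar}}\,e^{\frac1{2\hbar}(\bar w z-w\bar z)},\qquad u_w=u_{(w,0)},\qquad \mathrm{Ad}(u)f=u\star f\star\bar u.$$ Let $\mathcal H_{BF}$ be the Bargmann–Fock space of anti-holomorphic functions on $\mathbb{C}^n$ that are square-integrable for $(2\pi\hbar)^{-n}e^{-\bar z z/2\hbar}\,dz\,d\bar z$, with the $L^2$ inner product. For $f\in\mathcal A_\hbar$ let $\Psi_f(z)=\sum_I\frac1{I!}\frac{\partial^{|I|}f}{\partial\bar z^I}(0)\,\bar z^I$, let $\mathfrak D=\{\Psi_f: f\in\mathcal A_\hbar\}$, and let $\pi(f)\Psi_g=\Psi_{f\star g}$ be the Bargmann–Fock representation on $\mathfrak D$ (the GNS representation of the evaluation functional $\delta_0$). **Theorem.** 1. The series defining $f\star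 g$ converges absolutely at every point for $f,g\in\mathcal A_\hbar$, and $\mathcal A_\hbar$ is closed under $\star$ and complex conjugation. The series defining $\Psi_f$ converges absolutely at every point, $\mathfrak D\subseteq\mathcal H_{BF}$, and $\pi(f):\mathfrak D\to\mathfrak D$ is well defined. The map $(w,c)\mapsto u_{(w,c)}$ is a group morphism into the unitary elements of $\mathcal A_\hbar$, and $\mathsf H_n$ acts on $\mathcal A_\hbar$ by the $*$-automorphisms $\mathrm{Ad}(u_{(w,c)})=\mathrm{Ad}(u_w)=T_w^*$, where $(T_w^*f)(z)=f(z+w)$. 2. There is a strongly continuous unitary representation $U$ of $\mathsf H_n$ on $\mathcal H_{BF}$ with $U_{(w,c)}\mathfrak D=\mathfrak D$ and $U_{(w,c)}=\pi(u_{(w,c)})$ on $\mathfrak D$, given on all of $\mathcal H_{BF}$ by $$(U_{(w,c)}\psi)(z)=e^{-\frac{i}{2\hbar}c-\frac{\bar w w}{4\hbar}}\,e^{-\frac{w\bar z}{2\hbar}}\,\psi(z+w).$$ With $U_w=U_{(w,0)}$ one has $U_wU_v=e^{-\frac{i}{2\hbar}\operatorname{Im}(\bar w v)}U_{w+v}$.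 3. (Covariance) For all $(w,c)\in\mathsf H_n$ and $f\in\mathcal A_\hbar$, as operators with domain $\mathfrak D$, $$\pi(\mathrm{Ad}(u_{(w,c)})f)=U_{(w,c)}\,\pi(f)\,U_{(w,c)}^*=U_w\,\pi(f)\,U_w^*.$$ 4. (Coherent states) Put $\psi_{(w,c)}=U_{(w,c)}^{-1}1$. Then $\psi_{(w,c)}\in\mathfrak D$ and $f(w)=\langle\psi_{(w,c)},\pi(f)\psi_{(w,c)}\rangle$ for all $f\in\mathcal A_\hbar$ and $(w,c)\in\mathsf H_n$. Moreover $U_b^{-1}\psi_a=\psi_{ab}$ for $a,b\in\mathsf H_n$, so if $a=(w,c)$ and $b=(v,d)$ then $U_b^{-1}\psi_a$ has the expectation value functional $f\mapsto f(w+v)$: the action factors to the translation action on the functionals $\delta_w$. -/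

import Mathlib

open scoped ComplexConjugate ENNReal

noncomputable section

namespace WickBF

/-! ### Multi-indices -/

/-- Multi-indices `R = (r₁, …, rₙ)`, ordered componentwise. -/
abbrev MIdx (n : ℕ) : Type := Fin n → ℕ

variable {n : ℕ}

/-- `|R| = r₁ + ⋯ + rₙ` -/
def mdeg (R : MIdx n) : ℕ := ∑ i, R i

/-- `R! = r₁! ⋯ rₙ!` -/
def mfact (R : MIdx n) : ℕ := ∏ i, (R i).factorial

/-- `(R choose I) = ∏ (rᵢ choose Iᵢ)` -/
def mbinom (R I : MIdx n) : ℕ := ∏ i, (R i).choose (I i)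

/-- `z^R = z₁^{r₁} ⋯ zₙ^{rₙ}` -/
def mpow (z : Fin n → ℂ) (R : MIdx n) : ℂ := ∏ i, z i ^ R i

/-! ### Wirtinger derivatives -/

/-- `∂f/∂zⁱ = ½ (∂f/∂xⁱ - i ∂f/∂yⁱ)` -/
def dz (i : Fin n) (f : (Fin n → ℂ) → ℂ) (z : Fin n → ℂ) : ℂ :=
  (1 / 2 : ℂ) * (fderiv ℝ f z (Pi.single i 1) - Complex.I * fderiv ℝ f z (Pi.single i Complex.I))

/-- `∂f/∂z̄ⁱ = ½ (∂f/∂xⁱ + i ∂f/∂yⁱ)` -/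
def dzbar (i : Fin n) (f : (Fin n → ℂ) → ℂ) (z : Fin n → ℂ) : ℂ :=
  (1 / 2 : ℂ) * (fderiv ℝ f z (Pi.single i 1) + Complex.I * fderiv ℝ f z (Pi.single i Complex.I))

/-- `D₁^{r₁} ⋯ Dₙ^{rₙ} f` for operators `D₁, …, Dₙ` on functions. -/
def iterD (D : Fin n → ((Fin n → ℂ) → ℂ) → ((Fin n → ℂ) → ℂ)) (R : MIdx n)
    (f : (Fin n → ℂ) → ℂ) : (Fin n → ℂ) → ℂ :=
  (List.finRange n).foldr (fun i g => (D i)^[R i] g) f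

/-- `∂^{|R|+|S|} f / ∂z^R ∂z̄^S` -/
def mixedD (R S : MIdx n) (f : (Fin n → ℂ) → ℂ) : (Fin n → ℂ) → ℂ :=
  iterD dz R (iterD dzbar S f)

/-! ### The Wick algebra -/

/-- The quantities `h_{m,ℓ,R,S}(f) ∈ [0, ∞]` at the point `p`. Only `0 ≤ ℓ ≤ 2^m - 1` is used;
`ℓ / 2` is natural-number division, so it is `(ℓ - 1) / 2` for odd `ℓ`. -/
def hSeq (ħ : ℝ) (p : Fin n → ℂ) (f : (Fin n → ℂ) → ℂ) : ℕ → ℕ → MIdx n → MIdx n → ℝ≥0∞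
  | 0, _, R, S =>
      ∑' N : MIdx n, ENNReal.ofReal
        ((2 * ħ) ^ (mdeg R + mdeg S + mdeg N) / (mfact N : ℝ) * ‖mixedD R (N + S) f p‖ ^ 2)
  | m + 1, ℓ, R, S =>
      if Even ℓ then
        ∑' N : MIdx n, (mfact N : ℝ≥0∞)⁻¹ *
          (∑ I ∈ Finset.Iic R, ∑ J ∈ Finset.Iic (N + S),
            (mbinom R I : ℝ≥0∞) * (mbinom (N + S) J : ℝ≥0∞) * hSeq ħ p f m (ℓ / 2) I J) ^ 2
      else
        ∑' N : MIdx n, (mfact N : ℝ≥0∞)⁻¹ *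
          (∑ I ∈ Finset.Iic R, ∑ J ∈ Finset.Iic (N + S),
            (mbinom R I : ℝ≥0∞) * (mbinom (N + S) J : ℝ≥0∞) * hSeq ħ p f m (ℓ / 2) J I) ^ 2

/-- The seminorm `‖f‖_{m,ℓ,R,S} = h_{m,ℓ,R,S}(f)^{1/2^{m+1}} ∈ [0, ∞]`. -/
def wickSeminorm (ħ : ℝ) (p : Fin n → ℂ) (m ℓ : ℕ) (R S : MIdx n) (f : (Fin n → ℂ) → ℂ) : ℝ≥0∞ :=
  hSeq ħ p f m ℓ R S ^ (1 / (2 : ℝ) ^ (m + 1))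

/-- The algebra `𝒜_{p,ħ}`, as the space of real-analytic functions on `ℂⁿ` all of whose seminorms
at `p` are finite (each class of smooth functions with finite seminorms, modulo functions with
vanishing infinite jet at `p`, has exactly one real-analytic representative). -/
def wickAlgebra (n : ℕ) (ħ : ℝ) (p : Fin n → ℂ) : Set ((Fin n → ℂ) → ℂ) :=
  {f | AnalyticOnNhd ℝ f Set.univ ∧
    ∀ (m ℓ : ℕ), ℓ < 2 ^ m → ∀ R S : MIdx n, wickSeminorm ħ p m ℓ R S f < ∞}

/-- The `N`-th term of the Wick star product `f ⋆ g` at `z`. -/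
def wickTerm (ħ : ℝ) (f g : (Fin n → ℂ) → ℂ) (z : Fin n → ℂ) (N : MIdx n) : ℂ :=
  (2 * (ħ : ℂ)) ^ mdeg N / (mfact N : ℂ) * iterD dz N f z * iterD dzbar N g z

/-- The Wick star product
`f ⋆ g = ∑_N (2ħ)^{|N|} / N! (∂^{|N|} f / ∂z^N) (∂^{|N|} g / ∂z̄^N)`. -/
def wickMul (ħ : ℝ) (f g : (Fin n → ℂ) → ℂ) : (Fin n → ℂ) → ℂ :=
  fun z => ∑' N : MIdx n, wickTerm ħ f g z N

/-- `Ad(u) f = u ⋆ f ⋆ u*` for a unitary `u`; the involution is complex conjugation. -/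
def wickAd (ħ : ℝ) (u f : (Fin n → ℂ) → ℂ) : (Fin n → ℂ) → ℂ :=
  wickMul ħ (wickMul ħ u f) (star u)

/-! ### The Heisenberg group and its unitaries in the Wick algebra -/

/-- The Heisenberg group `H_n = ℂⁿ × ℝ`. -/
@[ext] structure Heisenberg (n : ℕ) where
  /-- the translation part -/
  w : Fin n → ℂ
  /-- the central part -/
  c : ℝ

/-- `(w, c) (w', c') = (w + w', c + c' + Im(w̄ w'))` -/
instance : Mul (Heisenberg n) :=
  ⟨fun a b => ⟨a.w + b.w, a.c + b.c + (∑ i, conj (a.w i) * b.w i).im⟩⟩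

instance : One (Heisenberg n) := ⟨⟨0, 0⟩⟩

instance : Inv (Heisenberg n) := ⟨fun a => ⟨-a.w, -a.c⟩⟩

instance : Group (Heisenberg n) :=
  Group.ofLeftAxioms
    (by
      intro a b c
      ext i
      · exact congrFun (add_assoc a.w b.w c.w) i
      · change a.c + b.c + (∑ i, conj (a.w i) * b.w i).im + c.c
            + (∑ i, conj ((a.w + b.w) i) * c.w i).im
          = a.c + (b.c + c.c + (∑ i, conj (b.w i) * c.w i).im)
            + (∑ i, conj (a.w i) * (b.w + c.w) i).im
        simp only [Pi.add_apply, map_add, add_mul, mul_add, Finset.sum_add_distrib, Complex.add_im]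
        ring)
    (by
      intro a
      ext i
      · exact congrFun (zero_add a.w) i
      · change 0 + a.c + (∑ i, conj ((0 : Fin n → ℂ) i) * a.w i).im = a.c
        simp)
    (by
      intro a
      ext i
      · exact congrFun (neg_add_cancel a.w) i
      · change -a.c + a.c + (∑ i, conj ((-a.w) i) * a.w i).im = 0
        simp [mul_comm])

/-- The topology of `ℂⁿ × ℝ`. -/
instance : TopologicalSpace (Heisenberg n) :=
  TopologicalSpace.induced (fun a => (a.w, a.c)) inferInstance

/-- `e_{a,b}(z) = exp(ħ a·b) exp(a·z + b·z̄)` -/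
def expFun (ħ : ℝ) (a b : Fin n → ℂ) : (Fin n → ℂ) → ℂ :=
  fun z => Complex.exp (ħ * ∑ i, a i * b i) * Complex.exp (∑ i, a i * z i + ∑ i, b i * conj (z i))

/-- `u_w = e_{w̄/(2ħ), -w/(2ħ)}` -/
def uTrans (ħ : ℝ) (w : Fin n → ℂ) : (Fin n → ℂ) → ℂ :=
  expFun ħ (fun i => conj (w i) / (2 * ħ)) (fun i => -(w i / (2 * ħ)))

/-- `u_{(w,c)} = exp(-i c/(2ħ)) u_w` -/
def uHeis (ħ : ℝ) (a : Heisenberg n) : (Fin n → ℂ) → ℂ :=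
  fun z => Complex.exp (-(Complex.I * a.c / (2 * ħ))) * uTrans ħ a.w z

/-! ### The Bargmann-Fock space -/

/-- Lebesgue measure with the density `(2πħ)^{-n} exp(-z̄z/(2ħ))`. -/
def gaussMeasure (n : ℕ) (ħ : ℝ) : MeasureTheory.Measure (Fin n → ℂ) :=
  MeasureTheory.volume.withDensity fun z =>
    ENNReal.ofReal (((2 * Real.pi * ħ) ^ n)⁻¹ * Real.exp (-(∑ i, ‖z i‖ ^ 2) / (2 * ħ)))

/-- `F` is anti-holomorphic on `ℂⁿ` and square-integrable for the Gaussian measure. -/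
def MemBF (ħ : ℝ) (F : (Fin n → ℂ) → ℂ) : Prop :=
  Differentiable ℂ (fun z => conj (F z)) ∧ MeasureTheory.MemLp F 2 (gaussMeasure n ħ)

/-- The Bargmann-Fock space as a space of functions. -/
def bfSubmodule (n : ℕ) (ħ : ℝ) : Submodule ℂ ((Fin n → ℂ) → ℂ) where
  carrier := {F | MemBF ħ F}
  add_mem' := by
    intro F G hF hG
    refine ⟨?_, hF.2.add hG.2⟩
    have e : (fun z => conj ((F + G) z)) = (fun z => conj (F z)) + fun z => conj (G z) := by
      funext z
      simp
    rw [e]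
    exact hF.1.add hG.1
  zero_mem' := ⟨by simp, MeasureTheory.MemLp.zero⟩
  smul_mem' := by
    intro a F hF
    refine ⟨?_, hF.2.const_smul a⟩
    have e : (fun z => conj ((a • F) z)) = fun z => conj a * conj (F z) := by
      funext z
      simp
    rw [e]
    exact hF.1.const_mul (conj a)

/-- The Bargmann-Fock space. -/
def BF (n : ℕ) (ħ : ℝ) : Type := bfSubmodule n ħ

instance (ħ : ℝ) : AddCommGroup (BF n ħ) := inferInstanceAs (AddCommGroup (bfSubmodule n ħ))

instance (ħ : ℝ) : Module ℂ (BF n ħ) := inferInstanceAs (Module ℂ (bfSubmodule n ħ))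

instance (ħ : ℝ) : CoeFun (BF n ħ) (fun _ => (Fin n → ℂ) → ℂ) := ⟨fun φ => φ.1⟩

theorem BF.continuous {ħ : ℝ} (φ : BF n ħ) : Continuous (φ : (Fin n → ℂ) → ℂ) := by
  have h := Complex.continuous_conj.comp φ.2.1.continuous
  simpa [Function.comp_def] using h

theorem BF.integrable {ħ : ℝ} (φ ψ : BF n ħ) :
    MeasureTheory.Integrable (fun z => conj (φ z) * ψ z) (gaussMeasure n ħ) :=
  MeasureTheory.MemLp.integrable_mul φ.2.2.star ψ.2.2

theorem BF.eq_zero {ħ : ℝ} (hħ : 0 < ħ) (φ : BF n ħ)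
    (h : ∫ z, conj (φ z) * φ z ∂(gaussMeasure n ħ) = 0) : φ = 0 := by
  have e : ∀ z, conj (φ z) * φ z = ((‖φ z‖ ^ 2 : ℝ) : ℂ) := by
    intro z
    rw [Complex.conj_mul']
    push_cast
    rfl
  have hi : MeasureTheory.Integrable (fun z => ‖φ z‖ ^ 2) (gaussMeasure n ħ) := by
    have := (BF.integrable φ φ).re
    simpa only [e, Complex.ofReal_re, RCLike.re_to_complex] using this
  simp only [e] at h
  rw [integral_complex_ofReal, Complex.ofReal_eq_zero,
    MeasureTheory.integral_eq_zero_iff_of_nonneg (fun z => by positivity) hi] at h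
  have hc : Continuous fun z => ‖φ z‖ ^ 2 := (BF.continuous φ).norm.pow 2
  have h2 : (fun z => ‖φ z‖ ^ 2) =ᵐ[MeasureTheory.volume] (fun _ => (0 : ℝ)) := by
    have hm : Measurable fun z : Fin n → ℂ =>
        ENNReal.ofReal (((2 * Real.pi * ħ) ^ n)⁻¹ * Real.exp (-(∑ i, ‖z i‖ ^ 2) / (2 * ħ))) := by
      fun_prop
    have h3 := (MeasureTheory.ae_withDensity_iff hm).1 h
    filter_upwards [h3] with z hz
    refine hz ?_
    have : 0 < ((2 * Real.pi * ħ) ^ n)⁻¹ * Real.exp (-(∑ i, ‖z i‖ ^ 2) / (2 * ħ)) := by positivity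
    simpa using this
  have h4 := (Continuous.ae_eq_iff_eq MeasureTheory.volume hc continuous_const).1 h2
  apply Subtype.ext
  funext z
  have h5 : ‖φ z‖ ^ 2 = 0 := congrFun h4 z
  exact norm_eq_zero.1 (pow_eq_zero_iff (two_ne_zero) |>.1 h5)

/-- The `L²` inner product `⟨φ, ψ⟩ = ∫ conj(φ) ψ` for the Gaussian measure. -/
@[reducible] def bfCore (n : ℕ) (ħ : ℝ) [hħ : Fact (0 < ħ)] : InnerProductSpace.Core ℂ (BF n ħ) where
  inner φ ψ := ∫ z, conj (φ z) * ψ z ∂(gaussMeasure n ħ)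
  conj_inner_symm φ ψ := by
    change conj (∫ z, conj (ψ z) * φ z ∂(gaussMeasure n ħ)) = _
    rw [← integral_conj]
    congr 1
    funext z
    simp [mul_comm]
  re_inner_nonneg φ := by
    rw [← integral_re (BF.integrable φ φ)]
    refine MeasureTheory.integral_nonneg fun z => ?_
    change 0 ≤ RCLike.re (conj (φ z) * φ z)
    rw [Complex.conj_mul', ← Complex.ofReal_pow, RCLike.re_to_complex, Complex.ofReal_re]
    exact sq_nonneg _
  add_left φ ψ χ := by
    change ∫ z, conj (φ z + ψ z) * χ z ∂(gaussMeasure n ħ) = _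
    simp only [map_add, add_mul]
    exact MeasureTheory.integral_add (BF.integrable φ χ) (BF.integrable ψ χ)
  smul_left φ ψ r := by
    change ∫ z, conj (r * φ z) * ψ z ∂(gaussMeasure n ħ) = _
    simp only [map_mul, mul_assoc]
    exact MeasureTheory.integral_const_mul _ _
  definite φ h := BF.eq_zero hħ.out φ h

instance (ħ : ℝ) [Fact (0 < ħ)] : NormedAddCommGroup (BF n ħ) :=
  (bfCore n ħ).toNormedAddCommGroup

instance (ħ : ℝ) [Fact (0 < ħ)] : InnerProductSpace ℂ (BF n ħ) :=
  InnerProductSpace.ofCore (bfCore n ħ).toCore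

theorem memBF_one {ħ : ℝ} (hħ : 0 < ħ) : MemBF ħ (fun _ : Fin n → ℂ => (1 : ℂ)) := by
  refine ⟨by simp, ?_⟩
  have hb : 0 < ((1 / (2 * ħ) : ℝ) : ℂ).re := by
    rw [Complex.ofReal_re]
    positivity
  have h1 : MeasureTheory.Integrable (fun x : ℂ => Real.exp (-(1 / (2 * ħ)) * ‖x‖ ^ 2)) := by
    have := (GaussianFourier.integrable_cexp_neg_mul_sq_norm_add (V := ℂ) hb 0 0).norm
    refine this.congr (Filter.Eventually.of_forall fun x => ?_)
    simp only [inner_zero_left, Complex.ofReal_zero, mul_zero, add_zero, Complex.norm_exp]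
    congr 1
    rw [← Complex.ofReal_pow, ← Complex.ofReal_neg, ← Complex.ofReal_mul, Complex.ofReal_re]
  have h2 : MeasureTheory.Integrable
      (fun z : Fin n → ℂ => ∏ i, Real.exp (-(1 / (2 * ħ)) * ‖z i‖ ^ 2)) :=
    MeasureTheory.Integrable.fintype_prod (fun _ => h1)
  have h3 : MeasureTheory.Integrable (fun z : Fin n → ℂ =>
      ((2 * Real.pi * ħ) ^ n)⁻¹ * Real.exp (-(∑ i, ‖z i‖ ^ 2) / (2 * ħ))) := by
    refine (h2.const_mul ((2 * Real.pi * ħ) ^ n)⁻¹).congr (Filter.Eventually.of_forall fun z => ?_)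
    simp only
    rw [← Real.exp_sum, ← Finset.mul_sum]
    congr 2
    ring
  have : MeasureTheory.IsFiniteMeasure (gaussMeasure n ħ) :=
    MeasureTheory.isFiniteMeasure_withDensity_ofReal h3.2
  exact MeasureTheory.memLp_const 1

/-- The vacuum vector `ψ₁ = 1`. -/
def vacuum (n : ℕ) (ħ : ℝ) [hħ : Fact (0 < ħ)] : BF n ħ := ⟨fun _ => 1, memBF_one hħ.out⟩

open Classical in
/-- A function in the Bargmann-Fock space as an element of it (`0` for other functions). -/
def toBF (ħ : ℝ) (F : (Fin n → ℂ) → ℂ) : BF n ħ := if h : MemBF ħ F then ⟨F, h⟩ else 0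

/-! ### The Bargmann-Fock representation -/

/-- The `I`-th term `(1/I!) (∂^{|I|} f / ∂z̄^I)(0) z̄^I` of the anti-holomorphic Taylor series. -/
def psiTerm (f : (Fin n → ℂ) → ℂ) (z : Fin n → ℂ) (I : MIdx n) : ℂ :=
  (mfact I : ℂ)⁻¹ * iterD dzbar I f 0 * mpow (fun i => conj (z i)) I

/-- The anti-holomorphic Taylor expansion `Ψ_f` at `0`. -/
def Psi (f : (Fin n → ℂ) → ℂ) : (Fin n → ℂ) → ℂ := fun z => ∑' I : MIdx n, psiTerm f z I

/-- The common domain `𝔇 = {Ψ_f | f ∈ 𝒜}` inside the Bargmann-Fock space. -/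
def bfDomain (n : ℕ) (ħ : ℝ) (p : Fin n → ℂ) : Set (BF n ħ) :=
  {φ | ∃ f ∈ wickAlgebra n ħ p, (φ : (Fin n → ℂ) → ℂ) = Psi f}

/-- The Bargmann-Fock representation on `𝔇`: `π(f) φ = Ψ_{f ⋆ φ}`, which is the GNS representation
`π(f) Ψ_g = Ψ_{f ⋆ g}` of the functional `δ₀` (take `g = φ`, as `Ψ_φ = φ`). -/
def bfRep (ħ : ℝ) (f : (Fin n → ℂ) → ℂ) (φ : BF n ħ) : BF n ħ := toBF ħ (Psi (wickMul ħ f φ))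

/-- `φ = U⁻¹ ψ₁ = U* ψ₁`, the coherent state vector `ψ_{(w,c)}` at `a = (w, c)`. -/
def coherentVector {ħ : ℝ} [Fact (0 < ħ)] (U : Heisenberg n →* (BF n ħ ≃ₗᵢ[ℂ] BF n ħ))
    (a : Heisenberg n) : BF n ħ := (U a).symm (vacuum n ħ)

end WickBF

end

open WickBF

set_option linter.unusedSectionVars false

noncomputable section

namespace WickBF

/-! The proof rests on a description of the algebra free of ħ and of the base point
(`mem_wickAlgebra_iff`): it consists of the functions $z\mapsto F(z,\bar z)$, where $F$ is entire on
$\mathbb{C}^n\times\mathbb{C}^n$ and its Taylor coefficients $c_x$ (normalised by $x!$) satisfy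
$|c_x|\le C_\varepsilon(|x|!)^\varepsilon$ for every $\varepsilon>0$. Finite seminorms force this
growth because a step of the recursion dominates a square: $h_m^2\le h_{m+1}$, together with $h_m\le
C\,R!\,S!$ up to squares, gives $h_0^{2^{k+1}}\le C\,R!\,S!$ for every $k$ (`hSeq_pow_le`).
Conversely the recursion preserves subfactorial growth (`hSeq_bound`), and a real-analytic function
is determined by its Wirtinger jet at one point (`eq_zero_of_mixedD_eq_zero`).

On coefficients, differentiation is an index shift, translation is `recenter`, pointwise
multiplication is `conv` and the star product is `starCoef`; all preserve the growth class. Both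
bracketings of a threefold product are one absolutely convergent sum over the contractions between
pairs of factors, hence associativity (`wickMul_assoc`).

Exponentials are joint eigenfunctions of all Wirtinger derivatives. In $u\star f\star\bar u$ the
contractions between $u$ and $\bar u$ sum to a scalar cancelling $u\bar u$, and the remaining ones
sum to the Taylor series of $f(z+w)$ (`wickAd_uHeis`). All automorphism properties are then
properties of translations.

$\Psi_f$ is $F(0,\bar z)$. It is square-integrable because $F$ grows slower than every Gaussian, and
$\ker\Psi$ is a left ideal (`Psi_wickMul_Psi`), so $\pi$ is multiplicative. Computing
$\pi(u_{(w,c)})$ on $\mathfrak D$ yields a formula that makes sense on all of $\mathcal H_{BF}$; it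
is isometric because it translates $|\psi|^2$ times the Gaussian density. Covariance is then
multiplicativity of $\pi$ applied to $u\star f\star\bar u$. Since the vacuum evaluates at the origin
(`inner_vacuum`), covariance turns the coherent expectation value into $f(w)$. -/

open Finset in
instance instHasAntidiagonalMultiIndex {ι : Type*} [Fintype ι] [DecidableEq ι] :
    HasAntidiagonal (ι → ℕ) := HasAntidiagonal.antidiagonalOfLocallyFinite

/-! ### Factorial weights -/

/-- The weight `(k!)^ε`. -/
def wt (ε : ℝ) (k : ℕ) : ℝ := (k.factorial : ℝ) ^ ε

theorem wt_pos (ε : ℝ) (k : ℕ) : 0 < wt ε k :=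
  Real.rpow_pos_of_pos (by exact_mod_cast k.factorial_pos) _

theorem wt_add_exponent (ε δ : ℝ) (k : ℕ) : wt (ε + δ) k = wt ε k * wt δ k :=
  Real.rpow_add (by exact_mod_cast k.factorial_pos) _ _

theorem wt_le_wt {ε δ : ℝ} (h : ε ≤ δ) (k : ℕ) : wt ε k ≤ wt δ k :=
  Real.rpow_le_rpow_of_exponent_le (by exact_mod_cast k.factorial_pos) h

/-- Raise $x^k/k!\le e^x$ at $x=A^{1/\varepsilon}$ to the power $\varepsilon$. Geometric factors are
thereby absorbed into an arbitrarily small power of the factorial. -/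
theorem pow_le_wt {ε A : ℝ} (hε : 0 < ε) (hA : 0 ≤ A) :
    ∃ C, 0 < C ∧ ∀ k : ℕ, A ^ k ≤ C * wt ε k := by
  refine ⟨Real.exp (A ^ (1 / ε)) ^ ε, by positivity, fun k => ?_⟩
  have h := Real.pow_div_factorial_le_exp (x := A ^ (1 / ε)) (by positivity) k
  have hk : (0 : ℝ) < k.factorial := by exact_mod_cast k.factorial_pos
  rw [div_le_iff₀ hk] at h
  have h2 := Real.rpow_le_rpow (by positivity) h hε.le
  rw [Real.mul_rpow (by positivity) hk.le] at h2
  refine le_trans (le_of_eq ?_) h2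
  rw [← Real.rpow_natCast, ← Real.rpow_natCast, ← Real.rpow_mul hA, ← Real.rpow_mul hA]
  congr 1
  field_simp

theorem wt_mul_le {ε : ℝ} (hε : 0 ≤ ε) (k l : ℕ) : wt ε k * wt ε l ≤ wt ε (k + l) := by
  unfold wt
  rw [← Real.mul_rpow (by positivity) (by positivity)]
  refine Real.rpow_le_rpow (by positivity) ?_ hε
  exact_mod_cast Nat.le_of_dvd (Nat.factorial_pos _) (Nat.factorial_mul_factorial_dvd_factorial_add k l)

theorem factorial_add_le (k l : ℕ) :
    ((k + l).factorial : ℝ) ≤ 2 ^ (k + l) * (k.factorial * l.factorial) := by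
  have h1 : (k + l).choose k * (k.factorial * l.factorial) = (k + l).factorial := by
    have := Nat.choose_mul_factorial_mul_factorial (Nat.le_add_right k l)
    rwa [Nat.add_sub_cancel_left, mul_assoc] at this
  have h2 : (k + l).choose k ≤ 2 ^ (k + l) := Nat.choose_le_two_pow _ _
  rw [← h1]
  push_cast
  gcongr
  exact_mod_cast h2

/-- A binomial coefficient is at most $2^{k+l}$, and this geometric factor is paid for by a second
copy of each weight; hence the doubled exponent. -/
theorem wt_add_le {ε : ℝ} (hε : 0 < ε) :
    ∃ C, 0 < C ∧ ∀ k l : ℕ, wt ε (k + l) ≤ C * (wt (2 * ε) k * wt (2 * ε) l) := by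
  obtain ⟨C, hC, h⟩ := pow_le_wt hε (A := 2 ^ ε) (by positivity)
  refine ⟨C * C, by positivity, fun k l => ?_⟩
  have h1 : wt ε (k + l) ≤ (2 ^ ε) ^ k * (2 ^ ε) ^ l * (wt ε k * wt ε l) := by
    have := Real.rpow_le_rpow (by positivity) (factorial_add_le k l) hε.le
    rw [Real.mul_rpow (by positivity) (by positivity), Real.mul_rpow (by positivity)
      (by positivity)] at this
    refine this.trans_eq ?_
    rw [← pow_add, ← Real.rpow_natCast, ← Real.rpow_natCast, ← Real.rpow_mul (by norm_num),
      ← Real.rpow_mul (by norm_num), mul_comm ε]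
    rfl
  refine h1.trans ?_
  have hk := wt_pos ε k
  have hl := wt_pos ε l
  rw [two_mul, wt_add_exponent, wt_add_exponent]
  calc (2 ^ ε) ^ k * (2 ^ ε) ^ l * (wt ε k * wt ε l)
      ≤ (C * wt ε k) * (C * wt ε l) * (wt ε k * wt ε l) := by
        gcongr
        · exact h k
        · exact h l
    _ = _ := by ring

/-! ### Multi-indices -/

variable {ι : Type*} [Fintype ι]

/-- The length of a multi-index. -/
def tdeg (x : ι → ℕ) : ℕ := ∑ i, x i

/-- The factorial of a multi-index. -/
def tfact (x : ι → ℕ) : ℕ := ∏ i, (x i).factorial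

/-- The divided power `v^x / x!`. -/
def dpow (v : ι → ℂ) (x : ι → ℕ) : ℂ := ∏ i, (v i ^ x i / ((x i).factorial : ℂ))

theorem tdeg_add (x y : ι → ℕ) : tdeg (x + y) = tdeg x + tdeg y := by
  simp [tdeg, Finset.sum_add_distrib]

@[simp] theorem tdeg_zero : tdeg (0 : ι → ℕ) = 0 := by simp [tdeg]

@[simp] theorem tfact_zero : tfact (0 : ι → ℕ) = 1 := by simp [tfact]

theorem tfact_pos (x : ι → ℕ) : 0 < tfact x := Finset.prod_pos fun _ _ => Nat.factorial_pos _

theorem tfact_ne_zero (x : ι → ℕ) : (tfact x : ℂ) ≠ 0 := by exact_mod_cast (tfact_pos x).ne'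

theorem dpow_eq (v : ι → ℂ) (x : ι → ℕ) : dpow v x = (∏ i, v i ^ x i) / tfact x := by
  simp [dpow, tfact, Finset.prod_div_distrib]

@[simp] theorem dpow_index_zero (v : ι → ℂ) : dpow v 0 = 1 := by simp [dpow]

theorem dpow_zero [DecidableEq ι] (x : ι → ℕ) : dpow 0 x = if x = 0 then 1 else 0 := by
  split_ifs with h
  · simp [h]
  · obtain ⟨i, hi⟩ := Function.ne_iff.1 h
    have hi' : x i ≠ 0 := hi
    exact Finset.prod_eq_zero (Finset.mem_univ i) (by simp [hi'])

theorem norm_dpow_le {v : ι → ℂ} {A : ℝ} (hv : ∀ i, ‖v i‖ ≤ A) (x : ι → ℕ) :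
    ‖dpow v x‖ ≤ A ^ tdeg x / tfact x := by
  rw [dpow_eq, norm_div, norm_prod, Complex.norm_natCast, tdeg, ← Finset.prod_pow_eq_pow_sum]
  gcongr with i
  rw [norm_pow]
  gcongr
  exact hv i

theorem tfact_le (x : ι → ℕ) : tfact x ≤ (tdeg x).factorial :=
  Nat.le_of_dvd (Nat.factorial_pos _) (Nat.prod_factorial_dvd_factorial_sum _ _)

/-- The multinomial coefficient $|x|!/x!$ is one summand in the expansion of $(1+\dots+1)^{|x|}$. -/
theorem factorial_tdeg_le [DecidableEq ι] (x : ι → ℕ) :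
    (tdeg x).factorial ≤ Fintype.card ι ^ tdeg x * tfact x := by
  have h := Nat.multinomial_spec Finset.univ x
  have h2 := Finset.sum_pow_eq_sum_piAntidiag (R := ℕ) Finset.univ (fun _ : ι => 1) (tdeg x)
  simp only [Finset.sum_const, smul_eq_mul, mul_one, one_pow, Finset.prod_const_one,
    Nat.cast_id] at h2
  change tfact x * _ = (tdeg x).factorial at h
  rw [← h, mul_comm]
  gcongr
  rw [← Finset.card_univ, h2]
  exact Finset.single_le_sum (f := fun y => Nat.multinomial Finset.univ y)
    (fun _ _ => Nat.zero_le _) (by simp [tdeg])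

/-- The cubes $\{x : x_i<N\}$ are cofinal among finite sets of multi-indices, and over a cube the
sum of products is a product of sums. -/
theorem hasSum_prod_pi [DecidableEq ι] {f : ι → ℕ → ℂ} (hf : ∀ i, Summable fun k => ‖f i k‖) :
    (Summable fun x : ι → ℕ => ‖∏ i, f i (x i)‖) ∧
      HasSum (fun x : ι → ℕ => ∏ i, f i (x i)) (∏ i, ∑' k, f i k) := by
  have key : ∀ N, ∀ g : ι → ℕ → ℝ, ∑ x ∈ Fintype.piFinset fun _ : ι => Finset.range N, ∏ i, g i (x i)
      = ∏ i, ∑ k ∈ Finset.range N, g i k := fun N g => (Finset.prod_univ_sum _ _).symm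
  have hcof : Filter.Tendsto (fun N : ℕ => Fintype.piFinset fun _ : ι => Finset.range N)
      Filter.atTop Filter.atTop := by
    refine Filter.tendsto_atTop_finset_of_monotone ?_ ?_
    · intro a b h
      exact Fintype.piFinset_subset _ _ fun _ => Finset.range_mono h
    · intro x
      refine ⟨tdeg x + 1, ?_⟩
      simp only [Fintype.mem_piFinset, Finset.mem_range]
      intro i
      exact Nat.lt_succ_of_le (Finset.single_le_sum (f := x) (fun _ _ => Nat.zero_le _)
        (Finset.mem_univ i))
  have hs : Summable fun x : ι → ℕ => ‖∏ i, f i (x i)‖ := by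
    refine summable_of_sum_le (c := ∏ i, ∑' k, ‖f i k‖) (fun _ => norm_nonneg _) fun u => ?_
    obtain ⟨N, hN⟩ := (hcof.eventually (Filter.eventually_ge_atTop u)).exists
    calc ∑ x ∈ u, ‖∏ i, f i (x i)‖
        ≤ ∑ x ∈ Fintype.piFinset fun _ : ι => Finset.range N, ‖∏ i, f i (x i)‖ :=
          Finset.sum_le_sum_of_subset_of_nonneg hN fun _ _ _ => norm_nonneg _
      _ = ∏ i, ∑ k ∈ Finset.range N, ‖f i k‖ := by
          rw [← key]
          simp only [norm_prod]
      _ ≤ _ := Finset.prod_le_prod (fun _ _ => Finset.sum_nonneg fun _ _ => norm_nonneg _)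
          fun i _ => (hf i).sum_le_tsum _ fun _ _ => norm_nonneg _
  refine ⟨hs, ?_⟩
  have h1 := hs.of_norm.hasSum.comp hcof
  have h2 : Filter.Tendsto (fun N => ∏ i, ∑ k ∈ Finset.range N, f i k) Filter.atTop
      (nhds (∏ i, ∑' k, f i k)) :=
    tendsto_finsetProd _ fun i _ => ((hf i).of_norm.hasSum.tendsto_sum_nat)
  have h3 := tendsto_nhds_unique h1 (by
    refine h2.congr fun N => ?_
    exact Finset.prod_univ_sum _ _)
  rw [← h3]
  exact hs.of_norm.hasSum

theorem hasSum_dpow [DecidableEq ι] (v : ι → ℂ) : HasSum (dpow v) (Complex.exp (∑ i, v i)) := by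
  have h := (hasSum_prod_pi (f := fun i k => v i ^ k / (k.factorial : ℂ))
    fun i => NormedSpace.norm_expSeries_div_summable (v i)).2
  rw [Complex.exp_sum]
  simp only [Complex.exp_eq_exp_ℂ, NormedSpace.exp_eq_tsum_div]
  exact h

/-- The convergence criterion behind every series below: any exponent below one is beaten by $1/x!$.
All later numerical exponents are chosen to stay under this threshold. -/
theorem summable_wt [DecidableEq ι] {ε A : ℝ} (hε : ε < 1) (hA : 0 ≤ A) :
    Summable fun x : ι → ℕ => wt ε (tdeg x) * (A ^ tdeg x / tfact x) := by
  -- The cardinality pays for replacing $|x|!$ by $x!$; the factor 2 leaves the summable majorant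
  -- $2^{-|x|}$.
  set B : ℝ := Fintype.card ι * A * 2 with hB
  obtain ⟨C, hC, h⟩ := pow_le_wt (sub_pos.2 hε) (A := B) (by positivity)
  have hg : Summable fun x : ι → ℕ => (1 / 2 : ℝ) ^ tdeg x := by
    have := (hasSum_prod_pi (ι := ι) (f := fun _ k => (1 / 2 : ℂ) ^ k) fun i => by
      simpa using summable_geometric_two).1
    refine this.congr fun x => ?_
    rw [tdeg, ← Finset.prod_pow_eq_pow_sum, norm_prod]
    simp
  refine Summable.of_nonneg_of_le (fun x => ?_) (fun x => ?_) (hg.mul_left C)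
  · have := wt_pos ε (tdeg x)
    positivity
  · have hw := wt_pos ε (tdeg x)
    have hf : (0 : ℝ) < tfact x := by exact_mod_cast tfact_pos x
    have h1 : wt ε (tdeg x) * wt (1 - ε) (tdeg x) = (tdeg x).factorial := by
      rw [← wt_add_exponent]
      simp [wt]
    have h2 : ((tdeg x).factorial : ℝ) ≤ Fintype.card ι ^ tdeg x * tfact x := by
      exact_mod_cast factorial_tdeg_le x
    have h3 := h (tdeg x)
    have hfd : (0 : ℝ) < (tdeg x).factorial := by exact_mod_cast Nat.factorial_pos _
    rw [mul_div_assoc', div_le_iff₀ hf]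
    set k := tdeg x
    have h4 : wt ε k * B ^ k ≤ C * (Fintype.card ι ^ k * tfact x) := by
      calc wt ε k * B ^ k ≤ wt ε k * (C * wt (1 - ε) k) := by gcongr
        _ = C * (wt ε k * wt (1 - ε) k) := by ring
        _ ≤ _ := by rw [h1]; gcongr
    rcases Nat.eq_zero_or_pos (Fintype.card ι) with h0 | h0
    · have hk : k = 0 := by
        have := Fintype.card_eq_zero_iff.1 h0
        simp [k, tdeg]
      rw [hk] at h4 ⊢
      simpa using h4
    · have hc : (0 : ℝ) < (Fintype.card ι : ℝ) ^ k := by positivity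
      have h5 : (Fintype.card ι : ℝ) ^ k * (wt ε k * A ^ k * 2 ^ k) ≤
          (Fintype.card ι : ℝ) ^ k * (C * tfact x) := by
        rw [hB, mul_pow, mul_pow] at h4
        linarith
      have h6 := le_of_mul_le_mul_left h5 hc
      rw [one_div, inv_pow]
      have h2k : (0 : ℝ) < 2 ^ k := by positivity
      rw [show C * ((2 : ℝ) ^ k)⁻¹ * tfact x = C * tfact x / 2 ^ k by field_simp, le_div_iff₀ h2k]
      exact h6

/-! ### The binomial theorem for divided powers. -/

theorem prod_sum_antidiagonal [DecidableEq ι] {R : Type*} [CommSemiring R] (x : ι → ℕ)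
    (F : ι → ℕ → ℕ → R) :
    ∏ i, ∑ p ∈ Finset.HasAntidiagonal.antidiagonal (x i), F i p.1 p.2 =
      ∑ q ∈ Finset.HasAntidiagonal.antidiagonal x, ∏ i, F i (q.1 i) (q.2 i) := by
  rw [Finset.prod_univ_sum]
  refine Finset.sum_nbij' (fun p => (fun i => (p i).1, fun i => (p i).2))
    (fun q i => (q.1 i, q.2 i)) ?_ ?_ ?_ ?_ ?_
  · intro p hp
    simp only [Fintype.mem_piFinset, Finset.HasAntidiagonal.mem_antidiagonal] at hp ⊢
    exact funext hp
  · intro q hq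
    simp only [Fintype.mem_piFinset, Finset.HasAntidiagonal.mem_antidiagonal] at hq ⊢
    exact congrFun hq
  · intro p _
    rfl
  · intro q _
    rfl
  · intro p _
    rfl

theorem dpow_add [DecidableEq ι] (u v : ι → ℂ) (x : ι → ℕ) :
    dpow (u + v) x = ∑ q ∈ Finset.HasAntidiagonal.antidiagonal x, dpow u q.1 * dpow v q.2 := by
  have h : ∀ i, (u + v) i ^ x i / ((x i).factorial : ℂ) = ∑ p ∈ Finset.HasAntidiagonal.antidiagonal (x i),
      (u i ^ p.1 / (p.1.factorial : ℂ)) * (v i ^ p.2 / (p.2.factorial : ℂ)) := by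
    intro i
    rw [Pi.add_apply, add_pow, Finset.sum_div, Finset.Nat.sum_antidiagonal_eq_sum_range_succ
      (fun a b => (u i ^ a / (a.factorial : ℂ)) * (v i ^ b / (b.factorial : ℂ)))]
    refine Finset.sum_congr rfl fun k hk => ?_
    have hk' : k ≤ x i := Nat.lt_succ_iff.1 (Finset.mem_range.1 hk)
    rw [Nat.cast_choose ℂ hk']
    have := Nat.cast_ne_zero (R := ℂ).2 (Nat.factorial_ne_zero (x i))
    have := Nat.cast_ne_zero (R := ℂ).2 (Nat.factorial_ne_zero k)
    have := Nat.cast_ne_zero (R := ℂ).2 (Nat.factorial_ne_zero (x i - k))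
    field_simp
  simp only [dpow, h]
  rw [prod_sum_antidiagonal x fun i a b =>
    (u i ^ a / (a.factorial : ℂ)) * (v i ^ b / (b.factorial : ℂ))]
  simp only [Finset.prod_mul_distrib]

theorem dpow_mul_dpow [DecidableEq ι] (v : ι → ℂ) (x y : ι → ℕ) :
    dpow v x * dpow v y = (tfact (x + y) / (tfact x * tfact y) : ℂ) * dpow v (x + y) := by
  rw [dpow_eq, dpow_eq, dpow_eq]
  have := tfact_ne_zero (x + y)
  have := tfact_ne_zero x
  have := tfact_ne_zero y
  simp only [Pi.add_apply, pow_add, Finset.prod_mul_distrib]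
  field_simp

theorem sum_antidiagonal_tfact [DecidableEq ι] (x : ι → ℕ) :
    ∑ q ∈ Finset.HasAntidiagonal.antidiagonal x, (tfact x / (tfact q.1 * tfact q.2) : ℝ) = 2 ^ tdeg x := by
  have h := dpow_add (fun _ : ι => 1) (fun _ => 1) x
  simp only [dpow_eq, one_pow, Finset.prod_const_one, Pi.add_apply,
    one_add_one_eq_two] at h
  have hx := tfact_ne_zero x
  rw [div_eq_iff hx, Finset.prod_pow_eq_pow_sum] at h
  apply Complex.ofReal_injective
  push_cast
  rw [tdeg, h, Finset.sum_mul]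
  refine Finset.sum_congr rfl fun q _ => ?_
  ring

variable {ι : Type*} [Fintype ι]

/-! ### Entire functions given by Taylor coefficients of subfactorial growth -/

/-- A family of Taylor coefficients growing slower than every positive power of the factorial. -/
def Growth (c : (ι → ℕ) → ℂ) : Prop :=
  ∀ ε : ℝ, 0 < ε → ∃ C : ℝ, 0 < C ∧ ∀ x, ‖c x‖ ≤ C * wt ε (tdeg x)

/-- The entire function with Taylor coefficients `c` at the origin. -/
def taylorSum (c : (ι → ℕ) → ℂ) (v : ι → ℂ) : ℂ := ∑' x, c x * dpow v x

variable [DecidableEq ι]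

/-- Separating the two indices makes double series factor into products of single ones. The
hypothesis is used at $\varepsilon/2$ because splitting a weight doubles its exponent. -/
theorem Growth.shift_bound {c : (ι → ℕ) → ℂ} (hc : Growth c) {ε : ℝ} (hε : 0 < ε) :
    ∃ C, 0 < C ∧ ∀ x y, ‖c (x + y)‖ ≤ C * (wt ε (tdeg x) * wt ε (tdeg y)) := by
  obtain ⟨C, hC, h⟩ := hc (ε / 2) (by positivity)
  obtain ⟨D, hD, h'⟩ := wt_add_le (ε := ε / 2) (by positivity)
  refine ⟨C * D, by positivity, fun x y => (h _).trans ?_⟩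
  rw [tdeg_add, mul_assoc]
  have := h' (tdeg x) (tdeg y)
  rw [mul_div_cancel₀ ε two_ne_zero] at this
  gcongr

theorem Growth.shift {c : (ι → ℕ) → ℂ} (hc : Growth c) (y : ι → ℕ) :
    Growth fun x => c (x + y) := by
  intro ε hε
  obtain ⟨C, hC, h⟩ := hc.shift_bound hε
  have := wt_pos ε (tdeg y)
  refine ⟨C * wt ε (tdeg y), by positivity, fun x => (h x y).trans_eq (by ring)⟩

theorem Growth.summable_shift_bound {c : (ι → ℕ) → ℂ} (hc : Growth c) (u v : ι → ℂ) :
    Summable fun p : (ι → ℕ) × (ι → ℕ) => ‖c (p.1 + p.2) * (dpow u p.1 * dpow v p.2)‖ := by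
  obtain ⟨C, hC, h⟩ := hc.shift_bound (ε := 1 / 2) (by norm_num)
  have hs := fun w : ι → ℂ => summable_wt (ι := ι) (ε := 1 / 2) (A := ‖w‖) (by norm_num)
    (norm_nonneg _)
  have hnn : ∀ (w : ι → ℂ) (x : ι → ℕ),
      0 ≤ wt (1 / 2) (tdeg x) * (‖w‖ ^ tdeg x / tfact x) := fun w x => by
    have := wt_pos (1 / 2) (tdeg x)
    positivity
  refine Summable.of_nonneg_of_le (fun _ => norm_nonneg _) (fun p => ?_)
    (((hs u).mul_of_nonneg (hs v) (hnn u) (hnn v)).mul_left C)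
  have h1 := norm_dpow_le (fun i => norm_le_pi_norm u i) p.1
  have h2 := norm_dpow_le (fun i => norm_le_pi_norm v i) p.2
  rw [norm_mul, norm_mul]
  have hw1 := wt_pos (1 / 2) (tdeg p.1)
  have hw2 := wt_pos (1 / 2) (tdeg p.2)
  calc _ ≤ C * (wt (1 / 2) (tdeg p.1) * wt (1 / 2) (tdeg p.2)) *
        ((‖u‖ ^ tdeg p.1 / tfact p.1) * (‖v‖ ^ tdeg p.2 / tfact p.2)) := by
        gcongr
        exact h _ _
    _ = _ := by ring

theorem Growth.summable_norm {c : (ι → ℕ) → ℂ} (hc : Growth c) (v : ι → ℂ) :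
    Summable fun x => ‖c x * dpow v x‖ := by
  have h := (hc.summable_shift_bound v 0).comp_injective
    (i := fun x : ι → ℕ => (x, (0 : ι → ℕ))) (fun a b h => (Prod.ext_iff.1 h).1)
  simpa [Function.comp_def] using h

theorem Growth.summable {c : (ι → ℕ) → ℂ} (hc : Growth c) (v : ι → ℂ) :
    Summable fun x => c x * dpow v x := (hc.summable_norm v).of_norm

theorem tsum_eq_tsum_sum_antidiagonal {F : (ι → ℕ) × (ι → ℕ) → ℂ} (hF : Summable F) :
    ∑' p, F p = ∑' x, ∑ q ∈ Finset.HasAntidiagonal.antidiagonal x, F q := by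
  have hs := (Finset.HasAntidiagonal.sigmaAntidiagonalEquivProd (A := ι → ℕ)).summable_iff.2 hF
  rw [← (Finset.HasAntidiagonal.sigmaAntidiagonalEquivProd (A := ι → ℕ)).tsum_eq F]
  refine (hs.tsum_sigma' fun x => (hasSum_fintype _).summable).trans ?_
  refine tsum_congr fun x => ?_
  rw [tsum_fintype]
  exact Finset.sum_coe_sort (Finset.HasAntidiagonal.antidiagonal x) F

/-- The Taylor coefficients at the point `u`. -/
def recenter (c : (ι → ℕ) → ℂ) (u : ι → ℂ) (x : ι → ℕ) : ℂ := taylorSum (fun y => c (y + x)) u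

theorem Growth.recenter {c : (ι → ℕ) → ℂ} (hc : Growth c) (u : ι → ℂ) :
    Growth (recenter c u) := by
  intro ε hε
  -- The cap keeps the exponent below one, so that the series over $y$ converges.
  set δ := min ε (1 / 2)
  have hδ : 0 < δ := by positivity
  obtain ⟨C, hC, h⟩ := hc.shift_bound hδ
  have hs := summable_wt (ι := ι) (ε := δ) (A := ‖u‖)
    ((min_le_right _ _).trans_lt (by norm_num)) (norm_nonneg _)
  have hnn : ∀ x : ι → ℕ, 0 ≤ wt δ (tdeg x) * (‖u‖ ^ tdeg x / tfact x) := fun x => by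
    have := wt_pos δ (tdeg x)
    positivity
  have hS : 0 ≤ ∑' x : ι → ℕ, wt δ (tdeg x) * (‖u‖ ^ tdeg x / tfact x) := tsum_nonneg hnn
  refine ⟨C * (∑' x : ι → ℕ, wt δ (tdeg x) * (‖u‖ ^ tdeg x / tfact x) + 1), by positivity,
    fun x => ?_⟩
  have hx := wt_pos δ (tdeg x)
  have hb : ∀ y, ‖c (y + x) * dpow u y‖ ≤
      C * wt δ (tdeg x) * (wt δ (tdeg y) * (‖u‖ ^ tdeg y / tfact y)) := fun y => by
    have h1 := norm_dpow_le (fun i => norm_le_pi_norm u i) y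
    have hy := wt_pos δ (tdeg y)
    rw [norm_mul]
    calc _ ≤ C * (wt δ (tdeg y) * wt δ (tdeg x)) * (‖u‖ ^ tdeg y / tfact y) := by
          gcongr
          exact h _ _
      _ = _ := by ring
  have h2 := tsum_of_norm_bounded (hs.mul_left (C * wt δ (tdeg x))).hasSum hb
  rw [tsum_mul_left] at h2
  refine h2.trans ?_
  have h3 := wt_le_wt (min_le_left ε (1 / 2)) (tdeg x)
  calc _ ≤ C * wt ε (tdeg x) * (∑' x : ι → ℕ, wt δ (tdeg x) * (‖u‖ ^ tdeg x / tfact x) + 1) := by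
        have := wt_pos ε (tdeg x)
        gcongr
        linarith
    _ = _ := by ring

/-- Re-expansion of an entire function at $u$: expand the divided powers of $u+v$ binomially and
reorder an absolutely convergent double series. -/
theorem taylorSum_add {c : (ι → ℕ) → ℂ} (hc : Growth c) (u v : ι → ℂ) :
    taylorSum c (u + v) = taylorSum (recenter c u) v := by
  have hs := hc.summable_shift_bound u v
  have h1 := tsum_eq_tsum_sum_antidiagonal hs.of_norm
  have h2 : taylorSum c (u + v) = ∑' x, ∑ q ∈ Finset.HasAntidiagonal.antidiagonal x,
      c (q.1 + q.2) * (dpow u q.1 * dpow v q.2) := by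
    refine tsum_congr fun x => ?_
    rw [dpow_add, Finset.mul_sum]
    refine Finset.sum_congr rfl fun q hq => ?_
    rw [Finset.HasAntidiagonal.mem_antidiagonal.1 hq]
  rw [h2, ← h1, ← (Equiv.prodComm _ _).tsum_eq]
  have hs' := (Equiv.prodComm (ι → ℕ) (ι → ℕ)).summable_iff.2 hs.of_norm
  refine (hs'.tsum_prod' fun b => hs'.comp_injective (i := fun a => (b, a))
    fun _ _ h => (Prod.ext_iff.1 h).2).trans ?_
  refine tsum_congr fun b => ?_
  rw [recenter, taylorSum, ← tsum_mul_right]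
  refine tsum_congr fun a => ?_
  simp only [Function.comp_apply, Equiv.prodComm_apply, Prod.swap_prod_mk]
  ring

/-- The Taylor coefficients of a product. -/
def conv (c d : (ι → ℕ) → ℂ) (x : ι → ℕ) : ℂ :=
  ∑ q ∈ Finset.HasAntidiagonal.antidiagonal x,
    (tfact x / (tfact q.1 * tfact q.2) : ℂ) * (c q.1 * d q.2)

/-- The binomial coefficients of the convolution sum to $2^{|x|}$, which a weight absorbs.
Uniformity in the shifts $y,z$ is what the star product needs, where both factors are
differentiated. -/
theorem conv_shift_bound {c d : (ι → ℕ) → ℂ} (hc : Growth c) (hd : Growth d) {ε : ℝ} (hε : 0 < ε) :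
    ∃ C, 0 < C ∧ ∀ x y z, ‖conv (fun a => c (a + y)) (fun b => d (b + z)) x‖ ≤
      C * (wt ε (tdeg x) * (wt ε (tdeg y) * wt ε (tdeg z))) := by
  obtain ⟨C, hC, h⟩ := hc.shift_bound (half_pos hε)
  obtain ⟨D, hD, h'⟩ := hd.shift_bound (half_pos hε)
  obtain ⟨B, hB, h''⟩ := pow_le_wt (half_pos hε) (A := 2) (by norm_num)
  refine ⟨C * D * B, by positivity, fun x y z => ?_⟩
  set δ := ε / 2
  have hy := wt_pos δ (tdeg y)
  have hz := wt_pos δ (tdeg z)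
  have hx := wt_pos δ (tdeg x)
  have h1 : ‖conv (fun a => c (a + y)) (fun b => d (b + z)) x‖ ≤
      ∑ q ∈ Finset.HasAntidiagonal.antidiagonal x, (tfact x / (tfact q.1 * tfact q.2) : ℝ) *
        (C * D * (wt δ (tdeg x) * (wt δ (tdeg y) * wt δ (tdeg z)))) := by
    refine norm_sum_le_of_le _ fun q hq => ?_
    rw [norm_mul, norm_mul, norm_div, norm_mul]
    simp only [Complex.norm_natCast]
    refine mul_le_mul_of_nonneg_left ?_ (by positivity)
    have h2 := wt_mul_le (half_pos hε).le (tdeg q.1) (tdeg q.2)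
    rw [← tdeg_add, Finset.HasAntidiagonal.mem_antidiagonal.1 hq] at h2
    have h3 := wt_pos δ (tdeg q.1)
    have h4 := wt_pos δ (tdeg q.2)
    calc _ ≤ C * (wt δ (tdeg q.1) * wt δ (tdeg y)) * (D * (wt δ (tdeg q.2) * wt δ (tdeg z))) := by
          gcongr
          · exact h _ _
          · exact h' _ _
      _ = C * D * (wt δ (tdeg q.1) * wt δ (tdeg q.2) * (wt δ (tdeg y) * wt δ (tdeg z))) := by ring
      _ ≤ _ := by
          refine mul_le_mul_of_nonneg_left ?_ (by positivity)
          exact mul_le_mul_of_nonneg_right h2 (by positivity)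
  rw [← Finset.sum_mul, sum_antidiagonal_tfact] at h1
  refine h1.trans ?_
  have h5 : ∀ k, wt δ k * wt δ k = wt ε k := fun k => by
    rw [← wt_add_exponent, add_halves]
  have h6 := wt_le_wt (half_le_self hε.le) (tdeg y)
  have h7 := wt_le_wt (half_le_self hε.le) (tdeg z)
  have h8 := wt_pos ε (tdeg y)
  calc _ ≤ B * wt δ (tdeg x) * (C * D * (wt δ (tdeg x) * (wt ε (tdeg y) * wt ε (tdeg z)))) := by
        gcongr
        exact h'' _
    _ = C * D * B * (wt δ (tdeg x) * wt δ (tdeg x) * (wt ε (tdeg y) * wt ε (tdeg z))) := by ring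
    _ = _ := by rw [h5]

theorem Growth.conv {c d : (ι → ℕ) → ℂ} (hc : Growth c) (hd : Growth d) : Growth (conv c d) := by
  intro ε hε
  obtain ⟨C, hC, h⟩ := conv_shift_bound hc hd hε
  refine ⟨C, hC, fun x => ?_⟩
  simpa [wt] using h x 0 0

theorem taylorSum_mul {c d : (ι → ℕ) → ℂ} (hc : Growth c) (hd : Growth d) (v : ι → ℂ) :
    taylorSum c v * taylorSum d v = taylorSum (conv c d) v := by
  rw [taylorSum, taylorSum, tsum_mul_tsum_of_summable_norm (hc.summable_norm v) (hd.summable_norm v),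
    tsum_eq_tsum_sum_antidiagonal
      (summable_mul_of_summable_norm (hc.summable_norm v) (hd.summable_norm v)), taylorSum]
  refine tsum_congr fun x => ?_
  rw [WickBF.conv, Finset.sum_mul]
  refine Finset.sum_congr rfl fun q hq => ?_
  have h := dpow_mul_dpow v q.1 q.2
  rw [Finset.HasAntidiagonal.mem_antidiagonal.1 hq] at h
  linear_combination (c q.1 * d q.2) * h

/-! ### Star products of Taylor coefficients -/

section StarCoef

variable {κ : Type*} [Fintype κ] [DecidableEq κ]

@[simp] theorem tdeg_elim (x y : κ → ℕ) : tdeg (Sum.elim x y) = tdeg x + tdeg y := by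
  simp [tdeg]

theorem tfact_elim (x y : κ → ℕ) : tfact (Sum.elim x y) = tfact x * tfact y := by
  simp [tfact]

theorem dpow_elim (u v : κ → ℂ) (x y : κ → ℕ) :
    dpow (Sum.elim u v) (Sum.elim x y) = dpow u x * dpow v y := by
  simp only [dpow, Fintype.prod_sum_type, Sum.elim_inl, Sum.elim_inr]

/-- The `N`-th contribution to the Taylor coefficients of a star product. -/
def starTerm (h : ℝ) (c d : (κ ⊕ κ → ℕ) → ℂ) (N : κ → ℕ) (x : κ ⊕ κ → ℕ) : ℂ :=
  ((h : ℂ) ^ tdeg N / tfact N) *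
    conv (fun a => c (a + Sum.elim N 0)) (fun b => d (b + Sum.elim (0 : κ → ℕ) N)) x

/-- The Taylor coefficients of a star product. -/
def starCoef (h : ℝ) (c d : (κ ⊕ κ → ℕ) → ℂ) (x : κ ⊕ κ → ℕ) : ℂ := ∑' N, starTerm h c d N x

/-- The exponent of the weight in `N` is $2\varepsilon$ because `N` shifts both factors. Convergence
of the star product thus needs $2\varepsilon<1$, which explains the values 1/4 below. -/
theorem starTerm_bound {h : ℝ} {c d : (κ ⊕ κ → ℕ) → ℂ} (hc : Growth c) (hd : Growth d)
    {ε : ℝ} (hε : 0 < ε) : ∃ C, 0 < C ∧ ∀ N x, ‖starTerm h c d N x‖ ≤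
      C * wt ε (tdeg x) * (wt (2 * ε) (tdeg N) * (|h| ^ tdeg N / tfact N)) := by
  obtain ⟨C, hC, hb⟩ := conv_shift_bound hc hd hε
  refine ⟨C, hC, fun N x => ?_⟩
  have := hb x (Sum.elim N 0) (Sum.elim (0 : κ → ℕ) N)
  rw [tdeg_elim, tdeg_elim, tdeg_zero, add_zero, zero_add, ← wt_add_exponent, ← two_mul] at this
  rw [starTerm, norm_mul, norm_div, norm_pow, Complex.norm_real, Complex.norm_natCast,
    Real.norm_eq_abs]
  calc _ ≤ |h| ^ tdeg N / tfact N * (C * (wt ε (tdeg x) * wt (2 * ε) (tdeg N))) := by gcongr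
    _ = _ := by ring

theorem Growth.summable_starTerm {h : ℝ} {c d : (κ ⊕ κ → ℕ) → ℂ} (hc : Growth c) (hd : Growth d)
    (v : κ ⊕ κ → ℂ) :
    Summable fun p : (κ → ℕ) × (κ ⊕ κ → ℕ) => ‖starTerm h c d p.1 p.2 * dpow v p.2‖ := by
  obtain ⟨C, hC, hb⟩ := starTerm_bound (h := h) hc hd (ε := 1 / 4) (by norm_num)
  have hs1 := summable_wt (ι := κ) (ε := 2 * (1 / 4)) (A := |h|) (by norm_num) (abs_nonneg _)
  have hs2 := summable_wt (ι := κ ⊕ κ) (ε := 1 / 4) (A := ‖v‖) (by norm_num) (norm_nonneg _)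
  refine Summable.of_nonneg_of_le (fun _ => norm_nonneg _) (fun p => ?_)
    ((hs1.mul_of_nonneg hs2 (fun x => ?_) (fun x => ?_)).mul_left C)
  · rw [norm_mul]
    have h1 := norm_dpow_le (fun i => norm_le_pi_norm v i) p.2
    have h2 := wt_pos (1 / 4) (tdeg p.2)
    have h3 := wt_pos (2 * (1 / 4)) (tdeg p.1)
    calc _ ≤ C * wt (1 / 4) (tdeg p.2) *
          (wt (2 * (1 / 4)) (tdeg p.1) * (|h| ^ tdeg p.1 / tfact p.1)) *
            (‖v‖ ^ tdeg p.2 / tfact p.2) := by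
          gcongr
          exact hb _ _
      _ = _ := by ring
  · have := wt_pos (2 * (1 / 4)) (tdeg x)
    positivity
  · have := wt_pos (1 / 4) (tdeg x)
    positivity

theorem Growth.starCoef {h : ℝ} {c d : (κ ⊕ κ → ℕ) → ℂ} (hc : Growth c) (hd : Growth d) :
    Growth (starCoef h c d) := by
  intro ε hε
  set δ := min ε (1 / 4)
  have hδ : 0 < δ := by positivity
  obtain ⟨C, hC, hb⟩ := starTerm_bound (h := h) hc hd hδ
  have hδ1 : 2 * δ < 1 := by
    have := min_le_right ε (1 / 4)
    linarith
  have hs1 := summable_wt (ι := κ) (A := |h|) hδ1 (abs_nonneg _)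
  have hS : 0 ≤ ∑' N : κ → ℕ, wt (2 * δ) (tdeg N) * (|h| ^ tdeg N / tfact N) :=
    tsum_nonneg fun N => by
      have := wt_pos (2 * δ) (tdeg N)
      positivity
  refine ⟨C * (∑' N : κ → ℕ, wt (2 * δ) (tdeg N) * (|h| ^ tdeg N / tfact N) + 1), by positivity,
    fun x => ?_⟩
  have h1 := tsum_of_norm_bounded (hs1.mul_left (C * wt δ (tdeg x))).hasSum fun N => hb N x
  rw [tsum_mul_left] at h1
  refine h1.trans ?_
  have h3 := wt_le_wt (min_le_left ε (1 / 4)) (tdeg x)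
  have := wt_pos ε (tdeg x)
  calc _ ≤ C * wt ε (tdeg x) *
        (∑' N : κ → ℕ, wt (2 * δ) (tdeg N) * (|h| ^ tdeg N / tfact N) + 1) := by
        gcongr
        linarith
    _ = _ := by ring

/-- The sum over contractions and the Taylor sum may be interchanged, so the star product is
computed coefficientwise. -/
theorem hasSum_taylorSum_star {h : ℝ} {c d : (κ ⊕ κ → ℕ) → ℂ} (hc : Growth c) (hd : Growth d)
    (v : κ ⊕ κ → ℂ) :
    HasSum (fun N : κ → ℕ => ((h : ℂ) ^ tdeg N / tfact N) *
      (taylorSum (fun a => c (a + Sum.elim N 0)) v * taylorSum (fun b => d (b + Sum.elim (0 : κ → ℕ) N)) v))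
      (taylorSum (starCoef h c d) v) := by
  have hs := (hc.summable_starTerm (h := h) hd v).of_norm
  have e : ∀ N : κ → ℕ, ((h : ℂ) ^ tdeg N / tfact N) *
      (taylorSum (fun a => c (a + Sum.elim N 0)) v * taylorSum (fun b => d (b + Sum.elim (0 : κ → ℕ) N)) v)
      = ∑' x, starTerm h c d N x * dpow v x := fun N => by
    rw [taylorSum_mul (hc.shift _) (hd.shift _), taylorSum, ← tsum_mul_left]
    refine tsum_congr fun x => ?_
    rw [starTerm]
    ring
  have h1 := hs.hasSum.prod_fiberwise fun N => (hs.prod_factor N).hasSum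
  have h2 : ∑' p : (κ → ℕ) × (κ ⊕ κ → ℕ), starTerm h c d p.1 p.2 * dpow v p.2 =
      taylorSum (starCoef h c d) v := by
    rw [← (Equiv.prodComm (κ ⊕ κ → ℕ) (κ → ℕ)).tsum_eq]
    have hs' := (Equiv.prodComm (κ ⊕ κ → ℕ) (κ → ℕ)).summable_iff.2 hs
    refine (hs'.tsum_prod' fun x => hs'.prod_factor x).trans (tsum_congr fun x => ?_)
    rw [WickBF.starCoef, ← tsum_mul_right]
    rfl
  rw [h2] at h1
  exact h1.congr_fun fun N => e N

end StarCoef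

/-! ### Analyticity and derivatives -/

section Analytic

variable {ι : Type*} [Fintype ι] [DecidableEq ι]

/-- The type `Σ i, Fin (x i)` lists the variable `i` exactly `x i` times; the multilinear form
multiplies the corresponding coordinates of its `k` arguments. -/
theorem exists_monomial_multilinear (x : ι → ℕ) (k : ℕ) (hk : tdeg x = k) :
    ∃ M : ContinuousMultilinearMap ℂ (fun _ : Fin k => ι → ℂ) ℂ, ‖M‖ ≤ 1 ∧
      ∀ v : ι → ℂ, M (fun _ => v) = ∏ i, v i ^ x i := by
  have hcard : Fintype.card (Σ i, Fin (x i)) = k := by simp [← hk, tdeg]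
  let e := Fintype.equivFinOfCardEq hcard
  refine ⟨(ContinuousMultilinearMap.mkPiAlgebra ℂ (Fin k) ℂ).compContinuousLinearMap
    fun j => ContinuousLinearMap.proj (e.symm j).1, ?_, fun v => ?_⟩
  · refine (ContinuousMultilinearMap.norm_compContinuousLinearMap_le _ _).trans ?_
    refine mul_le_one₀ ContinuousMultilinearMap.norm_mkPiAlgebra.le
      (Finset.prod_nonneg fun _ _ => norm_nonneg _) (Finset.prod_le_one (fun _ _ => norm_nonneg _)
        fun j _ => ContinuousLinearMap.opNorm_le_bound _ zero_le_one fun v => ?_)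
    rw [one_mul]
    exact norm_le_pi_norm v _
  · simp only [ContinuousMultilinearMap.compContinuousLinearMap_apply,
      ContinuousLinearMap.proj_apply, ContinuousMultilinearMap.mkPiAlgebra_apply]
    rw [Equiv.prod_comp e.symm fun a => v a.1, Fintype.prod_sigma]
    simp

theorem hasSum_sum_piAntidiag {E : Type*} [NormedAddCommGroup E] [CompleteSpace E]
    {g : (ι → ℕ) → E} {a : E} (hg : HasSum g a) :
    HasSum (fun k => ∑ x ∈ Finset.piAntidiag Finset.univ k, g x) a := by
  have h := hg.tsum_fiberwise tdeg
  refine h.congr_fun fun k => ?_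
  have hset : tdeg ⁻¹' {k} = ((Finset.piAntidiag Finset.univ k : Finset (ι → ℕ)) : Set (ι → ℕ)) := by
    ext x
    simp [tdeg]
  rw [hset]
  exact (Finset.tsum_subtype' _ g).symm

theorem hasFPowerSeriesOnBall_taylorSum {c : (ι → ℕ) → ℂ} (hc : Growth c) :
    ∃ P : FormalMultilinearSeries ℂ (ι → ℂ) ℂ, HasFPowerSeriesOnBall (taylorSum c) P 0 ⊤ ∧
      ∀ k v, P k (fun _ => v) = ∑ x ∈ Finset.piAntidiag Finset.univ k, c x * dpow v x := by
  have hM : ∀ (k : ℕ) (x : ι → ℕ), ∃ M : ContinuousMultilinearMap ℂ (fun _ : Fin k => ι → ℂ) ℂ,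
      ‖M‖ ≤ 1 ∧ (tdeg x = k → ∀ v : ι → ℂ, M (fun _ => v) = ∏ i, v i ^ x i) := fun k x => by
    by_cases h : tdeg x = k
    · obtain ⟨M, h1, h2⟩ := exists_monomial_multilinear x k h
      exact ⟨M, h1, fun _ => h2⟩
    · exact ⟨0, by simp, fun h' => absurd h' h⟩
  choose M hM1 hM2 using hM
  let P : FormalMultilinearSeries ℂ (ι → ℂ) ℂ := fun k =>
    ∑ x ∈ Finset.piAntidiag Finset.univ k, (c x / tfact x) • M k x
  have hP : ∀ k v, P k (fun _ => v) = ∑ x ∈ Finset.piAntidiag Finset.univ k, c x * dpow v x := by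
    intro k v
    simp only [P, sum_apply, smul_apply]
    refine Finset.sum_congr rfl fun x hx => ?_
    have hx' : tdeg x = k := by simpa [tdeg] using hx
    rw [hM2 k x hx', dpow_eq, smul_eq_mul]
    ring
  refine ⟨P, ⟨?_, by simp, ?_⟩, hP⟩
  · rw [top_le_iff]
    refine FormalMultilinearSeries.radius_eq_top_of_summable_norm _ fun r => ?_
    -- Absolute convergence at the diagonal point $(r,\dots,r)$ bounds $\sum_k\|P_k\|r^k$, for every
    -- $r$.
    have hs := (hasSum_sum_piAntidiag (hc.summable_norm fun _ => (r : ℂ)).hasSum).summable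
    refine Summable.of_nonneg_of_le (fun _ => by positivity) (fun k => ?_) hs
    have h1 : ‖P k‖ ≤ ∑ x ∈ Finset.piAntidiag Finset.univ k, ‖c x‖ / tfact x := by
      refine norm_sum_le_of_le _ fun x _ => ?_
      rw [norm_smul, norm_div, Complex.norm_natCast]
      exact mul_le_of_le_one_right (by positivity) (hM1 k x)
    refine (mul_le_mul_of_nonneg_right h1 (by positivity)).trans_eq ?_
    rw [Finset.sum_mul]
    refine Finset.sum_congr rfl fun x hx => ?_
    have hx' : ∑ i, x i = k := by simpa using hx
    rw [norm_mul, dpow_eq, norm_div, norm_prod, Complex.norm_natCast]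
    simp only [norm_pow, Complex.norm_real, NNReal.norm_eq, Finset.prod_pow_eq_pow_sum, hx']
    ring
  · intro v _
    rw [zero_add]
    simp only [hP]
    exact hasSum_sum_piAntidiag (hc.summable v).hasSum

theorem analyticOnNhd_taylorSum {c : (ι → ℕ) → ℂ} (hc : Growth c) :
    AnalyticOnNhd ℂ (taylorSum c) Set.univ := by
  obtain ⟨P, hP, -⟩ := hasFPowerSeriesOnBall_taylorSum hc
  simpa using hP.analyticOnNhd

/-- After re-expansion at `u` the derivative is the homogeneous part of degree one, and only the
index $e_i$ survives in the direction $e_i$. -/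
theorem fderiv_taylorSum_single {c : (ι → ℕ) → ℂ} (hc : Growth c) (u : ι → ℂ) (i : ι) :
    fderiv ℂ (taylorSum c) u (Pi.single i 1) =
      taylorSum (fun x => c (x + Pi.single i 1)) u := by
  obtain ⟨P, hP, hP2⟩ := hasFPowerSeriesOnBall_taylorSum (hc.recenter u)
  have h1 := hP.hasFPowerSeriesAt.hasFDerivAt
  have h2 : HasFDerivAt (taylorSum c) (continuousMultilinearCurryFin1 ℂ (ι → ℂ) ℂ (P 1)) u := by
    have h3 := (hasFDerivAt_id (𝕜 := ℂ) u).sub_const u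
    have h4 : HasFDerivAt (taylorSum (recenter c u))
      (continuousMultilinearCurryFin1 ℂ (ι → ℂ) ℂ (P 1)) ((fun w => id w - u) u) := by
      simpa using h1
    have h5 := HasFDerivAt.comp (f := fun w => id w - u) u h4 h3
    rw [ContinuousLinearMap.comp_id] at h5
    have e : taylorSum c = taylorSum (recenter c u) ∘ fun w => id w - u := by
      funext w
      simp only [Function.comp_apply, id]
      rw [← taylorSum_add hc, add_sub_cancel]
    rw [e]
    exact h5
  rw [h2.fderiv, continuousMultilinearCurryFin1_apply]
  have e : (Fin.snoc 0 (Pi.single i 1) : Fin 1 → ι → ℂ) = fun _ => Pi.single i 1 := by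
    funext j
    have hj : j = Fin.last 0 := Subsingleton.elim (α := Fin 1) _ _
    rw [hj, Fin.snoc_last]
  rw [e, hP2, Finset.sum_eq_single (Pi.single i 1)]
  · rw [recenter, dpow_eq]
    have h6 : ∏ j, (Pi.single i 1 : ι → ℂ) j ^ (Pi.single i 1 : ι → ℕ) j = 1 :=
      Finset.prod_eq_one fun j _ => by
        by_cases h : j = i
        · subst h; simp
        · simp [h]
    have h7 : tfact (Pi.single i 1 : ι → ℕ) = 1 :=
      Finset.prod_eq_one fun j _ => by
        by_cases h : j = i
        · subst h; simp
        · simp [h]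
    rw [h6, h7]
    simp
  · intro x hx hne
    have hx' : ∑ j, x j = 1 := by simpa using hx
    obtain ⟨j, hj, hxj⟩ : ∃ j, j ≠ i ∧ x j ≠ 0 := by
      by_contra! hcon
      refine hne (funext fun j => ?_)
      by_cases h : j = i
      · subst h
        rw [Finset.sum_eq_single j (fun b _ hb => hcon b hb) (by simp)] at hx'
        simp [hx']
      · simp [h, hcon j h]
    have : dpow (Pi.single i 1 : ι → ℂ) x = 0 :=
      Finset.prod_eq_zero (Finset.mem_univ j) (by simp [hj, hxj])
    rw [this, mul_zero]
  · intro h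
    exact absurd (by simp) h

end Analytic

/-! ### Change of the expansion point. -/

section Recenter

variable {ι : Type*} [Fintype ι] [DecidableEq ι]

@[simp] theorem taylorSum_zero (c : (ι → ℕ) → ℂ) : taylorSum c 0 = c 0 := by
  rw [taylorSum, tsum_eq_single 0 fun x hx => by simp [dpow_zero, hx]]
  simp

@[simp] theorem recenter_zero (c : (ι → ℕ) → ℂ) : recenter c 0 = c := by
  funext x
  simp [recenter]

theorem recenter_shift (c : (ι → ℕ) → ℂ) (u : ι → ℂ) (x : ι → ℕ) :
    (fun y => recenter c u (y + x)) = recenter (fun y => c (y + x)) u := by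
  funext y
  simp only [recenter, add_assoc]

theorem recenter_recenter {c : (ι → ℕ) → ℂ} (hc : Growth c) (u v : ι → ℂ) :
    recenter (recenter c u) v = recenter c (u + v) := by
  funext x
  rw [recenter, recenter_shift, ← taylorSum_add (hc.shift x)]
  rfl

end Recenter

/-! ### Functions on `ℂⁿ` as restrictions of entire functions on `ℂⁿ × ℂⁿ` -/

section WickFun

variable {n : ℕ}

/-- The real-linear embedding `z ↦ (z, z̄)`. -/
def conjGraph : (Fin n → ℂ) →L[ℝ] (Fin n ⊕ Fin n → ℂ) :=
  ContinuousLinearMap.pi (Sum.elim (fun i => ContinuousLinearMap.proj i)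
    fun i => (Complex.conjCLE : ℂ →L[ℝ] ℂ).comp (ContinuousLinearMap.proj i))

theorem conjGraph_apply (z : Fin n → ℂ) : conjGraph z = Sum.elim z fun i => conj (z i) := by
  funext i
  rcases i with i | i <;> simp [conjGraph]

/-- The function `z ↦ ∑ c_{R,S} z^R z̄^S / (R! S!)`. -/
def wickFun (c : (Fin n ⊕ Fin n → ℕ) → ℂ) (z : Fin n → ℂ) : ℂ := taylorSum c (conjGraph z)

/-- The family of all mixed Wirtinger derivatives at a point. -/
def jet (f : (Fin n → ℂ) → ℂ) (q : Fin n → ℂ) (x : Fin n ⊕ Fin n → ℕ) : ℂ :=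
  mixedD (x ∘ Sum.inl) (x ∘ Sum.inr) f q

theorem analyticOnNhd_wickFun {c : (Fin n ⊕ Fin n → ℕ) → ℂ} (hc : Growth c) :
    AnalyticOnNhd ℝ (wickFun c) Set.univ :=
  (analyticOnNhd_taylorSum hc).restrictScalars.comp (conjGraph.analyticOnNhd _)
    fun _ _ => Set.mem_univ _

theorem fderiv_wickFun {c : (Fin n ⊕ Fin n → ℕ) → ℂ} (hc : Growth c) (z v : Fin n → ℂ) :
    fderiv ℝ (wickFun c) z v = fderiv ℂ (taylorSum c) (conjGraph z) (conjGraph v) := by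
  have h1 := ((analyticOnNhd_taylorSum hc) (conjGraph z) (Set.mem_univ _)).differentiableAt
  have h2 := h1.hasFDerivAt.restrictScalars ℝ
  have h3 := h2.comp z conjGraph.hasFDerivAt
  have h4 : fderiv ℝ (wickFun c) z = _ := h3.fderiv
  rw [h4]
  rfl

theorem conjGraph_single (i : Fin n) (a : ℂ) : conjGraph (Pi.single i a) =
    a • (Pi.single (Sum.inl i) 1 : Fin n ⊕ Fin n → ℂ) + conj a • Pi.single (Sum.inr i) 1 := by
  rw [conjGraph_apply]
  funext j
  rcases j with j | j <;> by_cases h : j = i <;> simp [h, Pi.single_apply]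

/-- By the chain rule the directions $e_i$ and $\mathrm{i}e_i$ see the two complex partial
derivatives of the entire extension with coefficients $(1,1)$ and $(\mathrm{i},-\mathrm{i})$; the
Wirtinger combination isolates one of them. -/
theorem dz_wickFun {c : (Fin n ⊕ Fin n → ℕ) → ℂ} (hc : Growth c) (i : Fin n) :
    dz i (wickFun c) = wickFun fun x => c (x + Pi.single (Sum.inl i) 1) := by
  funext z
  rw [dz, fderiv_wickFun hc, fderiv_wickFun hc, conjGraph_single, conjGraph_single]
  simp only [map_add, map_smul, fderiv_taylorSum_single hc, wickFun, Complex.conj_I, map_one,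
    smul_eq_mul]
  linear_combination (-(1 / 2 : ℂ) * taylorSum (fun x => c (x + Pi.single (Sum.inl i) 1))
    (conjGraph z) + (1 / 2 : ℂ) * taylorSum (fun x => c (x + Pi.single (Sum.inr i) 1))
    (conjGraph z)) * Complex.I_mul_I

theorem dzbar_wickFun {c : (Fin n ⊕ Fin n → ℕ) → ℂ} (hc : Growth c) (i : Fin n) :
    dzbar i (wickFun c) = wickFun fun x => c (x + Pi.single (Sum.inr i) 1) := by
  funext z
  rw [dzbar, fderiv_wickFun hc, fderiv_wickFun hc, conjGraph_single, conjGraph_single]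
  simp only [map_add, map_smul, fderiv_taylorSum_single hc, wickFun, Complex.conj_I, map_one,
    smul_eq_mul]
  linear_combination ((1 / 2 : ℂ) * taylorSum (fun x => c (x + Pi.single (Sum.inl i) 1))
    (conjGraph z) - (1 / 2 : ℂ) * taylorSum (fun x => c (x + Pi.single (Sum.inr i) 1))
    (conjGraph z)) * Complex.I_mul_I

theorem iterD_wickFun {D : Fin n → ((Fin n → ℂ) → ℂ) → ((Fin n → ℂ) → ℂ)}
    {e : Fin n → Fin n ⊕ Fin n} (hD : ∀ c : (Fin n ⊕ Fin n → ℕ) → ℂ, Growth c → ∀ i,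
      D i (wickFun c) = wickFun fun x => c (x + Pi.single (e i) 1))
    (R : MIdx n) {c : (Fin n ⊕ Fin n → ℕ) → ℂ} (hc : Growth c) :
    iterD D R (wickFun c) = wickFun fun x => c (x + ∑ i, R i • Pi.single (e i) 1) := by
  have h1 : ∀ (i : Fin n) (k : ℕ) (c : (Fin n ⊕ Fin n → ℕ) → ℂ), Growth c →
      (D i)^[k] (wickFun c) = wickFun fun x => c (x + k • Pi.single (e i) 1) := by
    intro i k
    induction k with
    | zero => intro c _; simp
    | succ k ih =>
      intro c hc
      rw [Function.iterate_succ_apply, hD c hc, ih _ (hc.shift _)]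
      simp only [succ_nsmul, add_assoc]
  have h2 : ∀ l : List (Fin n), l.foldr (fun i g => (D i)^[R i] g) (wickFun c) =
      wickFun fun x => c (x + (l.map fun i => R i • Pi.single (e i) 1).sum) := by
    intro l
    induction l with
    | nil => simp
    | cons i l ih =>
      rw [List.foldr_cons, ih, h1 _ _ _ (hc.shift _)]
      simp only [List.map_cons, List.sum_cons, add_assoc]
  rw [iterD, h2, ← List.ofFn_eq_map, List.sum_ofFn]

theorem iterD_dz_wickFun (R : MIdx n) {c : (Fin n ⊕ Fin n → ℕ) → ℂ} (hc : Growth c) :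
    iterD dz R (wickFun c) = wickFun fun x => c (x + Sum.elim R (0 : Fin n → ℕ)) := by
  rw [iterD_wickFun (fun c hc i => dz_wickFun hc i) R hc]
  have : ∑ i, R i • (Pi.single (Sum.inl i) 1 : Fin n ⊕ Fin n → ℕ) =
      Sum.elim R (0 : Fin n → ℕ) := by
    funext j
    rcases j with j | j <;> simp [Finset.sum_apply, Pi.single_apply]
  rw [this]

theorem iterD_dzbar_wickFun (R : MIdx n) {c : (Fin n ⊕ Fin n → ℕ) → ℂ} (hc : Growth c) :
    iterD dzbar R (wickFun c) = wickFun fun x => c (x + Sum.elim (0 : Fin n → ℕ) R) := by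
  rw [iterD_wickFun (fun c hc i => dzbar_wickFun hc i) R hc]
  have : ∑ i, R i • (Pi.single (Sum.inr i) 1 : Fin n ⊕ Fin n → ℕ) =
      Sum.elim (0 : Fin n → ℕ) R := by
    funext j
    rcases j with j | j <;> simp [Finset.sum_apply, Pi.single_apply]
  rw [this]

theorem elim_add_elim (a b c d : MIdx n) :
    (Sum.elim a b : Fin n ⊕ Fin n → ℕ) + Sum.elim c d = Sum.elim (a + c) (b + d) := by
  funext j
  rcases j with j | j <;> rfl

theorem mixedD_wickFun (R S : MIdx n) {c : (Fin n ⊕ Fin n → ℕ) → ℂ} (hc : Growth c) :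
    mixedD R S (wickFun c) = wickFun fun x => c (x + Sum.elim R S) := by
  rw [mixedD, iterD_dzbar_wickFun S hc, iterD_dz_wickFun R (hc.shift _)]
  simp only [add_assoc, elim_add_elim, add_zero, zero_add]

theorem jet_wickFun {c : (Fin n ⊕ Fin n → ℕ) → ℂ} (hc : Growth c) (q : Fin n → ℂ) :
    jet (wickFun c) q = recenter c (conjGraph q) := by
  funext x
  rw [jet, mixedD_wickFun _ _ hc, Sum.elim_comp_inl_inr]
  rfl

end WickFun

/-! ### Uniqueness of analytic functions with given Wirtinger derivatives -/

section Uniqueness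

variable {n : ℕ}

/-- A common form of the Wirtinger operators. -/
def wirt (s : ℂ) (i : Fin n) (f : (Fin n → ℂ) → ℂ) (z : Fin n → ℂ) : ℂ :=
  (1 / 2 : ℂ) * (fderiv ℝ f z (Pi.single i 1) + s * fderiv ℝ f z (Pi.single i Complex.I))

theorem dz_eq_wirt : (dz : Fin n → _) = wirt (-Complex.I) := by
  funext i f z
  simp [dz, wirt, sub_eq_add_neg]

theorem dzbar_eq_wirt : (dzbar : Fin n → _) = wirt Complex.I := rfl

theorem wirt_analytic {f : (Fin n → ℂ) → ℂ} (hf : AnalyticOnNhd ℝ f Set.univ) (s : ℂ) (i : Fin n) :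
    AnalyticOnNhd ℝ (wirt s i f) Set.univ := by
  have h : ∀ v : Fin n → ℂ, AnalyticOnNhd ℝ (fun z => fderiv ℝ f z v) Set.univ := fun v =>
    ((ContinuousLinearMap.apply ℝ ℂ v).analyticOnNhd Set.univ).comp hf.fderiv
      fun _ _ => Set.mem_univ _
  exact analyticOnNhd_const.mul ((h _).add (analyticOnNhd_const.mul (h _)))

theorem wirt_sub {f g : (Fin n → ℂ) → ℂ} (hf : AnalyticOnNhd ℝ f Set.univ)
    (hg : AnalyticOnNhd ℝ g Set.univ) (s : ℂ) (i : Fin n) :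
    wirt s i (f - g) = wirt s i f - wirt s i g := by
  funext z
  simp only [wirt, Pi.sub_apply]
  rw [fderiv_sub (hf z (Set.mem_univ _)).differentiableAt (hg z (Set.mem_univ _)).differentiableAt]
  simp only [sub_apply]
  ring

theorem wirt_comm {f : (Fin n → ℂ) → ℂ} (hf : AnalyticOnNhd ℝ f Set.univ) (s t : ℂ)
    (i j : Fin n) : wirt s i (wirt t j f) = wirt t j (wirt s i f) := by
  funext z
  have hd : DifferentiableAt ℝ (fderiv ℝ f) z := (hf.fderiv z (Set.mem_univ _)).differentiableAt
  have hsym : IsSymmSndFDerivAt ℝ f z :=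
    (hf z (Set.mem_univ _)).contDiffAt.isSymmSndFDerivAt (n := 2) (by simp)
  have h1 : ∀ (s : ℂ) (i : Fin n) (v : Fin n → ℂ), fderiv ℝ (wirt s i f) z v =
      (1 / 2 : ℂ) * (fderiv ℝ (fderiv ℝ f) z v (Pi.single i 1) +
        s * fderiv ℝ (fderiv ℝ f) z v (Pi.single i Complex.I)) := by
    intro s i v
    have h2 : ∀ w : Fin n → ℂ, HasFDerivAt (fun z => fderiv ℝ f z w)
        ((fderiv ℝ (fderiv ℝ f) z).flip w) z := fun w => by
      have := hd.hasFDerivAt.clm_apply (hasFDerivAt_const w z)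
      simpa using this
    have h3 := ((h2 (Pi.single i 1)).add ((h2 (Pi.single i Complex.I)).const_mul s)).const_mul
      (1 / 2 : ℂ)
    have h4 : fderiv ℝ (wirt s i f) z = _ := h3.fderiv
    rw [h4]
    simp [mul_add]
  rw [wirt, wirt, h1, h1, h1, h1, hsym.eq (Pi.single i 1) (Pi.single j 1),
    hsym.eq (Pi.single i 1) (Pi.single j Complex.I), hsym.eq (Pi.single i Complex.I) (Pi.single j 1),
    hsym.eq (Pi.single i Complex.I) (Pi.single j Complex.I)]
  ring

theorem iterate_wirt_analytic {f : (Fin n → ℂ) → ℂ} (hf : AnalyticOnNhd ℝ f Set.univ) (s : ℂ)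
    (i : Fin n) (k : ℕ) : AnalyticOnNhd ℝ ((wirt s i)^[k] f) Set.univ := by
  induction k with
  | zero => exact hf
  | succ k ih => rw [Function.iterate_succ_apply']; exact wirt_analytic ih s i

theorem foldr_wirt_analytic {f : (Fin n → ℂ) → ℂ} (hf : AnalyticOnNhd ℝ f Set.univ) (s : ℂ)
    (R : MIdx n) (l : List (Fin n)) :
    AnalyticOnNhd ℝ (l.foldr (fun i g => (wirt s i)^[R i] g) f) Set.univ := by
  induction l with
  | nil => exact hf
  | cons i l ih => exact iterate_wirt_analytic ih s i _

theorem iterate_wirt_comm {f : (Fin n → ℂ) → ℂ} (hf : AnalyticOnNhd ℝ f Set.univ) (s t : ℂ)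
    (i j : Fin n) (k : ℕ) : (wirt s i)^[k] (wirt t j f) = wirt t j ((wirt s i)^[k] f) := by
  induction k with
  | zero => rfl
  | succ k ih =>
    rw [Function.iterate_succ_apply', ih, wirt_comm (iterate_wirt_analytic hf s i k),
      Function.iterate_succ_apply']

theorem foldr_wirt_comm {f : (Fin n → ℂ) → ℂ} (hf : AnalyticOnNhd ℝ f Set.univ) (s t : ℂ)
    (R : MIdx n) (j : Fin n) (l : List (Fin n)) :
    l.foldr (fun i g => (wirt s i)^[R i] g) (wirt t j f) =
      wirt t j (l.foldr (fun i g => (wirt s i)^[R i] g) f) := by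
  induction l with
  | nil => rfl
  | cons i l ih =>
    rw [List.foldr_cons, ih, iterate_wirt_comm (foldr_wirt_analytic hf s R l), List.foldr_cons]

theorem iterD_wirt_comm {f : (Fin n → ℂ) → ℂ} (hf : AnalyticOnNhd ℝ f Set.univ) (s t : ℂ)
    (R : MIdx n) (j : Fin n) :
    iterD (wirt s) R (wirt t j f) = wirt t j (iterD (wirt s) R f) := foldr_wirt_comm hf s t R j _

theorem iterD_wirt_add_single {f : (Fin n → ℂ) → ℂ} (hf : AnalyticOnNhd ℝ f Set.univ) (s : ℂ)
    (R : MIdx n) (j : Fin n) :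
    iterD (wirt s) (R + Pi.single j 1) f = wirt s j (iterD (wirt s) R f) := by
  have h : ∀ l : List (Fin n), l.Nodup →
      (j ∉ l → l.foldr (fun i g => (wirt s i)^[(R + Pi.single j 1 : MIdx n) i] g) f =
        l.foldr (fun i g => (wirt s i)^[R i] g) f) ∧
      (j ∈ l → l.foldr (fun i g => (wirt s i)^[(R + Pi.single j 1 : MIdx n) i] g) f =
        wirt s j (l.foldr (fun i g => (wirt s i)^[R i] g) f)) := by
    intro l
    induction l with
    | nil => intro _; simp
    | cons i l ih =>
      intro hl
      obtain ⟨hi, hl⟩ := List.nodup_cons.1 hl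
      obtain ⟨ih1, ih2⟩ := ih hl
      refine ⟨fun hj => ?_, fun hj => ?_⟩
      · rw [List.mem_cons, not_or] at hj
        rw [List.foldr_cons, ih1 hj.2, List.foldr_cons]
        simp [Ne.symm hj.1]
      · by_cases hji : j = i
        · subst hji
          rw [List.foldr_cons, ih1 hi, List.foldr_cons, ← Function.iterate_succ_apply' (wirt s j)]
          simp
        · have hjl : j ∈ l := (List.mem_cons.1 hj).resolve_left hji
          rw [List.foldr_cons, ih2 hjl, List.foldr_cons,
            ← iterate_wirt_comm (foldr_wirt_analytic hf s R l)]
          simp [Ne.symm hji]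
  exact (h _ (List.nodup_finRange n)).2 (List.mem_finRange j)

theorem iterD_wirt_sub {f g : (Fin n → ℂ) → ℂ} (hf : AnalyticOnNhd ℝ f Set.univ)
    (hg : AnalyticOnNhd ℝ g Set.univ) (s : ℂ) (R : MIdx n) :
    iterD (wirt s) R (f - g) = iterD (wirt s) R f - iterD (wirt s) R g := by
  have h1 : ∀ (i : Fin n) (k : ℕ) (f g : (Fin n → ℂ) → ℂ), AnalyticOnNhd ℝ f Set.univ →
      AnalyticOnNhd ℝ g Set.univ →
      (wirt s i)^[k] (f - g) = (wirt s i)^[k] f - (wirt s i)^[k] g := by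
    intro i k
    induction k with
    | zero => intro f g _ _; rfl
    | succ k ih =>
      intro f g hf hg
      rw [Function.iterate_succ_apply, wirt_sub hf hg, ih _ _ (wirt_analytic hf s i)
        (wirt_analytic hg s i)]
      rfl
  unfold iterD
  induction List.finRange n with
  | nil => rfl
  | cons i l ih =>
    rw [List.foldr_cons, ih, h1 _ _ _ _ (foldr_wirt_analytic hf s R l)
      (foldr_wirt_analytic hg s R l)]
    rfl

theorem iterD_wirt_analytic {f : (Fin n → ℂ) → ℂ} (hf : AnalyticOnNhd ℝ f Set.univ) (s : ℂ)
    (R : MIdx n) : AnalyticOnNhd ℝ (iterD (wirt s) R f) Set.univ := foldr_wirt_analytic hf s R _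

theorem mixedD_sub {f g : (Fin n → ℂ) → ℂ} (hf : AnalyticOnNhd ℝ f Set.univ)
    (hg : AnalyticOnNhd ℝ g Set.univ) (R S : MIdx n) :
    mixedD R S (f - g) = mixedD R S f - mixedD R S g := by
  simp only [mixedD, dz_eq_wirt, dzbar_eq_wirt]
  rw [iterD_wirt_sub hf hg, iterD_wirt_sub (iterD_wirt_analytic hf _ _) (iterD_wirt_analytic hg _ _)]

theorem fderiv_eq_sum_wirt (f : (Fin n → ℂ) → ℂ) (z v : Fin n → ℂ) :
    fderiv ℝ f z v =
      ∑ i, (v i * wirt (-Complex.I) i f z + conj (v i) * wirt Complex.I i f z) := by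
  have hv : v = ∑ i, ((v i).re • (Pi.single i 1 : Fin n → ℂ) +
      (v i).im • (Pi.single i Complex.I : Fin n → ℂ)) := by
    funext j
    simp only [Finset.sum_apply, Pi.add_apply, Pi.smul_apply, Pi.single_apply, smul_ite, smul_zero]
    rw [Finset.sum_add_distrib, Finset.sum_ite_eq, Finset.sum_ite_eq]
    simp only [Finset.mem_univ, if_true, Complex.real_smul, mul_one]
    exact (Complex.re_add_im (v j)).symm
  conv_lhs => rw [hv]
  rw [map_sum]
  refine Finset.sum_congr rfl fun i _ => ?_
  rw [map_add, map_smul, map_smul, Complex.real_smul, Complex.real_smul, wirt, wirt]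
  generalize fderiv ℝ f z (Pi.single i 1) = A
  generalize fderiv ℝ f z (Pi.single i Complex.I) = B
  have h1 : v i = (v i).re + (v i).im * Complex.I := (Complex.re_add_im _).symm
  have h2 : conj (v i) = (v i).re - (v i).im * Complex.I := by
    apply Complex.ext <;> simp
  rw [h2]
  conv_rhs => rw [h1]
  simp only [Complex.add_re, Complex.add_im, Complex.ofReal_re, Complex.ofReal_im, Complex.mul_re,
    Complex.mul_im, Complex.I_re, Complex.I_im, mul_zero, mul_one, add_zero,
    zero_add, sub_self]
  linear_combination (v i).im * B * Complex.I_mul_I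

/-- An analytic function on `ℂⁿ` is determined by its mixed Wirtinger derivatives at one point. -/
theorem eq_zero_of_mixedD_eq_zero {f : (Fin n → ℂ) → ℂ} (hf : AnalyticOnNhd ℝ f Set.univ)
    {p : Fin n → ℂ} (h0 : ∀ R S, mixedD R S f p = 0) : f = 0 := by
  funext w
  obtain ⟨v, rfl⟩ : ∃ v, w = p + v := ⟨w - p, by simp⟩
  have hline : AnalyticOnNhd ℝ (fun t : ℝ => p + t • v) Set.univ :=
    analyticOnNhd_const.add (((ContinuousLinearMap.id ℝ ℝ).smulRight v).analyticOnNhd _)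
  have hcomp : ∀ g : (Fin n → ℂ) → ℂ, AnalyticOnNhd ℝ g Set.univ →
      AnalyticOnNhd ℝ (fun t : ℝ => g (p + t • v)) Set.univ := fun g hg =>
    hg.comp hline fun _ _ => Set.mem_univ _
  -- Restricted to a real line through `p`, the derivative of `g` is a combination of its first
  -- Wirtinger derivatives. Their jets at `p` vanish too, so the induction must run over all such
  -- `g` at once.
  have key : ∀ (k : ℕ) (g : (Fin n → ℂ) → ℂ), AnalyticOnNhd ℝ g Set.univ →
      (∀ R S, mixedD R S g p = 0) → iteratedDeriv k (fun t : ℝ => g (p + t • v)) 0 = 0 := by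
    intro k
    induction k with
    | zero =>
      intro g _ h
      have := h 0 0
      simpa [mixedD, iterD] using this
    | succ k ih =>
      intro g hg h
      have hd : deriv (fun t : ℝ => g (p + t • v)) = fun t => ∑ i,
          (v i * wirt (-Complex.I) i g (p + t • v) + conj (v i) * wirt Complex.I i g (p + t • v)) := by
        funext t
        rw [← fderiv_eq_sum_wirt]
        have h1 : HasDerivAt (fun t : ℝ => p + t • v) v t := by
          have := ((hasDerivAt_id t).smul_const v).const_add p
          simpa using this
        exact ((hg _ (Set.mem_univ _)).differentiableAt.hasFDerivAt.comp_hasDerivAt t h1).deriv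
      have hA : ∀ s i, ContDiffAt ℝ k (fun t : ℝ => wirt s i g (p + t • v)) 0 := fun s i =>
        (hcomp _ (wirt_analytic hg s i) 0 (Set.mem_univ _)).contDiffAt
      have hz : ∀ i, iteratedDeriv k (fun t : ℝ => wirt (-Complex.I) i g (p + t • v)) 0 = 0 := by
        intro i
        refine ih _ (wirt_analytic hg _ i) fun R S => ?_
        rw [← h (R + Pi.single i 1) S, mixedD, mixedD, dz_eq_wirt, dzbar_eq_wirt,
          iterD_wirt_comm hg, iterD_wirt_add_single (iterD_wirt_analytic hg _ _),
          iterD_wirt_comm (iterD_wirt_analytic hg _ _)]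
      have hzb : ∀ i, iteratedDeriv k (fun t : ℝ => wirt Complex.I i g (p + t • v)) 0 = 0 := by
        intro i
        refine ih _ (wirt_analytic hg _ i) fun R S => ?_
        rw [← h R (S + Pi.single i 1), mixedD, mixedD, dz_eq_wirt, dzbar_eq_wirt,
          iterD_wirt_add_single hg, iterD_wirt_comm hg]
      rw [iteratedDeriv_succ', hd, iteratedDeriv_fun_sum fun i _ =>
        (contDiffAt_const.mul (hA _ i)).add (contDiffAt_const.mul (hA _ i))]
      refine Finset.sum_eq_zero fun i _ => ?_
      rw [iteratedDeriv_fun_add (contDiffAt_const.mul (hA _ i)) (contDiffAt_const.mul (hA _ i)),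
        iteratedDeriv_const_mul _ (hA _ i), iteratedDeriv_const_mul _ (hA _ i), hz, hzb]
      simp
  have hφ := hcomp f hf
  -- The one-variable identity theorem: vanishing to infinite order at 0 forces vanishing at $t=1$,
  -- that is, at `p + v`.
  have h1 : analyticOrderAt (fun t : ℝ => f (p + t • v)) 0 = ⊤ :=
    ENat.eq_top_iff_forall_ge.2 fun m => (natCast_le_analyticOrderAt_iff_iteratedDeriv_eq_zero
      (hφ 0 (Set.mem_univ _))).2 fun k _ => key k f hf h0
  have h2 := hφ.eqOn_zero_of_preconnected_of_eventuallyEq_zero isPreconnected_univ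
    (Set.mem_univ 0) (analyticOrderAt_eq_top.1 h1) (Set.mem_univ 1)
  simpa using h2

/-- Moving the jet from `p` to the origin gives coefficients of an entire function whose jet at `p`
is that of `f`; uniqueness does the rest. -/
theorem eq_wickFun_of_growth_jet {f : (Fin n → ℂ) → ℂ} (hf : AnalyticOnNhd ℝ f Set.univ)
    {p : Fin n → ℂ} (hp : Growth (jet f p)) :
    f = wickFun (recenter (jet f p) (conjGraph (-p))) := by
  set c := recenter (jet f p) (conjGraph (-p)) with hc
  have hcg : Growth c := hp.recenter _
  rw [← sub_eq_zero]
  refine eq_zero_of_mixedD_eq_zero (p := p) (hf.sub (analyticOnNhd_wickFun hcg)) fun R S => ?_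
  rw [mixedD_sub hf (analyticOnNhd_wickFun hcg), Pi.sub_apply, sub_eq_zero]
  have h1 : jet (wickFun c) p = jet f p := by
    rw [jet_wickFun hcg, hc, recenter_recenter hp, ← map_add, neg_add_cancel, map_zero,
      recenter_zero]
  exact (congrFun h1 (Sum.elim R S)).symm

end Uniqueness

/-! ### The seminorms and the growth of Taylor coefficients -/

section Seminorms

variable {n : ℕ}

theorem sum_Iic_mbinom (R : MIdx n) : ∑ I ∈ Finset.Iic R, mbinom R I = 2 ^ mdeg R := by
  have h : Finset.Iic R = Fintype.piFinset fun i => Finset.Iic (R i) := by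
    ext I
    simp [Pi.le_def]
  rw [h, mdeg, ← Finset.prod_pow_eq_pow_sum]
  unfold mbinom
  rw [← Finset.prod_univ_sum (fun i => Finset.Iic (R i)) fun i j => (R i).choose j]
  refine Finset.prod_congr rfl fun i _ => ?_
  rw [← Nat.range_succ_eq_Iic]
  exact Nat.sum_range_choose (R i)

theorem mfact_ne_zero (N : MIdx n) : (mfact N : ℝ≥0∞) ≠ 0 := by
  exact_mod_cast (tfact_pos N).ne'

theorem sq_div_mfact_eq_ofReal (N : MIdx n) {a : ℝ} (ha : 0 ≤ a) :
    (mfact N : ℝ≥0∞)⁻¹ * ENNReal.ofReal a ^ 2 = ENNReal.ofReal (a ^ 2 / mfact N) := by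
  have h : (0 : ℝ) < mfact N := by exact_mod_cast tfact_pos N
  rw [div_eq_inv_mul, ENNReal.ofReal_mul (by positivity), ENNReal.ofReal_inv_of_pos h,
    ENNReal.ofReal_natCast, ENNReal.ofReal_pow ha]

/-- One step of the seminorm recursion in abstract form: a weighted sum of squares of subfactorial
quantities is subfactorial. The exponent `δ` is found before `C`, since the constant `C` of the
growth hypothesis depends on `δ`. -/
theorem exists_tsum_sq_bound (n : ℕ) {A ε : ℝ} (hA : 0 ≤ A) (hε : 0 < ε) :
    ∃ δ, 0 < δ ∧ ∀ C, 0 < C → ∃ D, 0 < D ∧ ∀ d : ℕ, ∑' N : MIdx n,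
      ENNReal.ofReal ((C * (A ^ (d + tdeg N) * wt δ (d + tdeg N))) ^ 2 / mfact N) ≤
        ENNReal.ofReal (D * wt ε d) := by
  set η := min ε (1 / 2) with hη
  have hη0 : 0 < η := by positivity
  -- Three doublings: absorbing the power of `A`, splitting $d+|N|$, and squaring.
  refine ⟨η / 8, by positivity, fun C hC => ?_⟩
  set δ := η / 8 with hδ
  have hδ0 : 0 < δ := by positivity
  obtain ⟨B, hB, h1⟩ := pow_le_wt hδ0 hA
  obtain ⟨F, hF, h2⟩ := wt_add_le (ε := 2 * δ) (by positivity)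
  have hs := summable_wt (ι := Fin n) (ε := η) (A := 1)
    ((min_le_right _ _).trans_lt (by norm_num)) zero_le_one
  set T := ∑' N : MIdx n, wt η (tdeg N) * (1 ^ tdeg N / tfact N)
  have hT : 0 ≤ T := tsum_nonneg fun N => by
    have := wt_pos η (tdeg N)
    positivity
  refine ⟨(C * B * F) ^ 2 * (T + 1), by positivity, fun d => ?_⟩
  have hd := wt_pos η d
  have hdε := wt_pos ε d
  have hb : ∀ N : MIdx n, (C * (A ^ (d + tdeg N) * wt δ (d + tdeg N))) ^ 2 / mfact N ≤
      (C * B * F) ^ 2 * wt η d * (wt η (tdeg N) * (1 ^ tdeg N / tfact N)) := fun N => by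
    have hk := wt_pos δ (d + tdeg N)
    have hN := wt_pos η (tdeg N)
    have h3 : A ^ (d + tdeg N) * wt δ (d + tdeg N) ≤
        B * (F * (wt (4 * δ) d * wt (4 * δ) (tdeg N))) := by
      calc _ ≤ B * wt δ (d + tdeg N) * wt δ (d + tdeg N) := by gcongr; exact h1 _
        _ = B * wt (2 * δ) (d + tdeg N) := by rw [two_mul, wt_add_exponent]; ring
        _ ≤ _ := by
          have := h2 d (tdeg N)
          rw [show 2 * (2 * δ) = 4 * δ by ring] at this
          gcongr
    have h4 : ∀ k, wt (4 * δ) k ^ 2 = wt η k := fun k => by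
      rw [sq, ← wt_add_exponent]
      congr 1
      rw [hδ]
      ring
    have hf : (0 : ℝ) < tfact N := by exact_mod_cast tfact_pos N
    change _ / (tfact N : ℝ) ≤ _
    calc _ ≤ (C * (B * (F * (wt (4 * δ) d * wt (4 * δ) (tdeg N))))) ^ 2 / tfact N := by
          gcongr
      _ = (C * B * F) ^ 2 * (wt (4 * δ) d ^ 2) * (wt (4 * δ) (tdeg N) ^ 2 / tfact N) := by ring
      _ = _ := by rw [h4, h4, one_pow]; ring
  calc _ ≤ ∑' N : MIdx n, ENNReal.ofReal
        ((C * B * F) ^ 2 * wt η d * (wt η (tdeg N) * (1 ^ tdeg N / tfact N))) :=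
        ENNReal.tsum_le_tsum fun N => ENNReal.ofReal_le_ofReal (hb N)
    _ = ENNReal.ofReal ((C * B * F) ^ 2 * wt η d * T) := by
        rw [← ENNReal.ofReal_tsum_of_nonneg _ (hs.mul_left _), tsum_mul_left]
        intro N
        have := wt_pos η (tdeg N)
        positivity
    _ ≤ _ := by
        refine ENNReal.ofReal_le_ofReal ?_
        have h5 := wt_le_wt (min_le_left ε (1 / 2)) d
        calc _ ≤ (C * B * F) ^ 2 * wt ε d * (T + 1) := by
              gcongr
              linarith
          _ = _ := by ring

/-- Induction on `m` with all `ε` at once, as each step of the recursion enlarges the exponent. The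
constant does not depend on `ℓ`. -/
theorem hSeq_bound {ħ : ℝ} (hħ : 0 < ħ) {p : Fin n → ℂ} {f : (Fin n → ℂ) → ℂ}
    (hf : Growth (jet f p)) (m : ℕ) : ∀ ε : ℝ, 0 < ε → ∃ C, 0 < C ∧ ∀ ℓ R S,
      hSeq ħ p f m ℓ R S ≤ ENNReal.ofReal (C * wt ε (tdeg R + tdeg S)) := by
  induction m with
  | zero =>
    intro ε hε
    -- Since $2\hbar\le(1+2\hbar)^2$, the power of $2\hbar$ moves inside the square without a root.
    obtain ⟨δ, hδ, h⟩ := exists_tsum_sq_bound n (A := 1 + 2 * ħ) (by positivity) hε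
    obtain ⟨C, hC, hb⟩ := hf δ hδ
    obtain ⟨D, hD, h'⟩ := h C hC
    refine ⟨D, hD, fun ℓ R S => ?_⟩
    rw [hSeq]
    refine le_trans (ENNReal.tsum_le_tsum fun N => ENNReal.ofReal_le_ofReal ?_)
      (h' (tdeg R + tdeg S))
    have h1 := hb (Sum.elim R (N + S))
    rw [tdeg_elim, tdeg_add, show tdeg R + (tdeg N + tdeg S) = tdeg R + tdeg S + tdeg N by ring] at h1
    change ‖mixedD R (N + S) f p‖ ≤ _ at h1
    change (2 * ħ) ^ (tdeg R + tdeg S + tdeg N) / (mfact N : ℝ) * _ ≤ _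
    set k := tdeg R + tdeg S + tdeg N
    have hw := wt_pos δ k
    have h2 : (2 * ħ) ^ k ≤ ((1 + 2 * ħ) ^ k) ^ 2 := by
      have h3 : (1 : ℝ) ≤ (1 + 2 * ħ) ^ k := one_le_pow₀ (by linarith)
      have h4 : (2 * ħ) ^ k ≤ (1 + 2 * ħ) ^ k := by gcongr; linarith
      nlinarith
    calc _ ≤ ((1 + 2 * ħ) ^ k) ^ 2 / mfact N * (C * wt δ k) ^ 2 := by gcongr
      _ = _ := by ring
  | succ m ih =>
    intro ε hε
    -- The binomial coefficients sum to $2^{|R|}\,2^{|N+S|}$.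
    obtain ⟨δ, hδ, h⟩ := exists_tsum_sq_bound n (A := 2) (by positivity) hε
    obtain ⟨C, hC, hb⟩ := ih δ hδ
    obtain ⟨D, hD, h'⟩ := h C hC
    refine ⟨D, hD, fun ℓ R S => ?_⟩
    have key : ∀ G : MIdx n → MIdx n → ℝ≥0∞,
        (∀ I J, G I J ≤ ENNReal.ofReal (C * wt δ (tdeg I + tdeg J))) →
        ∑' N : MIdx n, (mfact N : ℝ≥0∞)⁻¹ * (∑ I ∈ Finset.Iic R, ∑ J ∈ Finset.Iic (N + S),
          (mbinom R I : ℝ≥0∞) * (mbinom (N + S) J : ℝ≥0∞) * G I J) ^ 2 ≤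
          ENNReal.ofReal (D * wt ε (tdeg R + tdeg S)) := by
      intro G hG
      refine le_trans (ENNReal.tsum_le_tsum fun N => ?_) (h' (tdeg R + tdeg S))
      set k := tdeg R + tdeg S + tdeg N with hk
      have hw := wt_pos δ k
      rw [← sq_div_mfact_eq_ofReal N (by positivity)]
      gcongr
      calc _ ≤ ∑ I ∈ Finset.Iic R, ∑ J ∈ Finset.Iic (N + S),
            (mbinom R I : ℝ≥0∞) * (mbinom (N + S) J : ℝ≥0∞) * ENNReal.ofReal (C * wt δ k) := by
            refine Finset.sum_le_sum fun I hI => Finset.sum_le_sum fun J hJ => ?_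
            gcongr
            refine (hG I J).trans (ENNReal.ofReal_le_ofReal ?_)
            have h1 : tdeg I + tdeg J ≤ k := by
              have h2 : tdeg I ≤ tdeg R := Finset.sum_le_sum fun i _ => Finset.mem_Iic.1 hI i
              have h3 : tdeg J ≤ tdeg (N + S) := Finset.sum_le_sum fun i _ => Finset.mem_Iic.1 hJ i
              rw [tdeg_add] at h3
              omega
            have h4 : wt δ (tdeg I + tdeg J) ≤ wt δ k :=
              Real.rpow_le_rpow (by positivity) (by exact_mod_cast Nat.factorial_le h1) hδ.le
            gcongr
        _ = ((∑ I ∈ Finset.Iic R, mbinom R I : ℕ) : ℝ≥0∞) *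
            ((∑ J ∈ Finset.Iic (N + S), mbinom (N + S) J : ℕ) : ℝ≥0∞) *
              ENNReal.ofReal (C * wt δ k) := by
            push_cast
            rw [Finset.sum_mul_sum, Finset.sum_mul]
            simp only [Finset.sum_mul]
        _ = ENNReal.ofReal (C * (2 ^ k * wt δ k)) := by
            rw [sum_Iic_mbinom, sum_Iic_mbinom, ← Nat.cast_mul, ← pow_add,
              ← ENNReal.ofReal_natCast, ← ENNReal.ofReal_mul (by positivity)]
            congr 1
            have : mdeg R + mdeg (N + S) = k := by
              change tdeg R + tdeg (N + S) = k
              rw [tdeg_add]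
              omega
            rw [this]
            push_cast
            ring
    rw [hSeq]
    split_ifs
    · exact key _ fun I J => hb _ I J
    -- The exchanged indices for odd `ℓ` do no harm, because the weight depends only on the sum of
    -- the degrees.
    · exact key _ fun I J => by
        rw [add_comm]
        exact hb _ J I

/-- Keep only the summand `N` and in it the extreme indices $I=R$, $J=N+S$, whose binomial
coefficients are 1. The even branch controls the growth in the second index, the odd branch that in
the first. -/
theorem sq_hSeq_le_even (ħ : ℝ) (p : Fin n → ℂ) (f : (Fin n → ℂ) → ℂ) (m ℓ : ℕ) (R S N : MIdx n) :
    hSeq ħ p f m ℓ R (N + S) ^ 2 ≤ mfact N * hSeq ħ p f (m + 1) (2 * ℓ) R S := by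
  rw [mul_comm, ← ENNReal.div_le_iff (mfact_ne_zero N) (ENNReal.natCast_ne_top _), hSeq,
    if_pos (even_two_mul ℓ), Nat.mul_div_cancel_left ℓ two_pos, ENNReal.div_eq_inv_mul]
  refine le_trans ?_ (ENNReal.le_tsum N)
  gcongr
  refine le_trans ?_ (Finset.single_le_sum (fun _ _ => zero_le) (Finset.mem_Iic.2 le_rfl))
  refine le_trans ?_ (Finset.single_le_sum (fun _ _ => zero_le) (Finset.mem_Iic.2 le_rfl))
  simp [mbinom]

theorem sq_hSeq_le_odd (ħ : ℝ) (p : Fin n → ℂ) (f : (Fin n → ℂ) → ℂ) (m ℓ : ℕ) (R S N : MIdx n) :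
    hSeq ħ p f m ℓ (N + S) R ^ 2 ≤ mfact N * hSeq ħ p f (m + 1) (2 * ℓ + 1) R S := by
  have h : (2 * ℓ + 1) / 2 = ℓ := by omega
  rw [mul_comm, ← ENNReal.div_le_iff (mfact_ne_zero N) (ENNReal.natCast_ne_top _), hSeq,
    if_neg (by simp), h, ENNReal.div_eq_inv_mul]
  refine le_trans ?_ (ENNReal.le_tsum N)
  gcongr
  refine le_trans ?_ (Finset.single_le_sum (fun _ _ => zero_le) (Finset.mem_Iic.2 le_rfl))
  refine le_trans ?_ (Finset.single_le_sum (fun _ _ => zero_le) (Finset.mem_Iic.2 le_rfl))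
  simp [mbinom]

/-- An odd step controls $h(N,0)$ by $N!$, an even step reduces $h(R,S)^2$ to this case, and then
$h_m^2\le h_{m+1}$ doubles the power at each induction step while the right-hand side keeps its
form. This is where all the levels `m` of seminorms are needed. -/
theorem hSeq_pow_le {ħ : ℝ} {p : Fin n → ℂ} {f : (Fin n → ℂ) → ℂ}
    (hf : ∀ m ℓ, ℓ < 2 ^ m → ∀ R S, hSeq ħ p f m ℓ R S ≠ ∞) (k : ℕ) :
    ∀ m ℓ, ℓ < 2 ^ m → ∃ C : ℝ≥0∞, C ≠ ∞ ∧ ∀ R S,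
      hSeq ħ p f m ℓ R S ^ 2 ^ (k + 1) ≤ C * (mfact R * mfact S) := by
  have hB : ∀ m ℓ, ℓ < 2 ^ m → ∃ C : ℝ≥0∞, C ≠ ∞ ∧ ∀ N, hSeq ħ p f m ℓ N 0 ≤ C * mfact N := by
    intro m ℓ hℓ
    -- The summand 1 covers values below one, since $1\le N!$; values above one are at most their
    -- squares.
    refine ⟨1 + hSeq ħ p f (m + 1) (2 * ℓ + 1) 0 0, ENNReal.add_ne_top.2
      ⟨ENNReal.one_ne_top, hf _ _ (by rw [pow_succ]; omega) _ _⟩, fun N => ?_⟩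
    have h := sq_hSeq_le_odd ħ p f m ℓ 0 0 N
    rw [add_zero] at h
    have h1 : (1 : ℝ≥0∞) ≤ mfact N := by exact_mod_cast tfact_pos N
    rw [add_mul, one_mul]
    rcases le_total (hSeq ħ p f m ℓ N 0) 1 with h2 | h2
    · exact le_add_right (h2.trans h1)
    · refine le_add_left ?_
      rw [mul_comm]
      refine le_trans ?_ h
      rw [sq]
      exact le_mul_of_one_le_left zero_le h2
  induction k with
  | zero =>
    intro m ℓ hℓ
    obtain ⟨C, hC, h⟩ := hB (m + 1) (2 * ℓ) (by rw [pow_succ]; omega)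
    refine ⟨C, hC, fun R S => ?_⟩
    have h1 := sq_hSeq_le_even ħ p f m ℓ R 0 S
    rw [add_zero] at h1
    rw [zero_add, pow_one]
    refine h1.trans ?_
    calc _ ≤ (mfact S : ℝ≥0∞) * (C * mfact R) := by
          gcongr
          exact h R
      _ = _ := by ring
  | succ k ih =>
    intro m ℓ hℓ
    obtain ⟨C, hC, h⟩ := ih (m + 1) (2 * ℓ) (by rw [pow_succ]; omega)
    refine ⟨C, hC, fun R S => ?_⟩
    have h1 := sq_hSeq_le_even ħ p f m ℓ R S 0
    have h2 : mfact (0 : MIdx n) = 1 := tfact_zero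
    rw [zero_add, h2, Nat.cast_one, one_mul] at h1
    rw [pow_succ 2 (k + 1), mul_comm, pow_mul]
    exact (pow_le_pow_left' h1 _).trans (h R S)

theorem growth_jet_of_hSeq {ħ : ℝ} (hħ : 0 < ħ) {p : Fin n → ℂ} {f : (Fin n → ℂ) → ℂ}
    (hf : ∀ m ℓ, ℓ < 2 ^ m → ∀ R S, hSeq ħ p f m ℓ R S ≠ ∞) : Growth (jet f p) := by
  intro ε hε
  obtain ⟨k, hk⟩ := exists_nat_gt (1 / ε)
  -- The $K$-th root turns the factorial bound into one with exponent $1/K\le\varepsilon$.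
  set K := 2 ^ (k + 1) with hK
  have hK0 : (0 : ℝ) < K := by positivity
  have hKε : (K : ℝ)⁻¹ ≤ ε := by
    rw [inv_le_comm₀ hK0 hε, ← one_div]
    refine hk.le.trans ?_
    have : k ≤ K := (Nat.le_succ k).trans Nat.lt_two_pow_self.le
    exact_mod_cast this
  obtain ⟨C, hC, h⟩ := hSeq_pow_le hf k 0 0 (by simp)
  obtain ⟨B, hB, hB2⟩ := pow_le_wt (ε := ε) (A := (2 * ħ)⁻¹) hε (by positivity)
  refine ⟨(B * C.toReal ^ (K : ℝ)⁻¹ + 1) ^ (1 / 2 : ℝ), by positivity, fun x => ?_⟩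
  set R : MIdx n := x ∘ Sum.inl
  set S : MIdx n := x ∘ Sum.inr
  have hx : x = Sum.elim R S := (Sum.elim_comp_inl_inr x).symm
  set d := tdeg x with hd
  have hdRS : d = tdeg R + tdeg S := by rw [hd, hx, tdeg_elim]
  set t := (2 * ħ) ^ d * ‖jet f p x‖ ^ 2 with ht
  have ht0 : 0 ≤ t := by positivity
  -- This is the term $N=0$ of the series for $h_0$.
  have h1 : ENNReal.ofReal t ≤ hSeq ħ p f 0 0 R S := by
    rw [hSeq]
    refine le_trans (le_of_eq ?_) (ENNReal.le_tsum 0)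
    have h2 : mfact (0 : MIdx n) = 1 := tfact_zero
    have h3 : mdeg (0 : MIdx n) = 0 := tdeg_zero
    rw [h2, h3, zero_add, add_zero, Nat.cast_one, div_one, ht, hdRS]
    rfl
  have h2 : t ^ K ≤ C.toReal * d.factorial := by
    have h3 := (pow_le_pow_left' h1 K).trans (h R S)
    have h4 : ((mfact R : ℝ≥0∞) * mfact S) ≤ (d.factorial : ℝ≥0∞) := by
      have := tfact_le x
      rw [hx, tfact_elim, ← hx] at this
      exact_mod_cast this
    have h5 : ENNReal.ofReal t ^ K ≤ C * d.factorial := h3.trans (by gcongr)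
    rw [← ENNReal.ofReal_pow ht0, ENNReal.ofReal_le_iff_le_toReal
      (ENNReal.mul_ne_top hC (ENNReal.natCast_ne_top _)), ENNReal.toReal_mul,
      ENNReal.toReal_natCast] at h5
    exact h5
  have h3 : t ≤ C.toReal ^ (K : ℝ)⁻¹ * wt ε d := by
    have h4 := Real.rpow_le_rpow (by positivity) h2 (inv_nonneg.2 hK0.le)
    rw [Real.pow_rpow_inv_natCast ht0 (by positivity), Real.mul_rpow (by positivity)
      (by positivity)] at h4
    refine h4.trans ?_
    have := wt_le_wt hKε d
    unfold wt at this ⊢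
    gcongr
  have hw := wt_pos ε d
  have h4 : ‖jet f p x‖ ^ 2 ≤ (B * C.toReal ^ (K : ℝ)⁻¹ + 1) * wt ε d ^ 2 := by
    have h5 : ‖jet f p x‖ ^ 2 = (2 * ħ)⁻¹ ^ d * t := by
      rw [ht, ← mul_assoc, ← mul_pow, inv_mul_cancel₀ (by positivity), one_pow, one_mul]
    rw [h5]
    calc _ ≤ B * wt ε d * (C.toReal ^ (K : ℝ)⁻¹ * wt ε d) := by
          gcongr
          exact hB2 d
      _ = B * C.toReal ^ (K : ℝ)⁻¹ * wt ε d ^ 2 := by ring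
      _ ≤ _ := by
          gcongr
          linarith
  have h5 := Real.sqrt_le_sqrt h4
  rw [Real.sqrt_sq (norm_nonneg _), Real.sqrt_mul (by positivity), Real.sqrt_sq hw.le,
    Real.sqrt_eq_rpow] at h5
  exact h5

theorem wickSeminorm_lt_top {ħ : ℝ} {p : Fin n → ℂ} {m ℓ : ℕ} {R S : MIdx n}
    {f : (Fin n → ℂ) → ℂ} : wickSeminorm ħ p m ℓ R S f < ∞ ↔ hSeq ħ p f m ℓ R S ≠ ∞ := by
  have h : (0 : ℝ) < 1 / 2 ^ (m + 1) := by positivity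
  rw [wickSeminorm, ENNReal.rpow_lt_top_iff_of_pos h, lt_top_iff_ne_top]

/-- The pivot of the proof: seminorms, base point and ħ disappear, and only coefficient growth is
used from here on. -/
theorem mem_wickAlgebra_iff {ħ : ℝ} (hħ : 0 < ħ) {p : Fin n → ℂ} {f : (Fin n → ℂ) → ℂ} :
    f ∈ wickAlgebra n ħ p ↔ ∃ c, Growth c ∧ f = wickFun c := by
  constructor
  · rintro ⟨h1, h2⟩
    have h3 := growth_jet_of_hSeq hħ fun m ℓ hℓ R S => wickSeminorm_lt_top.1 (h2 m ℓ hℓ R S)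
    exact ⟨_, h3.recenter _, eq_wickFun_of_growth_jet h1 h3⟩
  · rintro ⟨c, hc, rfl⟩
    refine ⟨analyticOnNhd_wickFun hc, fun m ℓ _ R S => wickSeminorm_lt_top.2 ?_⟩
    have hj : Growth (jet (wickFun c) p) := by
      rw [jet_wickFun hc]
      exact hc.recenter _
    obtain ⟨C, -, h⟩ := hSeq_bound hħ hj m 1 one_pos
    exact ((h ℓ R S).trans_lt ENNReal.ofReal_lt_top).ne

end Seminorms

/-! ### The Wick star algebra -/

section Algebra

variable {n : ℕ}

/-- The functions of the Wick algebra, without reference to a base point. -/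
def IsWick (f : (Fin n → ℂ) → ℂ) : Prop := ∃ c, Growth c ∧ f = wickFun c

theorem IsWick.growth_jet {f : (Fin n → ℂ) → ℂ} (hf : IsWick f) (q : Fin n → ℂ) :
    Growth (jet f q) := by
  obtain ⟨c, hc, rfl⟩ := hf
  rw [jet_wickFun hc]
  exact hc.recenter _

theorem IsWick.translate_eq {f : (Fin n → ℂ) → ℂ} (hf : IsWick f) (q : Fin n → ℂ) :
    (fun z => f (z + q)) = wickFun (jet f q) := by
  obtain ⟨c, hc, rfl⟩ := hf
  funext z
  rw [jet_wickFun hc, wickFun, wickFun, ← taylorSum_add hc, ← map_add, add_comm q]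

theorem IsWick.eq_wickFun_jet {f : (Fin n → ℂ) → ℂ} (hf : IsWick f) : f = wickFun (jet f 0) := by
  simpa using hf.translate_eq 0

theorem IsWick.translate {f : (Fin n → ℂ) → ℂ} (hf : IsWick f) (q : Fin n → ℂ) :
    IsWick fun z => f (z + q) := ⟨_, hf.growth_jet q, hf.translate_eq q⟩

theorem jet_wickFun_zero {c : (Fin n ⊕ Fin n → ℕ) → ℂ} (hc : Growth c) :
    jet (wickFun c) 0 = c := by
  rw [jet_wickFun hc, map_zero, recenter_zero]

theorem IsWick.star {f : (Fin n → ℂ) → ℂ} (hf : IsWick f) : IsWick (star f) := by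
  obtain ⟨c, hc, rfl⟩ := hf
  have hdeg : ∀ x : Fin n ⊕ Fin n → ℕ, tdeg (x ∘ Sum.swap) = tdeg x := fun x =>
    Equiv.sum_comp (Equiv.sumComm (Fin n) (Fin n)) x
  -- Conjugation exchanges the roles of $z$ and $\bar z$.
  refine ⟨fun x => conj (c (x ∘ Sum.swap)), fun ε hε => ?_, ?_⟩
  · obtain ⟨C, hC, h⟩ := hc ε hε
    refine ⟨C, hC, fun x => ?_⟩
    rw [RCLike.norm_conj, ← hdeg x]
    exact h _
  · funext z
    let e : (Fin n ⊕ Fin n → ℕ) ≃ (Fin n ⊕ Fin n → ℕ) :=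
      Equiv.arrowCongr (Equiv.sumComm (Fin n) (Fin n)) (Equiv.refl ℕ)
    have he : ∀ x, e x = x ∘ Sum.swap := fun x => rfl
    simp only [Pi.star_apply, wickFun, taylorSum, RCLike.star_def]
    rw [Complex.conj_tsum, ← e.tsum_eq]
    refine tsum_congr fun x => ?_
    rw [map_mul, he]
    congr 1
    rw [dpow, dpow, map_prod, conjGraph_apply, Fintype.prod_sum_type, Fintype.prod_sum_type, mul_comm]
    simp

theorem IsWick.iterD_dz {f : (Fin n → ℂ) → ℂ} (hf : IsWick f) (N : MIdx n) (z : Fin n → ℂ) :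
    iterD dz N f z = jet f z (Sum.elim N (0 : Fin n → ℕ)) := by
  obtain ⟨c, hc, rfl⟩ := hf
  rw [iterD_dz_wickFun N hc, jet_wickFun hc]
  rfl

theorem IsWick.iterD_dzbar {f : (Fin n → ℂ) → ℂ} (hf : IsWick f) (N : MIdx n) (z : Fin n → ℂ) :
    iterD dzbar N f z = jet f z (Sum.elim (0 : Fin n → ℕ) N) := by
  obtain ⟨c, hc, rfl⟩ := hf
  rw [iterD_dzbar_wickFun N hc, jet_wickFun hc]
  rfl

theorem IsWick.jet_translate {f : (Fin n → ℂ) → ℂ} (hf : IsWick f) (q z : Fin n → ℂ) :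
    jet (fun z => f (z + q)) z = jet f (z + q) := by
  rw [hf.translate_eq, jet_wickFun (hf.growth_jet q)]
  obtain ⟨c, hc, rfl⟩ := hf
  rw [jet_wickFun hc, jet_wickFun hc, recenter_recenter hc, ← map_add, add_comm]

theorem wickTerm_eq {f g : (Fin n → ℂ) → ℂ} (hf : IsWick f) (hg : IsWick g) (ħ : ℝ)
    (z : Fin n → ℂ) (N : MIdx n) : wickTerm ħ f g z N =
      (((2 * ħ : ℝ) : ℂ) ^ tdeg N / tfact N) *
        (jet f z (Sum.elim N (0 : Fin n → ℕ)) * jet g z (Sum.elim (0 : Fin n → ℕ) N)) := by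
  rw [wickTerm, hf.iterD_dz, hg.iterD_dzbar, mul_assoc]
  push_cast
  rfl

theorem hasSum_wickTerm {f g : (Fin n → ℂ) → ℂ} (hf : IsWick f) (hg : IsWick g) (ħ : ℝ)
    (z : Fin n → ℂ) : HasSum (wickTerm ħ f g z)
      (wickFun (starCoef (2 * ħ) (jet f 0) (jet g 0)) z) := by
  have h := hasSum_taylorSum_star (h := 2 * ħ) (hf.growth_jet 0) (hg.growth_jet 0) (conjGraph z)
  refine h.congr_fun fun N => ?_
  rw [wickTerm_eq hf hg]
  nth_rw 1 [hf.eq_wickFun_jet, hg.eq_wickFun_jet]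
  rw [jet_wickFun (hf.growth_jet 0), jet_wickFun (hg.growth_jet 0)]
  rfl

theorem wickMul_eq_wickFun {f g : (Fin n → ℂ) → ℂ} (hf : IsWick f) (hg : IsWick g) (ħ : ℝ) :
    wickMul ħ f g = wickFun (starCoef (2 * ħ) (jet f 0) (jet g 0)) :=
  funext fun z => (hasSum_wickTerm hf hg ħ z).tsum_eq

theorem IsWick.wickMul {f g : (Fin n → ℂ) → ℂ} (hf : IsWick f) (hg : IsWick g) (ħ : ℝ) :
    IsWick (wickMul ħ f g) :=
  ⟨_, (hf.growth_jet 0).starCoef (hg.growth_jet 0), wickMul_eq_wickFun hf hg ħ⟩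

theorem wickMul_translate {f g : (Fin n → ℂ) → ℂ} (hf : IsWick f) (hg : IsWick g) (ħ : ℝ)
    (q : Fin n → ℂ) : wickMul ħ (fun z => f (z + q)) (fun z => g (z + q)) =
      fun z => wickMul ħ f g (z + q) := by
  funext z
  refine tsum_congr fun N => ?_
  rw [wickTerm_eq (hf.translate q) (hg.translate q), wickTerm_eq hf hg, hf.jet_translate,
    hg.jet_translate]

/-- The star product has constant coefficients, hence commutes with translations; this reduces the
point `q` to the origin. -/
theorem jet_wickMul {f g : (Fin n → ℂ) → ℂ} (hf : IsWick f) (hg : IsWick g) (ħ : ℝ)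
    (q : Fin n → ℂ) : jet (wickMul ħ f g) q = starCoef (2 * ħ) (jet f q) (jet g q) := by
  have h := (hf.wickMul hg ħ).jet_translate q 0
  rw [zero_add] at h
  rw [← h, ← wickMul_translate hf hg, wickMul_eq_wickFun (hf.translate q) (hg.translate q),
    jet_wickFun_zero (((hf.translate q).growth_jet 0).starCoef ((hg.translate q).growth_jet 0)),
    hf.jet_translate, hg.jet_translate, zero_add]

/-! ### Associativity -/

theorem conv_elim_left (c d : (Fin n ⊕ Fin n → ℕ) → ℂ) (N : MIdx n) :
    conv c d (Sum.elim N (0 : Fin n → ℕ)) = ∑ q ∈ Finset.HasAntidiagonal.antidiagonal N,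
      (tfact N / (tfact q.1 * tfact q.2) : ℂ) *
        (c (Sum.elim q.1 (0 : Fin n → ℕ)) * d (Sum.elim q.2 (0 : Fin n → ℕ))) := by
  symm
  refine Finset.sum_nbij'
    (fun q => (Sum.elim q.1 (0 : Fin n → ℕ), Sum.elim q.2 (0 : Fin n → ℕ)))
    (fun q => (q.1 ∘ Sum.inl, q.2 ∘ Sum.inl)) ?_ ?_ ?_ ?_ ?_
  · intro q hq
    rw [Finset.HasAntidiagonal.mem_antidiagonal] at hq ⊢
    rw [elim_add_elim, hq, add_zero]
  · intro q hq
    rw [Finset.HasAntidiagonal.mem_antidiagonal] at hq ⊢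
    exact congrArg (fun x => x ∘ Sum.inl) hq
  · intro q _
    rfl
  · intro q hq
    rw [Finset.HasAntidiagonal.mem_antidiagonal] at hq
    have h : ∀ i, q.1 (Sum.inr i) = 0 ∧ q.2 (Sum.inr i) = 0 := fun i => by
      have := congrFun hq (Sum.inr i)
      simpa using this
    ext i <;> rcases i with i | i <;> simp [h]
  · intro q _
    simp only [tfact_elim, tfact_zero, mul_one]

theorem conv_elim_right (c d : (Fin n ⊕ Fin n → ℕ) → ℂ) (N : MIdx n) :
    conv c d (Sum.elim (0 : Fin n → ℕ) N) = ∑ q ∈ Finset.HasAntidiagonal.antidiagonal N,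
      (tfact N / (tfact q.1 * tfact q.2) : ℂ) *
        (c (Sum.elim (0 : Fin n → ℕ) q.1) * d (Sum.elim (0 : Fin n → ℕ) q.2)) := by
  symm
  refine Finset.sum_nbij'
    (fun q => (Sum.elim (0 : Fin n → ℕ) q.1, Sum.elim (0 : Fin n → ℕ) q.2))
    (fun q => (q.1 ∘ Sum.inr, q.2 ∘ Sum.inr)) ?_ ?_ ?_ ?_ ?_
  · intro q hq
    rw [Finset.HasAntidiagonal.mem_antidiagonal] at hq ⊢
    rw [elim_add_elim, hq, add_zero]
  · intro q hq
    rw [Finset.HasAntidiagonal.mem_antidiagonal] at hq ⊢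
    exact congrArg (fun x => x ∘ Sum.inr) hq
  · intro q _
    rfl
  · intro q hq
    rw [Finset.HasAntidiagonal.mem_antidiagonal] at hq
    have h : ∀ i, q.1 (Sum.inl i) = 0 ∧ q.2 (Sum.inl i) = 0 := fun i => by
      have := congrFun hq (Sum.inl i)
      simpa using this
    ext i <;> rcases i with i | i <;> simp [h]
  · intro q _
    simp only [tfact_elim, tfact_zero, one_mul]

/-- The terms of a threefold star product at a point, indexed by the contractions between the
first and second, first and third, and second and third factors. -/
def tripleTerm (h : ℝ) (c d e : (Fin n ⊕ Fin n → ℕ) → ℂ) (M K L : MIdx n) : ℂ :=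
  (h : ℂ) ^ tdeg M / tfact M * ((h : ℂ) ^ tdeg K / tfact K) * ((h : ℂ) ^ tdeg L / tfact L) *
    (c (Sum.elim (M + K) (0 : Fin n → ℕ)) * d (Sum.elim L M) * e (Sum.elim (0 : Fin n → ℕ) (K + L)))

/-- Each of `M`, `K`, `L` shifts exactly two of the three factors, so its total exponent is
$1/4+1/4<1$. -/
theorem summable_tripleTerm (h : ℝ) {c d e : (Fin n ⊕ Fin n → ℕ) → ℂ} (hc : Growth c)
    (hd : Growth d) (he : Growth e) :
    Summable fun p : (MIdx n × MIdx n) × MIdx n => tripleTerm h c d e p.1.1 p.1.2 p.2 := by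
  obtain ⟨C, hC, h1⟩ := hc.shift_bound (ε := 1 / 4) (by norm_num)
  obtain ⟨D, hD, h2⟩ := hd.shift_bound (ε := 1 / 4) (by norm_num)
  obtain ⟨E, hE, h3⟩ := he.shift_bound (ε := 1 / 4) (by norm_num)
  have hs := summable_wt (ι := Fin n) (ε := 1 / 4 + 1 / 4) (A := |h|) (by norm_num) (abs_nonneg h)
  have hnn : ∀ x : MIdx n, 0 ≤ wt (1 / 4 + 1 / 4) (tdeg x) * (|h| ^ tdeg x / tfact x) := fun x => by
    have := wt_pos (1 / 4 + 1 / 4) (tdeg x)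
    positivity
  have hs2 := (hs.mul_of_nonneg hs hnn hnn).mul_of_nonneg hs
    (fun p => mul_nonneg (hnn _) (hnn _)) hnn
  refine Summable.of_norm_bounded (hs2.mul_left (C * D * E)) fun p => ?_
  obtain ⟨⟨M, K⟩, L⟩ := p
  have hM := wt_pos (1 / 4) (tdeg M)
  have hK := wt_pos (1 / 4) (tdeg K)
  have hL := wt_pos (1 / 4) (tdeg L)
  have b1 : ‖c (Sum.elim (M + K) (0 : Fin n → ℕ))‖ ≤
      C * (wt (1 / 4) (tdeg M) * wt (1 / 4) (tdeg K)) := by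
    have := h1 (Sum.elim M (0 : Fin n → ℕ)) (Sum.elim K (0 : Fin n → ℕ))
    simpa only [elim_add_elim, add_zero, tdeg_elim, tdeg_zero] using this
  have b2 : ‖d (Sum.elim L M)‖ ≤ D * (wt (1 / 4) (tdeg L) * wt (1 / 4) (tdeg M)) := by
    have := h2 (Sum.elim L (0 : Fin n → ℕ)) (Sum.elim (0 : Fin n → ℕ) M)
    simpa only [elim_add_elim, add_zero, zero_add, tdeg_elim, tdeg_zero] using this
  have b3 : ‖e (Sum.elim (0 : Fin n → ℕ) (K + L))‖ ≤
      E * (wt (1 / 4) (tdeg K) * wt (1 / 4) (tdeg L)) := by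
    have := h3 (Sum.elim (0 : Fin n → ℕ) K) (Sum.elim (0 : Fin n → ℕ) L)
    simpa only [elim_add_elim, add_zero, zero_add, tdeg_elim, tdeg_zero] using this
  have hn : ∀ N : MIdx n, ‖(h : ℂ) ^ tdeg N / tfact N‖ = |h| ^ tdeg N / tfact N := fun N => by
    rw [norm_div, norm_pow, Complex.norm_real, Complex.norm_natCast, Real.norm_eq_abs]
  simp only [tripleTerm, norm_mul, hn, wt_add_exponent]
  calc _ ≤ |h| ^ tdeg M / tfact M * (|h| ^ tdeg K / tfact K) * (|h| ^ tdeg L / tfact L) *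
        (C * (wt (1 / 4) (tdeg M) * wt (1 / 4) (tdeg K)) *
          (D * (wt (1 / 4) (tdeg L) * wt (1 / 4) (tdeg M))) *
          (E * (wt (1 / 4) (tdeg K) * wt (1 / 4) (tdeg L)))) := by gcongr
    _ = _ := by ring

/-- The rearrangements of the three indices of a triple sum. -/
theorem tsum_starCoef_mul (h : ℝ) {c d e : (Fin n ⊕ Fin n → ℕ) → ℂ} (hc : Growth c)
    (hd : Growth d) (he : Growth e) :
    ∑' N : MIdx n, ((h : ℂ) ^ tdeg N / tfact N) *
      (starCoef h c d (Sum.elim N (0 : Fin n → ℕ)) * e (Sum.elim (0 : Fin n → ℕ) N)) =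
    ∑' p : (MIdx n × MIdx n) × MIdx n, tripleTerm h c d e p.2 p.1.1 p.1.2 := by
  have hs := summable_tripleTerm h hc hd he
  let σ : (MIdx n × MIdx n) × MIdx n ≃ (MIdx n × MIdx n) × MIdx n :=
    ⟨fun p => ((p.2, p.1.1), p.1.2), fun p => ((p.1.2, p.2), p.1.1), fun _ => rfl, fun _ => rfl⟩
  have hs' : Summable fun p : (MIdx n × MIdx n) × MIdx n => tripleTerm h c d e p.2 p.1.1 p.1.2 :=
    σ.summable_iff.2 hs
  rw [hs'.tsum_prod' fun p => hs'.prod_factor p]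
  have hs2 : Summable fun p : MIdx n × MIdx n => ∑' M, tripleTerm h c d e M p.1 p.2 := hs'.prod
  -- Leibniz rule: the outer $z$-derivatives split as $N=K+L$, with `K` falling on the first factor
  -- and `L` on the second.
  rw [tsum_eq_tsum_sum_antidiagonal hs2]
  refine tsum_congr fun N => ?_
  rw [← Summable.tsum_finsetSum fun q _ => hs'.prod_factor q, starCoef, ← tsum_mul_right,
    ← tsum_mul_left]
  refine tsum_congr fun M => ?_
  rw [starTerm, conv_elim_left, Finset.mul_sum, Finset.sum_mul, Finset.mul_sum]
  refine Finset.sum_congr rfl fun q hq => ?_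
  have hq' := Finset.HasAntidiagonal.mem_antidiagonal.1 hq
  have hN := tfact_ne_zero N
  have h1 := tfact_ne_zero q.1
  have h2 := tfact_ne_zero q.2
  simp only [tripleTerm, elim_add_elim, add_zero, zero_add, hq']
  have hdeg : tdeg N = tdeg q.1 + tdeg q.2 := by rw [← hq', tdeg_add]
  rw [hdeg, pow_add, add_comm q.1 M]
  field_simp

theorem tsum_mul_starCoef (h : ℝ) {c d e : (Fin n ⊕ Fin n → ℕ) → ℂ} (hc : Growth c)
    (hd : Growth d) (he : Growth e) :
    ∑' N : MIdx n, ((h : ℂ) ^ tdeg N / tfact N) *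
      (c (Sum.elim N (0 : Fin n → ℕ)) * starCoef h d e (Sum.elim (0 : Fin n → ℕ) N)) =
    ∑' p : (MIdx n × MIdx n) × MIdx n, tripleTerm h c d e p.1.1 p.1.2 p.2 := by
  have hs := summable_tripleTerm h hc hd he
  rw [hs.tsum_prod' fun p => hs.prod_factor p]
  have hs2 : Summable fun p : MIdx n × MIdx n => ∑' L, tripleTerm h c d e p.1 p.2 L := hs.prod
  -- Here the outer $\bar z$-derivatives split as $N=M+K$, with `M` falling on the second factor and
  -- `K` on the third.
  rw [tsum_eq_tsum_sum_antidiagonal hs2]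
  refine tsum_congr fun N => ?_
  rw [← Summable.tsum_finsetSum fun q _ => hs.prod_factor q, starCoef, ← tsum_mul_left,
    ← tsum_mul_left]
  refine tsum_congr fun L => ?_
  rw [starTerm, conv_elim_right, Finset.mul_sum, Finset.mul_sum, Finset.mul_sum]
  refine Finset.sum_congr rfl fun q hq => ?_
  have hq' := Finset.HasAntidiagonal.mem_antidiagonal.1 hq
  have hN := tfact_ne_zero N
  have h1 := tfact_ne_zero q.1
  have h2 := tfact_ne_zero q.2
  simp only [tripleTerm, elim_add_elim, add_zero, zero_add, hq']
  have hdeg : tdeg N = tdeg q.1 + tdeg q.2 := by rw [← hq', tdeg_add]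
  rw [hdeg, pow_add]
  field_simp

theorem wickMul_wickMul_apply {f g k : (Fin n → ℂ) → ℂ} (hf : IsWick f) (hg : IsWick g)
    (hk : IsWick k) (ħ : ℝ) (z : Fin n → ℂ) : wickMul ħ (wickMul ħ f g) k z =
      ∑' p : (MIdx n × MIdx n) × MIdx n,
        tripleTerm (2 * ħ) (jet f z) (jet g z) (jet k z) p.2 p.1.1 p.1.2 := by
  rw [← tsum_starCoef_mul _ (hf.growth_jet z) (hg.growth_jet z) (hk.growth_jet z)]
  refine tsum_congr fun N => ?_
  rw [wickTerm_eq (hf.wickMul hg ħ) hk, jet_wickMul hf hg]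

/-- Both sides are the same absolutely convergent sum over `M`, `K`, `L`, up to a permutation of the
three indices. -/
theorem wickMul_assoc {f g k : (Fin n → ℂ) → ℂ} (hf : IsWick f) (hg : IsWick g)
    (hk : IsWick k) (ħ : ℝ) : wickMul ħ (wickMul ħ f g) k = wickMul ħ f (wickMul ħ g k) := by
  funext z
  have h1 : wickMul ħ f (wickMul ħ g k) z = ∑' p : (MIdx n × MIdx n) × MIdx n,
      tripleTerm (2 * ħ) (jet f z) (jet g z) (jet k z) p.1.1 p.1.2 p.2 := by
    rw [← tsum_mul_starCoef _ (hf.growth_jet z) (hg.growth_jet z) (hk.growth_jet z)]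
    refine tsum_congr fun N => ?_
    rw [wickTerm_eq hf (hg.wickMul hk ħ), jet_wickMul hg hk]
  rw [wickMul_wickMul_apply hf hg hk, h1]
  let σ : (MIdx n × MIdx n) × MIdx n ≃ (MIdx n × MIdx n) × MIdx n :=
    ⟨fun p => ((p.2, p.1.1), p.1.2), fun p => ((p.1.2, p.2), p.1.1), fun _ => rfl, fun _ => rfl⟩
  exact σ.tsum_eq fun p => tripleTerm (2 * ħ) (jet f z) (jet g z) (jet k z) p.1.1 p.1.2 p.2

end Algebra

/-! ### Exponentials and inner automorphisms -/

section Exponentials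

variable {n : ℕ}

theorem growth_const_mul_prod_pow {ι : Type*} [Fintype ι] [DecidableEq ι] (k : ℂ) (s : ι → ℂ) :
    Growth fun x : ι → ℕ => k * ∏ j, s j ^ x j := by
  intro ε hε
  obtain ⟨C, hC, h⟩ := pow_le_wt hε (norm_nonneg s)
  refine ⟨(‖k‖ + 1) * C, by positivity, fun x => ?_⟩
  have h1 : ‖∏ j, s j ^ x j‖ ≤ ‖s‖ ^ tdeg x := by
    rw [norm_prod, tdeg, ← Finset.prod_pow_eq_pow_sum]
    refine Finset.prod_le_prod (fun _ _ => norm_nonneg _) fun j _ => ?_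
    rw [norm_pow]
    exact pow_le_pow_left₀ (norm_nonneg _) (norm_le_pi_norm s j) _
  have hw := wt_pos ε (tdeg x)
  rw [norm_mul]
  calc _ ≤ (‖k‖ + 1) * (C * wt ε (tdeg x)) := by
        gcongr
        · linarith
        · exact h1.trans (h _)
    _ = _ := by ring

theorem taylorSum_const_mul_prod_pow {ι : Type*} [Fintype ι] [DecidableEq ι] (k : ℂ) (s v : ι → ℂ) :
    taylorSum (fun x => k * ∏ j, s j ^ x j) v = k * Complex.exp (∑ j, s j * v j) := by
  rw [taylorSum, ← (hasSum_dpow fun j => s j * v j).tsum_eq, ← tsum_mul_left]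
  refine tsum_congr fun x => ?_
  rw [dpow_eq, dpow_eq]
  simp only [mul_pow, Finset.prod_mul_distrib]
  ring

/-- The function `z ↦ k exp(a·z + b·z̄)`. -/
def wickExp (k : ℂ) (a b : Fin n → ℂ) (z : Fin n → ℂ) : ℂ :=
  k * Complex.exp (∑ i, a i * z i + ∑ i, b i * conj (z i))

theorem wickExp_eq_wickFun (k : ℂ) (a b : Fin n → ℂ) :
    wickExp k a b = wickFun fun x => k * ∏ j, (Sum.elim a b : Fin n ⊕ Fin n → ℂ) j ^ x j := by
  funext z
  rw [wickFun, taylorSum_const_mul_prod_pow, conjGraph_apply, Fintype.sum_sum_type]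
  rfl

theorem isWick_wickExp (k : ℂ) (a b : Fin n → ℂ) : IsWick (wickExp k a b) :=
  ⟨_, growth_const_mul_prod_pow _ _, wickExp_eq_wickFun k a b⟩

theorem jet_wickExp (k : ℂ) (a b q : Fin n → ℂ) (R S : MIdx n) :
    jet (wickExp k a b) q (Sum.elim R S) =
      wickExp k a b q * ((∏ i, a i ^ R i) * ∏ i, b i ^ S i) := by
  have h : (fun y : Fin n ⊕ Fin n → ℕ =>
      k * ∏ j, (Sum.elim a b : Fin n ⊕ Fin n → ℂ) j ^ (y + Sum.elim R S) j) =
      fun y => (k * ((∏ i, a i ^ R i) * ∏ i, b i ^ S i)) *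
        ∏ j, (Sum.elim a b : Fin n ⊕ Fin n → ℂ) j ^ y j := by
    funext y
    simp only [Fintype.prod_sum_type, Sum.elim_inl, Sum.elim_inr, Pi.add_apply, pow_add,
      Finset.prod_mul_distrib]
    ring
  rw [wickExp_eq_wickFun, jet_wickFun (growth_const_mul_prod_pow _ _), recenter, h, wickFun,
    taylorSum_const_mul_prod_pow, taylorSum_const_mul_prod_pow]
  ring

theorem wickMul_wickExp (ħ : ℝ) (k k' : ℂ) (a b a' b' : Fin n → ℂ) :
    wickMul ħ (wickExp k a b) (wickExp k' a' b') =
      wickExp (k * k' * Complex.exp (2 * ħ * ∑ i, a i * b' i)) (a + a') (b + b') := by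
  funext z
  have h : ∀ N, wickTerm ħ (wickExp k a b) (wickExp k' a' b') z N =
      (wickExp k a b z * wickExp k' a' b' z) * dpow (fun i => 2 * ħ * (a i * b' i)) N := fun N => by
    rw [wickTerm_eq (isWick_wickExp _ _ _) (isWick_wickExp _ _ _), jet_wickExp, jet_wickExp, dpow_eq]
    simp only [mul_pow, Finset.prod_mul_distrib, Pi.zero_apply, pow_zero, Finset.prod_const_one,
      Finset.prod_pow_eq_pow_sum, tdeg]
    push_cast
    ring
  rw [wickMul]
  simp only [h]
  rw [tsum_mul_left, (hasSum_dpow _).tsum_eq, ← Finset.mul_sum, wickExp, wickExp, wickExp]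
  simp only [Pi.add_apply, add_mul, Finset.sum_add_distrib, Complex.exp_add]
  ring

theorem star_wickExp (k : ℂ) (a b : Fin n → ℂ) :
    star (wickExp k a b) = wickExp (conj k) (fun i => conj (b i)) (fun i => conj (a i)) := by
  funext z
  simp only [Pi.star_apply, wickExp, RCLike.star_def, map_mul, map_add, map_sum, ← Complex.exp_conj,
    Complex.conj_conj]
  rw [add_comm]

theorem taylorSum_elim_zero (c : (Fin n ⊕ Fin n → ℕ) → ℂ) (v : Fin n → ℂ) :
    taylorSum c (Sum.elim 0 v) = ∑' N : MIdx n, c (Sum.elim (0 : Fin n → ℕ) N) * dpow v N := by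
  have hinj : Function.Injective fun N : MIdx n => (Sum.elim (0 : Fin n → ℕ) N : Fin n ⊕ Fin n → ℕ) :=
    fun N N' h => congrArg (fun x => x ∘ Sum.inr) h
  rw [taylorSum, ← hinj.tsum_eq]
  · refine tsum_congr fun N => ?_
    rw [dpow_elim, dpow_index_zero, one_mul]
  · intro x hx
    refine ⟨x ∘ Sum.inr, ?_⟩
    have h1 : x ∘ Sum.inl = 0 := by
      by_contra h0
      refine hx ?_
      have h2 : dpow (Sum.elim (0 : Fin n → ℂ) v) x = 0 := by
        rw [← Sum.elim_comp_inl_inr x, dpow_elim, dpow_zero, if_neg h0, zero_mul]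
      simp only [h2, mul_zero]
    change Sum.elim (0 : Fin n → ℕ) (x ∘ Sum.inr) = x
    rw [← h1, Sum.elim_comp_inl_inr]

/-- The exponential is an eigenfunction of every $\partial/\partial z_i$, so the series becomes a
Taylor series of `f` in $\bar z$ alone: besides the multiplication, $\bar z$ is translated by
$2\hbar a$ with $z$ kept fixed. -/
theorem wickMul_wickExp_left (ħ : ℝ) (k : ℂ) (a b : Fin n → ℂ) {f : (Fin n → ℂ) → ℂ}
    (hf : IsWick f) (z : Fin n → ℂ) : wickMul ħ (wickExp k a b) f z =
      wickExp k a b z * taylorSum (jet f z) (Sum.elim 0 fun i => 2 * ħ * a i) := by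
  have h : ∀ N, wickTerm ħ (wickExp k a b) f z N = wickExp k a b z *
      (jet f z (Sum.elim (0 : Fin n → ℕ) N) * dpow (fun i => 2 * ħ * a i) N) := fun N => by
    rw [wickTerm_eq (isWick_wickExp _ _ _) hf, jet_wickExp, dpow_eq]
    simp only [mul_pow, Finset.prod_mul_distrib, Pi.zero_apply, pow_zero, Finset.prod_const_one,
      Finset.prod_pow_eq_pow_sum, tdeg]
    push_cast
    ring
  rw [wickMul]
  simp only [h]
  rw [tsum_mul_left]
  congr 1
  exact (taylorSum_elim_zero _ _).symm

/-- The constant factor of `u_{(w,c)}`. -/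
def heisConst (ħ : ℝ) (a : Heisenberg n) : ℂ :=
  Complex.exp (-(Complex.I * a.c / (2 * ħ)) - (∑ i, conj (a.w i) * a.w i) / (4 * ħ))

theorem uHeis_eq_wickExp {ħ : ℝ} (hħ : 0 < ħ) (a : Heisenberg n) :
    uHeis ħ a = wickExp (heisConst ħ a) (fun i => conj (a.w i) / (2 * ħ))
      (fun i => -(a.w i / (2 * ħ))) := by
  have hħ' : (ħ : ℂ) ≠ 0 := by exact_mod_cast hħ.ne'
  funext z
  rw [uHeis, uTrans, expFun, wickExp, ← mul_assoc, heisConst, ← Complex.exp_add]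
  congr 3
  rw [sub_eq_add_neg, Finset.mul_sum, Finset.sum_div, ← Finset.sum_neg_distrib]
  congr 1
  refine Finset.sum_congr rfl fun i _ => ?_
  field_simp
  ring

theorem isWick_uHeis {ħ : ℝ} (hħ : 0 < ħ) (a : Heisenberg n) : IsWick (uHeis ħ a) := by
  rw [uHeis_eq_wickExp hħ]
  exact isWick_wickExp _ _ _

theorem conj_re_im_identity (S T : ℂ) (hT : T = conj S) :
    S = (S + T) / 2 + Complex.I * (S.im : ℂ) := by
  subst hT
  apply Complex.ext <;> simp

/-- The central cocycle supplies $\mathrm{i}\operatorname{Im}(\bar wv)$ and the polarisation of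
$|w+v|^2$ supplies $\operatorname{Re}(\bar wv)$; together they form the full $\bar wv$ produced by
the star product of exponentials. -/
theorem heisConst_mul {ħ : ℝ} (hħ : 0 < ħ) (a b : Heisenberg n) : heisConst ħ (a * b) =
    heisConst ħ a * heisConst ħ b * Complex.exp (-(∑ i, conj (a.w i) * b.w i) / (2 * ħ)) := by
  have hħ' : (ħ : ℂ) ≠ 0 := by exact_mod_cast hħ.ne'
  have hw : (a * b).w = a.w + b.w := rfl
  have hc : (a * b).c = a.c + b.c + (∑ i, conj (a.w i) * b.w i).im := rfl
  rw [heisConst, heisConst, heisConst, ← Complex.exp_add, ← Complex.exp_add, hc, hw]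
  congr 1
  set S := ∑ i, conj (a.w i) * b.w i with hS
  set T := ∑ i, conj (b.w i) * a.w i with hT
  have hTS : T = conj S := by
    rw [hT, hS, map_sum]
    refine Finset.sum_congr rfl fun i _ => ?_
    simp [mul_comm]
  have h1 : ∑ i, conj ((a.w + b.w) i) * (a.w + b.w) i =
      (∑ i, conj (a.w i) * a.w i) + (∑ i, conj (b.w i) * b.w i) + (S + T) := by
    rw [hS, hT, ← Finset.sum_add_distrib, ← Finset.sum_add_distrib, ← Finset.sum_add_distrib]
    refine Finset.sum_congr rfl fun i _ => ?_
    rw [Pi.add_apply, map_add]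
    ring
  have h3 := conj_re_im_identity S T hTS
  rw [h1]
  push_cast
  field_simp
  linear_combination 4 * h3

theorem uHeis_mul {ħ : ℝ} (hħ : 0 < ħ) (a b : Heisenberg n) :
    uHeis ħ (a * b) = wickMul ħ (uHeis ħ a) (uHeis ħ b) := by
  have hħ' : (ħ : ℂ) ≠ 0 := by exact_mod_cast hħ.ne'
  rw [uHeis_eq_wickExp hħ, uHeis_eq_wickExp hħ, uHeis_eq_wickExp hħ, wickMul_wickExp]
  have hw : (a * b).w = a.w + b.w := rfl
  congr 1
  · rw [heisConst_mul hħ]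
    congr 2
    rw [Finset.mul_sum, ← Finset.sum_neg_distrib, Finset.sum_div]
    refine Finset.sum_congr rfl fun i _ => ?_
    field_simp
  · funext i
    rw [hw]
    simp only [Pi.add_apply, map_add]
    ring
  · funext i
    rw [hw]
    simp only [Pi.add_apply]
    ring

theorem uHeis_one (ħ : ℝ) : uHeis ħ (1 : Heisenberg n) = 1 := by
  have hw : (1 : Heisenberg n).w = 0 := rfl
  have hc : (1 : Heisenberg n).c = 0 := rfl
  funext z
  simp [uHeis, uTrans, expFun, hw, hc]

theorem star_uHeis {ħ : ℝ} (hħ : 0 < ħ) (a : Heisenberg n) : star (uHeis ħ a) = uHeis ħ a⁻¹ := by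
  have hw : a⁻¹.w = -a.w := rfl
  have hc : a⁻¹.c = -a.c := rfl
  rw [uHeis_eq_wickExp hħ, uHeis_eq_wickExp hħ, star_wickExp]
  congr 1
  · rw [heisConst, heisConst, ← Complex.exp_conj, hw, hc]
    congr 1
    simp only [map_sub, map_neg, map_div₀, map_mul, map_sum, Complex.conj_I, Complex.conj_ofReal,
      Complex.conj_conj, map_ofNat, Pi.neg_apply]
    push_cast
    simp only [neg_mul_neg, mul_comm]
    ring
  · funext i
    simp [hw, neg_div, Complex.conj_ofReal, Complex.conj_ofNat]
  · funext i
    simp [hw, neg_div, Complex.conj_ofReal, Complex.conj_ofNat]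

theorem mul_star_uHeis_apply {ħ : ℝ} (hħ : 0 < ħ) (a : Heisenberg n) (z : Fin n → ℂ) :
    uHeis ħ a z * uHeis ħ a⁻¹ z = Complex.exp (-(∑ i, conj (a.w i) * a.w i) / (2 * ħ)) := by
  have hħ' : (ħ : ℂ) ≠ 0 := by exact_mod_cast hħ.ne'
  have hw : a⁻¹.w = -a.w := rfl
  have hc : a⁻¹.c = -a.c := rfl
  rw [uHeis_eq_wickExp hħ, uHeis_eq_wickExp hħ, wickExp, wickExp, heisConst, heisConst, hw, hc]
  rw [← Complex.exp_add, ← Complex.exp_add, ← Complex.exp_add]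
  congr 1
  simp only [Pi.neg_apply, map_neg, neg_div, neg_mul, mul_neg, neg_neg, Finset.sum_neg_distrib]
  push_cast
  field_simp
  ring

/-- In the triple sum, the contractions between $u$ and $\bar u$ give $e^{\bar ww/2\hbar}$, the
inverse of $u\bar u$. Those with `f` give the Taylor series of `f` at $z$ in the direction $(w,\bar
w)$. -/
theorem wickAd_uHeis {ħ : ℝ} (hħ : 0 < ħ) (a : Heisenberg n) {f : (Fin n → ℂ) → ℂ}
    (hf : IsWick f) : wickAd ħ (uHeis ħ a) f = fun z => f (z + a.w) := by
  have hħ' : (ħ : ℂ) ≠ 0 := by exact_mod_cast hħ.ne'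
  have hw : a⁻¹.w = -a.w := rfl
  funext z
  rw [wickAd, star_uHeis hħ, wickMul_wickMul_apply (isWick_uHeis hħ _) hf (isWick_uHeis hħ _)]
  have hterm : ∀ p : (MIdx n × MIdx n) × MIdx n,
      tripleTerm (2 * ħ) (jet (uHeis ħ a) z) (jet f z) (jet (uHeis ħ a⁻¹) z) p.2 p.1.1 p.1.2 =
      (uHeis ħ a z * uHeis ħ a⁻¹ z) * (dpow (fun i => conj (a.w i) * a.w i / (2 * ħ)) p.1.1 *
        (jet f z (Sum.elim p.1.2 p.2) * dpow (conjGraph a.w) (Sum.elim p.1.2 p.2))) := by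
    intro p
    rw [tripleTerm, uHeis_eq_wickExp hħ, uHeis_eq_wickExp hħ, jet_wickExp, jet_wickExp, hw,
      conjGraph_apply, dpow_elim, dpow_eq, dpow_eq, dpow_eq]
    simp only [Pi.neg_apply, map_neg, neg_div, neg_neg, Pi.zero_apply, pow_zero,
      Finset.prod_const_one, mul_one, one_mul, Pi.add_apply, pow_add, Finset.prod_mul_distrib,
      div_pow, Finset.prod_div_distrib, mul_pow, Finset.prod_pow_eq_pow_sum, tdeg]
    push_cast
    have := tfact_ne_zero p.1.1
    have := tfact_ne_zero p.1.2
    have := tfact_ne_zero p.2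
    field_simp
    ring
  simp only [hterm]
  rw [tsum_mul_left]
  -- The two indices contracted with `f` are merged into one multi-index over both sets of
  -- variables, which exposes the product of two series.
  let σ : MIdx n × (Fin n ⊕ Fin n → ℕ) ≃ (MIdx n × MIdx n) × MIdx n :=
    ((Equiv.refl _).prodCongr (Equiv.sumArrowEquivProdArrow (Fin n) (Fin n) ℕ)).trans
      (Equiv.prodAssoc _ _ _).symm
  rw [← σ.tsum_eq]
  have hσ : ∀ x : MIdx n × (Fin n ⊕ Fin n → ℕ),
      dpow (fun i => conj (a.w i) * a.w i / (2 * ħ)) (σ x).1.1 *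
        (jet f z (Sum.elim (σ x).1.2 (σ x).2) * dpow (conjGraph a.w) (Sum.elim (σ x).1.2 (σ x).2)) =
      dpow (fun i => conj (a.w i) * a.w i / (2 * ħ)) x.1 *
        (jet f z x.2 * dpow (conjGraph a.w) x.2) := by
    intro x
    have h2 : (Sum.elim (σ x).1.2 (σ x).2 : Fin n ⊕ Fin n → ℕ) = x.2 :=
      Sum.elim_comp_inl_inr x.2
    rw [h2]
    rfl
  simp only [hσ]
  have hone : Growth fun _ : Fin n → ℕ => (1 : ℂ) := by
    simpa using growth_const_mul_prod_pow (1 : ℂ) (fun _ : Fin n => (1 : ℂ))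
  have hs1 := hone.summable_norm fun i => conj (a.w i) * a.w i / (2 * ħ)
  simp only [one_mul] at hs1
  rw [← tsum_mul_tsum_of_summable_norm hs1 ((hf.growth_jet z).summable_norm (conjGraph a.w)),
    (hasSum_dpow _).tsum_eq, mul_star_uHeis_apply hħ, ← mul_assoc, ← Complex.exp_add,
    ← Finset.sum_div, ← add_div, neg_add_cancel, zero_div, Complex.exp_zero, one_mul]
  change wickFun (jet f z) a.w = _
  rw [← hf.translate_eq z, add_comm]

theorem uTrans_eq_uHeis (ħ : ℝ) (w : Fin n → ℂ) : uTrans ħ w = uHeis ħ ⟨w, 0⟩ := by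
  funext z
  simp [uHeis]

end Exponentials

/-! ### Anti-holomorphic Taylor expansions -/

section AntiHolomorphic

variable {n : ℕ}

theorem psiTerm_eq {f : (Fin n → ℂ) → ℂ} (hf : IsWick f) (z : Fin n → ℂ) (I : MIdx n) :
    psiTerm f z I = jet f 0 (Sum.elim (0 : Fin n → ℕ) I) * dpow (fun i => conj (z i)) I := by
  rw [psiTerm, hf.iterD_dzbar, dpow_eq]
  change (tfact I : ℂ)⁻¹ * _ * (∏ i, conj (z i) ^ I i) = _
  ring

theorem summable_psiTerm {f : (Fin n → ℂ) → ℂ} (hf : IsWick f) (z : Fin n → ℂ) :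
    Summable (psiTerm f z) := by
  have hinj : Function.Injective fun N : MIdx n => (Sum.elim (0 : Fin n → ℕ) N : Fin n ⊕ Fin n → ℕ) :=
    fun N N' h => congrArg (fun x => x ∘ Sum.inr) h
  have h := ((hf.growth_jet 0).summable (Sum.elim 0 fun i => conj (z i))).comp_injective hinj
  refine h.congr fun I => ?_
  rw [psiTerm_eq hf, Function.comp_apply, dpow_elim, dpow_index_zero, one_mul]

theorem Psi_eq {f : (Fin n → ℂ) → ℂ} (hf : IsWick f) (z : Fin n → ℂ) :
    Psi f z = taylorSum (jet f 0) (Sum.elim 0 fun i => conj (z i)) := by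
  rw [taylorSum_elim_zero]
  exact tsum_congr fun I => psiTerm_eq hf z I

theorem Psi_wickFun {c : (Fin n ⊕ Fin n → ℕ) → ℂ} (hc : Growth c) (z : Fin n → ℂ) :
    Psi (wickFun c) z = taylorSum c (Sum.elim 0 fun i => conj (z i)) := by
  rw [Psi_eq ⟨c, hc, rfl⟩, jet_wickFun_zero hc]

/-- The anti-holomorphic part of a family of Taylor coefficients. -/
def antiCoef (c : (Fin n ⊕ Fin n → ℕ) → ℂ) (x : Fin n ⊕ Fin n → ℕ) : ℂ :=
  if x ∘ Sum.inl = 0 then c x else 0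

theorem Growth.antiCoef {c : (Fin n ⊕ Fin n → ℕ) → ℂ} (hc : Growth c) : Growth (antiCoef c) := by
  intro ε hε
  obtain ⟨C, hC, h⟩ := hc ε hε
  refine ⟨C, hC, fun x => ?_⟩
  rw [WickBF.antiCoef]
  split_ifs
  · exact h x
  · have := wt_pos ε (tdeg x)
    rw [norm_zero]
    positivity

theorem taylorSum_antiCoef (c : (Fin n ⊕ Fin n → ℕ) → ℂ) (u v : Fin n → ℂ) :
    taylorSum (antiCoef c) (Sum.elim u v) = taylorSum c (Sum.elim 0 v) := by
  refine tsum_congr fun x => ?_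
  rw [← Sum.elim_comp_inl_inr x, dpow_elim, dpow_elim, antiCoef, dpow_zero, Sum.elim_comp_inl]
  split_ifs with h
  · rw [h, dpow_index_zero]
  · simp

theorem Psi_eq_wickFun {f : (Fin n → ℂ) → ℂ} (hf : IsWick f) :
    Psi f = wickFun (antiCoef (jet f 0)) := by
  funext z
  rw [Psi_eq hf, wickFun, conjGraph_apply, taylorSum_antiCoef]

theorem IsWick.Psi {f : (Fin n → ℂ) → ℂ} (hf : IsWick f) : IsWick (Psi f) :=
  ⟨_, (hf.growth_jet 0).antiCoef, Psi_eq_wickFun hf⟩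

theorem Psi_translate_Psi {f : (Fin n → ℂ) → ℂ} (hf : IsWick f) (w : Fin n → ℂ) :
    Psi (fun z => Psi f (z + w)) = fun z => Psi f (z + w) := by
  have hg := (hf.growth_jet 0).antiCoef
  funext z
  rw [hf.Psi.translate_eq, Psi_wickFun (hf.Psi.growth_jet w), Psi_eq_wickFun hf, jet_wickFun hg,
    ← taylorSum_add hg, conjGraph_apply, wickFun, conjGraph_apply]
  have h : (Sum.elim w (fun i => conj (w i)) : Fin n ⊕ Fin n → ℂ) +
      Sum.elim (0 : Fin n → ℂ) (fun i => conj (z i)) =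
      Sum.elim w (fun i => conj ((z + w) i)) := by
    funext j
    rcases j with j | j <;> simp [add_comm]
  rw [h, taylorSum_antiCoef, taylorSum_antiCoef]

theorem Psi_Psi {f : (Fin n → ℂ) → ℂ} (hf : IsWick f) : Psi (Psi f) = Psi f := by
  simpa using Psi_translate_Psi hf 0

/-- `Psi` sets $z=0$ in the entire extension and keeps $\bar z$, so it respects pointwise products.
-/
theorem Psi_mul {f g : (Fin n → ℂ) → ℂ} (hf : IsWick f) (hg : IsWick g) :
    Psi (fun z => f z * g z) = fun z => Psi f z * Psi g z := by
  obtain ⟨c, hc, rfl⟩ := hf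
  obtain ⟨d, hd, rfl⟩ := hg
  have h : (fun z => wickFun c z * wickFun d z) = wickFun (conv c d) :=
    funext fun z => taylorSum_mul hc hd _
  funext z
  rw [h, Psi_wickFun (hc.conv hd), Psi_wickFun hc, Psi_wickFun hd, taylorSum_mul hc hd]

theorem Psi_congr {f g : (Fin n → ℂ) → ℂ} (hf : IsWick f) (hg : IsWick g)
    (h : ∀ I : MIdx n, jet f 0 (Sum.elim (0 : Fin n → ℕ) I) = jet g 0 (Sum.elim (0 : Fin n → ℕ) I)) :
    Psi f = Psi g := by
  funext z
  refine tsum_congr fun I => ?_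
  rw [psiTerm_eq hf, psiTerm_eq hg, h]

/-- The kernel of `Psi` is a left ideal. -/
theorem Psi_wickMul_Psi {f g : (Fin n → ℂ) → ℂ} (hf : IsWick f) (hg : IsWick g) (ħ : ℝ) :
    Psi (wickMul ħ f (Psi g)) = Psi (wickMul ħ f g) := by
  refine Psi_congr (hf.wickMul hg.Psi ħ) (hf.wickMul hg ħ) fun I => ?_
  rw [jet_wickMul hf hg.Psi, jet_wickMul hf hg]
  refine tsum_congr fun N => ?_
  -- Pure $\bar z$-coefficients at 0 of the product involve only pure $\bar z$-coefficients of the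
  -- right factor, and `Psi` preserves these.
  rw [starTerm, starTerm, conv_elim_right, conv_elim_right]
  congr 1
  refine Finset.sum_congr rfl fun q _ => ?_
  rw [Psi_eq_wickFun hg, jet_wickFun_zero (hg.growth_jet 0).antiCoef]
  simp only [elim_add_elim, add_zero, antiCoef, Sum.elim_comp_inl, if_true]

theorem Psi_wickExp (k : ℂ) (a b : Fin n → ℂ) :
    Psi (wickExp k a b) = wickExp k 0 b := by
  funext z
  rw [wickExp_eq_wickFun, Psi_wickFun (growth_const_mul_prod_pow _ _),
    taylorSum_const_mul_prod_pow, wickExp, Fintype.sum_sum_type]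
  simp

/-- Star multiplication by $u$ moves only $\bar z$, by $\bar w$; as `Psi f` does not depend on $z$,
this is an honest translation by $w$. -/
theorem wickMul_uHeis_Psi {ħ : ℝ} (hħ : 0 < ħ) (a : Heisenberg n) {f : (Fin n → ℂ) → ℂ}
    (hf : IsWick f) : wickMul ħ (uHeis ħ a) (Psi f) = fun z => uHeis ħ a z * Psi f (z + a.w) := by
  have hħ' : (ħ : ℂ) ≠ 0 := by exact_mod_cast hħ.ne'
  have hg := (hf.growth_jet 0).antiCoef
  funext z
  rw [uHeis_eq_wickExp hħ, wickMul_wickExp_left ħ _ _ _ hf.Psi]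
  have h : (fun i => 2 * (ħ : ℂ) * (conj (a.w i) / (2 * ħ))) = fun i => conj (a.w i) := by
    funext i
    field_simp
  have h2 : (Sum.elim z (fun i => conj (z i)) : Fin n ⊕ Fin n → ℂ) +
      Sum.elim (0 : Fin n → ℂ) (fun i => conj (a.w i)) = Sum.elim z (fun i => conj ((z + a.w) i)) := by
    funext j
    rcases j with j | j <;> simp
  rw [h, Psi_eq_wickFun hf, jet_wickFun hg, ← taylorSum_add hg, wickFun, conjGraph_apply,
    conjGraph_apply, h2, taylorSum_antiCoef, taylorSum_antiCoef]

theorem Psi_wickMul_uHeis_Psi {ħ : ℝ} (hħ : 0 < ħ) (a : Heisenberg n) {f : (Fin n → ℂ) → ℂ}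
    (hf : IsWick f) (z : Fin n → ℂ) : Psi (wickMul ħ (uHeis ħ a) (Psi f)) z =
      heisConst ħ a * Complex.exp (-(∑ i, a.w i * conj (z i)) / (2 * ħ)) * Psi f (z + a.w) := by
  rw [wickMul_uHeis_Psi hħ a hf, Psi_mul (isWick_uHeis hħ a) (hf.Psi.translate a.w),
    Psi_translate_Psi hf, uHeis_eq_wickExp hħ, Psi_wickExp]
  simp only [wickExp]
  simp only [Pi.zero_apply, zero_mul, Finset.sum_const_zero, zero_add]
  congr 3
  rw [← Finset.sum_neg_distrib, Finset.sum_div]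
  refine Finset.sum_congr rfl fun i _ => ?_
  ring

end AntiHolomorphic

/-! ### Growth of entire functions and square integrability -/

section SquareIntegrable

variable {n : ℕ}

/-- The square root of $t^k\le k!\,e^t$ at $t=2\delta\|v\|^2$ bounds $\|v\|^k$ by
$(k!)^{1/2}(2\delta)^{-k/2}e^{\delta\|v\|^2}$, which explains `A`; the remaining series converges
since $1/4+1/2<1$. -/
theorem norm_taylorSum_le {ι : Type*} [Fintype ι] [DecidableEq ι] {c : (ι → ℕ) → ℂ}
    (hc : Growth c) {δ : ℝ} (hδ : 0 < δ) :
    ∃ C, 0 < C ∧ ∀ v, ‖taylorSum c v‖ ≤ C * Real.exp (δ * ‖v‖ ^ 2) := by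
  obtain ⟨C, hC, h⟩ := hc (1 / 4) (by norm_num)
  set A := Real.sqrt (2 * δ)⁻¹ with hA
  have hs := summable_wt (ι := ι) (ε := 1 / 4 + 1 / 2) (A := A) (by norm_num) (Real.sqrt_nonneg _)
  set T := ∑' x : ι → ℕ, wt (1 / 4 + 1 / 2) (tdeg x) * (A ^ tdeg x / tfact x)
  have hT : 0 ≤ T := tsum_nonneg fun x => by
    have := wt_pos (1 / 4 + 1 / 2) (tdeg x)
    positivity
  refine ⟨C * (T + 1), by positivity, fun v => ?_⟩
  have hpow : ∀ k : ℕ, ‖v‖ ^ k ≤ wt (1 / 2) k * A ^ k * Real.exp (δ * ‖v‖ ^ 2) := fun k => by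
    have h1 := Real.pow_div_factorial_le_exp (x := 2 * δ * ‖v‖ ^ 2) (by positivity) k
    have hk : (0 : ℝ) < k.factorial := by exact_mod_cast k.factorial_pos
    rw [div_le_iff₀ hk, mul_pow] at h1
    have h2 : (‖v‖ ^ k) ^ 2 ≤ (wt (1 / 2) k * A ^ k * Real.exp (δ * ‖v‖ ^ 2)) ^ 2 := by
      have h3 : (wt (1 / 2) k * A ^ k * Real.exp (δ * ‖v‖ ^ 2)) ^ 2 =
          ((2 * δ) ^ k)⁻¹ * (Real.exp (2 * δ * ‖v‖ ^ 2) * k.factorial) := by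
        have h4 : wt (1 / 2) k ^ 2 = k.factorial := by
          rw [sq, ← wt_add_exponent]
          norm_num [wt]
        have h5 : (A ^ k) ^ 2 = ((2 * δ) ^ k)⁻¹ := by
          rw [← pow_mul, mul_comm, pow_mul, hA, Real.sq_sqrt (by positivity), inv_pow]
        have h6 : Real.exp (δ * ‖v‖ ^ 2) ^ 2 = Real.exp (2 * δ * ‖v‖ ^ 2) := by
          rw [← Real.exp_nat_mul]
          congr 1
          push_cast
          ring
        rw [mul_pow, mul_pow, h4, h5, h6]
        ring
      rw [h3, ← pow_mul, mul_comm k 2, pow_mul]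
      rw [← div_eq_inv_mul, le_div_iff₀ (by positivity)]
      linarith
    have := wt_pos (1 / 2) k
    exact le_of_sq_le_sq h2 (by positivity)
  have hb : ∀ x, ‖c x * dpow v x‖ ≤ C * Real.exp (δ * ‖v‖ ^ 2) *
      (wt (1 / 4 + 1 / 2) (tdeg x) * (A ^ tdeg x / tfact x)) := fun x => by
    have h1 := norm_dpow_le (fun i => norm_le_pi_norm v i) x
    have hw := wt_pos (1 / 4) (tdeg x)
    have hf : (0 : ℝ) < tfact x := by exact_mod_cast tfact_pos x
    rw [norm_mul, wt_add_exponent]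
    calc _ ≤ C * wt (1 / 4) (tdeg x) *
          ((wt (1 / 2) (tdeg x) * A ^ tdeg x * Real.exp (δ * ‖v‖ ^ 2)) / tfact x) := by
          gcongr
          · exact h x
          · refine h1.trans ?_
            gcongr
            exact hpow _
      _ = _ := by ring
  have h2 : ‖taylorSum c v‖ ≤ C * Real.exp (δ * ‖v‖ ^ 2) * T := by
    have := tsum_of_norm_bounded (hs.mul_left (C * Real.exp (δ * ‖v‖ ^ 2))).hasSum hb
    rwa [tsum_mul_left] at this
  refine h2.trans ?_
  calc _ ≤ C * Real.exp (δ * ‖v‖ ^ 2) * (T + 1) := by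
        gcongr
        linarith
    _ = _ := by ring

theorem integrable_exp_neg_sum_sq {b : ℝ} (hb : 0 < b) :
    MeasureTheory.Integrable (fun z : Fin n → ℂ => Real.exp (-b * ∑ i, ‖z i‖ ^ 2)) ∧
      ∫ z : Fin n → ℂ, Real.exp (-b * ∑ i, ‖z i‖ ^ 2) = (Real.pi / b) ^ n := by
  have e : (fun z : Fin n → ℂ => Real.exp (-b * ∑ i, ‖z i‖ ^ 2)) =
      fun z => ∏ i, Real.exp (-b * ‖z i‖ ^ 2) := by
    funext z
    rw [← Real.exp_sum, Finset.mul_sum]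
  have hint := GaussianFourier.integral_rexp_neg_mul_sq_norm (V := ℂ) hb
  rw [Complex.finrank_real_complex] at hint
  have h1 : MeasureTheory.Integrable fun x : ℂ => Real.exp (-b * ‖x‖ ^ 2) := by
    -- A non-integrable function would have integral 0 by convention, against the known positive
    -- value.
    by_contra hcon
    rw [MeasureTheory.integral_undef hcon] at hint
    have : 0 < Real.pi / b := by positivity
    norm_num at hint
    exact this.ne hint
  rw [e]
  refine ⟨MeasureTheory.Integrable.fintype_prod fun _ => h1, ?_⟩
  rw [MeasureTheory.integral_fintype_prod_volume_eq_prod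
    (fun (_ : Fin n) (x : ℂ) => Real.exp (-b * ‖x‖ ^ 2))]
  rw [Finset.prod_const, Finset.card_univ, Fintype.card_fin, hint]
  norm_num

/-- The density of the Gaussian measure. -/
def gaussDensity (ħ : ℝ) (z : Fin n → ℂ) : ℝ :=
  ((2 * Real.pi * ħ) ^ n)⁻¹ * Real.exp (-(∑ i, ‖z i‖ ^ 2) / (2 * ħ))

theorem gaussDensity_pos {ħ : ℝ} (hħ : 0 < ħ) (z : Fin n → ℂ) : 0 < gaussDensity ħ z := by
  unfold gaussDensity
  positivity

theorem continuous_gaussDensity (ħ : ℝ) : Continuous (gaussDensity ħ : (Fin n → ℂ) → ℝ) := by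
  unfold gaussDensity
  fun_prop

theorem integral_gaussDensity {ħ : ℝ} (hħ : 0 < ħ) :
    MeasureTheory.Integrable (gaussDensity ħ : (Fin n → ℂ) → ℝ) ∧
      ∫ z : Fin n → ℂ, gaussDensity ħ z = 1 := by
  obtain ⟨h1, h2⟩ := integrable_exp_neg_sum_sq (n := n) (b := 1 / (2 * ħ)) (by positivity)
  have e : (gaussDensity ħ : (Fin n → ℂ) → ℝ) = fun z =>
      ((2 * Real.pi * ħ) ^ n)⁻¹ * Real.exp (-(1 / (2 * ħ)) * ∑ i, ‖z i‖ ^ 2) := by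
    funext z
    rw [gaussDensity]
    congr 2
    ring
  rw [e]
  refine ⟨h1.const_mul _, ?_⟩
  rw [MeasureTheory.integral_const_mul, h2, ← inv_pow, ← mul_pow]
  have : (2 * Real.pi * ħ)⁻¹ * (Real.pi / (1 / (2 * ħ))) = 1 := by
    have := Real.pi_pos
    field_simp
  rw [this, one_pow]

theorem integrable_gaussMeasure_iff {ħ : ℝ} (hħ : 0 < ħ) {E : Type*} [NormedAddCommGroup E]
    [NormedSpace ℝ E] {F : (Fin n → ℂ) → E} :
    MeasureTheory.Integrable F (gaussMeasure n ħ) ↔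
      MeasureTheory.Integrable fun z => gaussDensity ħ z • F z := by
  have hm : Measurable fun z : Fin n → ℂ => ENNReal.ofReal (gaussDensity ħ z) :=
    (continuous_gaussDensity ħ).measurable.ennreal_ofReal
  have h := MeasureTheory.integrable_withDensity_iff_integrable_smul' (μ := MeasureTheory.volume)
    hm (by simp) (g := F)
  simp only [ENNReal.toReal_ofReal (gaussDensity_pos hħ _).le] at h
  exact h

theorem integral_gaussMeasure {ħ : ℝ} (hħ : 0 < ħ) {E : Type*} [NormedAddCommGroup E]
    [NormedSpace ℝ E] (F : (Fin n → ℂ) → E) :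
    ∫ z, F z ∂(gaussMeasure n ħ) = ∫ z, gaussDensity ħ z • F z := by
  have hm : Measurable fun z : Fin n → ℂ => ENNReal.ofReal (gaussDensity ħ z) :=
    (continuous_gaussDensity ħ).measurable.ennreal_ofReal
  have h := integral_withDensity_eq_integral_toReal_smul (μ := MeasureTheory.volume)
    hm (by simp) F
  simp only [ENNReal.toReal_ofReal (gaussDensity_pos hħ _).le] at h
  exact h

theorem memBF_iff {ħ : ℝ} (hħ : 0 < ħ) {F : (Fin n → ℂ) → ℂ} :
    MemBF ħ F ↔ Differentiable ℂ (fun z => conj (F z)) ∧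
      MeasureTheory.Integrable fun z => gaussDensity ħ z * ‖F z‖ ^ 2 := by
  refine and_congr_right fun hd => ?_
  have hc : Continuous F := by
    simpa [Function.comp_def] using Complex.continuous_conj.comp hd.continuous
  rw [MeasureTheory.memLp_two_iff_integrable_sq_norm hc.aestronglyMeasurable,
    integrable_gaussMeasure_iff hħ]
  rfl

theorem memBF_Psi {ħ : ℝ} (hħ : 0 < ħ) {f : (Fin n → ℂ) → ℂ} (hf : IsWick f) :
    MemBF ħ (Psi f) := by
  rw [memBF_iff hħ]
  have hg := hf.growth_jet 0
  have hdiff : Differentiable ℂ fun z => conj (Psi f z) := by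
    have hgc : Growth fun x => conj (jet f 0 x) := fun ε hε => by
      obtain ⟨C, hC, h⟩ := hg ε hε
      exact ⟨C, hC, fun x => by rw [RCLike.norm_conj]; exact h x⟩
    have e : (fun z => conj (Psi f z)) = fun z =>
        taylorSum (fun x => conj (jet f 0 x)) (Sum.elim (0 : Fin n → ℂ) z) := by
      funext z
      rw [Psi_eq hf, taylorSum, taylorSum, Complex.conj_tsum]
      refine tsum_congr fun x => ?_
      rw [map_mul, dpow, dpow, map_prod]
      congr 1
      refine Finset.prod_congr rfl fun j _ => ?_
      rcases j with j | j <;> simp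
    rw [e]
    have h1 : Differentiable ℂ (taylorSum fun x => conj (jet f 0 x)) := fun v =>
      ((analyticOnNhd_taylorSum hgc) v (Set.mem_univ _)).differentiableAt
    refine h1.comp (differentiable_pi.2 fun j => ?_)
    rcases j with j | j
    · exact differentiable_const 0
    · exact differentiable_apply j
  refine ⟨hdiff, ?_⟩
  have hcont : Continuous (Psi f) := by
    simpa [Function.comp_def] using Complex.continuous_conj.comp hdiff.continuous
  -- After squaring, the growth is $e^{|z|^2/4\hbar}$, which uses up half of the Gaussian exponent.
  obtain ⟨C, hC, hb⟩ := norm_taylorSum_le hg (δ := 1 / (8 * ħ)) (by positivity)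
  obtain ⟨h1, -⟩ := integrable_exp_neg_sum_sq (n := n) (b := 1 / (4 * ħ)) (by positivity)
  refine (h1.const_mul (((2 * Real.pi * ħ) ^ n)⁻¹ * C ^ 2)).mono'
    (((continuous_gaussDensity ħ).mul (hcont.norm.pow 2)).aestronglyMeasurable)
    (Filter.Eventually.of_forall fun z => ?_)
  have hd := gaussDensity_pos hħ z
  rw [Real.norm_of_nonneg (by positivity)]
  set s := ∑ i, ‖z i‖ ^ 2 with hs
  have h2 : ‖Psi f z‖ ≤ C * Real.exp (1 / (8 * ħ) * s) := by
    rw [Psi_eq hf]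
    refine (hb _).trans ?_
    have h3 : ‖(Sum.elim 0 fun i => conj (z i) : Fin n ⊕ Fin n → ℂ)‖ ≤ Real.sqrt s := by
      refine (pi_norm_le_iff_of_nonneg (Real.sqrt_nonneg _)).2 fun j => ?_
      rcases j with j | j
      · simp
      · rw [Sum.elim_inr, RCLike.norm_conj]
        refine Real.le_sqrt_of_sq_le ?_
        exact Finset.single_le_sum (f := fun i => ‖z i‖ ^ 2) (fun _ _ => by positivity)
          (Finset.mem_univ j)
    have hs0 : 0 ≤ s := Finset.sum_nonneg fun _ _ => by positivity
    have h4 : ‖(Sum.elim 0 fun i => conj (z i) : Fin n ⊕ Fin n → ℂ)‖ ^ 2 ≤ s := by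
      rw [← Real.sq_sqrt hs0]
      gcongr
    gcongr
  calc gaussDensity ħ z * ‖Psi f z‖ ^ 2
      ≤ gaussDensity ħ z * (C * Real.exp (1 / (8 * ħ) * s)) ^ 2 := by gcongr
    _ = ((2 * Real.pi * ħ) ^ n)⁻¹ * C ^ 2 * Real.exp (-(1 / (4 * ħ)) * s) := by
        rw [gaussDensity, mul_pow C, ← Real.exp_nat_mul, ← hs]
        have : Real.exp (-(1 / (4 * ħ)) * s) =
            Real.exp (-s / (2 * ħ)) * Real.exp ((2 : ℕ) * (1 / (8 * ħ) * s)) := by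
          rw [← Real.exp_add]
          congr 1
          push_cast
          field_simp
          ring
        rw [this]
        ring

end SquareIntegrable

/-! ### The unitary representation of the Heisenberg group -/

section Representation

variable {n : ℕ}

/-- The action of the Heisenberg group on anti-holomorphic functions. -/
def heisAct (ħ : ℝ) (a : Heisenberg n) (F : (Fin n → ℂ) → ℂ) (z : Fin n → ℂ) : ℂ :=
  heisConst ħ a * Complex.exp (-(∑ i, a.w i * conj (z i)) / (2 * ħ)) * F (z + a.w)

theorem heisAct_mul {ħ : ℝ} (hħ : 0 < ħ) (a b : Heisenberg n) (F : (Fin n → ℂ) → ℂ) :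
    heisAct ħ (a * b) F = heisAct ħ a (heisAct ħ b F) := by
  have hw : (a * b).w = a.w + b.w := rfl
  funext z
  simp only [heisAct, heisConst_mul hħ, hw, ← add_assoc]
  have h : Complex.exp (-(∑ i, conj (a.w i) * b.w i) / (2 * ħ)) *
      Complex.exp (-(∑ i, (a.w + b.w) i * conj (z i)) / (2 * ħ)) =
      Complex.exp (-(∑ i, a.w i * conj (z i)) / (2 * ħ)) *
        Complex.exp (-(∑ i, b.w i * conj ((z + a.w) i)) / (2 * ħ)) := by
    rw [← Complex.exp_add, ← Complex.exp_add]
    congr 1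
    rw [← add_div, ← add_div, ← neg_add, ← neg_add, ← Finset.sum_add_distrib,
      ← Finset.sum_add_distrib]
    congr 2
    refine Finset.sum_congr rfl fun i _ => ?_
    simp only [Pi.add_apply, map_add]
    ring
  linear_combination (heisConst ħ a * heisConst ħ b * F (z + a.w + b.w)) * h

theorem heisConst_one (ħ : ℝ) : heisConst ħ (1 : Heisenberg n) = 1 := by
  have hw : (1 : Heisenberg n).w = 0 := rfl
  have hc : (1 : Heisenberg n).c = 0 := rfl
  simp [heisConst, hw, hc]

theorem heisAct_one (ħ : ℝ) (F : (Fin n → ℂ) → ℂ) : heisAct ħ (1 : Heisenberg n) F = F := by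
  have hw : (1 : Heisenberg n).w = 0 := rfl
  funext z
  simp [heisAct, heisConst_one, hw]

/-- The prefactors complete the square $|z+w|^2=|z|^2+|w|^2+2\operatorname{Re}(w\bar z)$ in the
Gaussian. Unitarity then reduces to translation invariance of Lebesgue measure. -/
theorem gaussDensity_mul_sq_heisAct (ħ : ℝ) (a : Heisenberg n) (F : (Fin n → ℂ) → ℂ)
    (z : Fin n → ℂ) : gaussDensity ħ z * ‖heisAct ħ a F z‖ ^ 2 =
      gaussDensity ħ (z + a.w) * ‖F (z + a.w)‖ ^ 2 := by
  have h1 : ‖heisConst ħ a‖ = Real.exp (-(∑ i, ‖a.w i‖ ^ 2) / (4 * ħ)) := by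
    have e : -(Complex.I * a.c / (2 * ħ)) - (∑ i, conj (a.w i) * a.w i) / (4 * ħ) =
        ((-(a.c / (2 * ħ)) : ℝ) : ℂ) * Complex.I +
          ((-(∑ i, ‖a.w i‖ ^ 2) / (4 * ħ) : ℝ) : ℂ) := by
      simp only [Complex.conj_mul']
      push_cast
      ring
    rw [heisConst, e, Complex.norm_exp, Complex.add_re, Complex.re_ofReal_mul, Complex.I_re,
      Complex.ofReal_re, mul_zero, zero_add]
  have h2 : ‖Complex.exp (-(∑ i, a.w i * conj (z i)) / (2 * ħ))‖ =
      Real.exp (-(∑ i, (a.w i * conj (z i)).re) / (2 * ħ)) := by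
    have e : (2 * ħ : ℂ) = ((2 * ħ : ℝ) : ℂ) := by push_cast; rfl
    rw [Complex.norm_exp, e, Complex.div_ofReal_re, Complex.neg_re, Complex.re_sum]
  have h3 : ∀ i, ‖(z + a.w) i‖ ^ 2 =
      ‖z i‖ ^ 2 + ‖a.w i‖ ^ 2 + 2 * (a.w i * conj (z i)).re := fun i => by
    simp only [Pi.add_apply, Complex.sq_norm, Complex.normSq_add]
    rw [← Complex.conj_re (z i * _)]
    simp [mul_comm]
  rw [heisAct, norm_mul, norm_mul, h1, h2, mul_pow, ← mul_assoc]
  congr 1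
  rw [gaussDensity, gaussDensity, ← Real.exp_add, mul_assoc, ← Real.exp_nat_mul, ← Real.exp_add]
  simp only [h3, Finset.sum_add_distrib, ← Finset.mul_sum]
  congr 2
  push_cast
  -- At ħ = 0 both exponents vanish, by the convention for division by zero.
  by_cases hh : ħ = 0
  · simp [hh]
  field_simp
  ring

theorem memBF_heisAct {ħ : ℝ} (hħ : 0 < ħ) (a : Heisenberg n) {F : (Fin n → ℂ) → ℂ}
    (hF : MemBF ħ F) : MemBF ħ (heisAct ħ a F) := by
  rw [memBF_iff hħ] at hF ⊢
  obtain ⟨h1, h2⟩ := hF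
  constructor
  · have e : (fun z => conj (heisAct ħ a F z)) = fun z => conj (heisConst ħ a) *
        Complex.exp (-(∑ i, conj (a.w i) * z i) / (2 * ħ)) * conj (F (z + a.w)) := by
      funext z
      simp only [heisAct, map_mul, ← Complex.exp_conj, map_div₀, map_neg, map_sum,
        Complex.conj_conj, Complex.conj_ofReal, Complex.conj_ofNat]
    rw [e]
    have h3 : Differentiable ℂ fun z => conj (F (z + a.w)) :=
      h1.comp (differentiable_id.add_const a.w)
    refine Differentiable.mul ?_ h3
    fun_prop
  · simp only [gaussDensity_mul_sq_heisAct]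
    exact h2.comp_add_right a.w

variable {ħ : ℝ} [hħ : Fact (0 < ħ)]

theorem inner_BF (φ ψ : BF n ħ) :
    inner ℂ φ ψ = ∫ z, gaussDensity ħ z • (conj (φ z) * ψ z) :=
  integral_gaussMeasure hħ.out _

theorem norm_sq_BF (φ : BF n ħ) : ‖φ‖ ^ 2 = ∫ z, gaussDensity ħ z * ‖φ z‖ ^ 2 := by
  have h : ((‖φ‖ ^ 2 : ℝ) : ℂ) = inner ℂ φ φ := by
    rw [inner_self_eq_norm_sq_to_K]
    push_cast
    rfl
  apply Complex.ofReal_injective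
  rw [h, inner_BF, ← integral_complex_ofReal]
  congr 1
  funext z
  rw [Complex.conj_mul', Complex.real_smul]
  push_cast
  rfl

/-- The unitary operators of the Bargmann-Fock representation of the Heisenberg group. -/
def heisUnitary (a : Heisenberg n) : BF n ħ ≃ₗᵢ[ℂ] BF n ħ where
  toFun φ := ⟨heisAct ħ a φ, memBF_heisAct hħ.out a φ.2⟩
  invFun φ := ⟨heisAct ħ a⁻¹ φ, memBF_heisAct hħ.out a⁻¹ φ.2⟩
  left_inv φ := Subtype.ext <| by
    change heisAct ħ a⁻¹ (heisAct ħ a φ) = φ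
    rw [← heisAct_mul hħ.out, inv_mul_cancel, heisAct_one]
  right_inv φ := Subtype.ext <| by
    change heisAct ħ a (heisAct ħ a⁻¹ φ) = φ
    rw [← heisAct_mul hħ.out, mul_inv_cancel, heisAct_one]
  map_add' φ ψ := Subtype.ext <| funext fun z => by
    change heisAct ħ a (fun z => φ z + ψ z) z = heisAct ħ a φ z + heisAct ħ a ψ z
    simp only [heisAct]
    ring
  map_smul' k φ := Subtype.ext <| funext fun z => by
    change heisAct ħ a (fun z => k * φ z) z = k * heisAct ħ a φ z
    simp only [heisAct]
    ring
  norm_map' φ := by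
    refine (sq_eq_sq₀ (norm_nonneg _) (norm_nonneg _)).1 ?_
    rw [norm_sq_BF, norm_sq_BF]
    change ∫ z, gaussDensity ħ z * ‖heisAct ħ a φ z‖ ^ 2 = _
    simp only [gaussDensity_mul_sq_heisAct]
    exact MeasureTheory.integral_add_right_eq_self
      (fun z => gaussDensity ħ z * ‖(φ : (Fin n → ℂ) → ℂ) z‖ ^ 2) a.w

/-- The Bargmann-Fock representation of the Heisenberg group. -/
def heisRep (n : ℕ) (ħ : ℝ) [hħ : Fact (0 < ħ)] : Heisenberg n →* (BF n ħ ≃ₗᵢ[ℂ] BF n ħ) where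
  toFun := heisUnitary
  map_one' := LinearIsometryEquiv.ext fun _ => Subtype.ext (heisAct_one ħ _)
  map_mul' a b := LinearIsometryEquiv.ext fun _ => Subtype.ext (heisAct_mul hħ.out a b _)

theorem heisRep_symm (a : Heisenberg n) : (heisRep n ħ a).symm = heisRep n ħ a⁻¹ :=
  LinearIsometryEquiv.ext fun _ => Subtype.ext rfl

/-! ### Strong continuity -/

theorem ofReal_norm_sq_BF (φ : BF n ħ) :
    ENNReal.ofReal (‖φ‖ ^ 2) = ∫⁻ z, ENNReal.ofReal (gaussDensity ħ z * ‖φ z‖ ^ 2) := by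
  rw [norm_sq_BF, MeasureTheory.ofReal_integral_eq_lintegral_ofReal
    ((memBF_iff hħ.out).1 φ.2).2]
  exact Filter.Eventually.of_forall fun z =>
    mul_nonneg (gaussDensity_pos hħ.out z).le (sq_nonneg _)

/-- Pointwise convergence with constant norm implies convergence. -/
theorem tendsto_BF {F : ℕ → BF n ħ} {G : BF n ħ}
    (hF : ∀ z, Filter.Tendsto (fun k => F k z) Filter.atTop (nhds (G z)))
    (hn : ∀ k, ‖F k‖ = ‖G‖) : Filter.Tendsto F Filter.atTop (nhds G) := by
  -- Fatou's lemma bounds $\|F_k+G\|$ from below in the limit and the triangle inequality bounds it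
  -- from above by $2\|G\|$; the parallelogram law then forces $\|F_k-G\|\to0$.
  have h1 : ENNReal.ofReal (‖G + G‖ ^ 2) ≤
      Filter.liminf (fun k => ENNReal.ofReal (‖F k + G‖ ^ 2)) Filter.atTop := by
    simp only [ofReal_norm_sq_BF]
    have hm : ∀ φ : BF n ħ, Measurable fun z => ENNReal.ofReal (gaussDensity ħ z * ‖φ z‖ ^ 2) :=
      fun φ => ((continuous_gaussDensity ħ).mul
        ((BF.continuous φ).norm.pow 2)).measurable.ennreal_ofReal
    refine le_trans (le_of_eq ?_) (MeasureTheory.lintegral_liminf_le fun k => hm (F k + G))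
    refine MeasureTheory.lintegral_congr fun z => (Filter.Tendsto.liminf_eq ?_).symm
    exact ENNReal.tendsto_ofReal ((((hF z).add_const (G z)).norm.pow 2).const_mul _)
  have hle : ∀ k, ‖F k + G‖ ^ 2 ≤ ‖G + G‖ ^ 2 := fun k => by
    have : ‖G + G‖ = ‖G‖ + ‖G‖ := by
      rw [← two_smul ℂ G, norm_smul]
      norm_num
      ring
    rw [this]
    gcongr
    exact (norm_add_le _ _).trans_eq (by rw [hn k])
  have h2 : Filter.Tendsto (fun k => ENNReal.ofReal (‖F k + G‖ ^ 2)) Filter.atTop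
      (nhds (ENNReal.ofReal (‖G + G‖ ^ 2))) := by
    refine tendsto_of_le_liminf_of_limsup_le h1 ?_
    refine Filter.limsup_le_of_le (by isBoundedDefault) (Filter.Eventually.of_forall fun k => ?_)
    exact ENNReal.ofReal_le_ofReal (hle k)
  have h3 : Filter.Tendsto (fun k => ‖F k + G‖ ^ 2) Filter.atTop (nhds (‖G + G‖ ^ 2)) := by
    have := (ENNReal.tendsto_toReal ENNReal.ofReal_ne_top).comp h2
    simpa [Function.comp_def, ENNReal.toReal_ofReal] using this
  have h4 : ∀ k, ‖F k - G‖ ^ 2 = ‖G + G‖ ^ 2 - ‖F k + G‖ ^ 2 := fun k => by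
    have p1 := parallelogram_law_with_norm ℂ (F k) G
    have p2 := parallelogram_law_with_norm ℂ G G
    rw [hn k] at p1
    rw [sub_self, norm_zero] at p2
    linarith
  rw [tendsto_iff_norm_sub_tendsto_zero]
  have h5 : Filter.Tendsto (fun k => ‖F k - G‖ ^ 2) Filter.atTop (nhds 0) := by
    simp only [h4]
    exact (h3.const_sub (‖G + G‖ ^ 2)).trans (by rw [sub_self])
  have h6 := h5.sqrt
  simpa [Real.sqrt_sq] using h6

theorem isInducing_Heisenberg :
    Topology.IsInducing fun a : Heisenberg n => (a.w, a.c) := ⟨rfl⟩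

/-- First countability reduces continuity to sequences; along these the functions converge pointwise
by the explicit formula, and the norms are constant by unitarity. -/
theorem continuous_heisRep (φ : BF n ħ) : Continuous fun a : Heisenberg n => heisRep n ħ a φ := by
  have hind := isInducing_Heisenberg (n := n)
  have : FirstCountableTopology (Heisenberg n) := hind.firstCountableTopology
  refine continuous_iff_seqContinuous.2 fun s a hs => ?_
  refine tendsto_BF (fun z => ?_) fun k => ?_
  · have hw : Continuous fun a : Heisenberg n => a.w := continuous_fst.comp hind.continuous
    have hc : Continuous fun a : Heisenberg n => a.c := continuous_snd.comp hind.continuous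
    have hφ := BF.continuous φ
    have hcont : Continuous fun a : Heisenberg n => heisAct ħ a φ z := by
      unfold heisAct heisConst
      have hwi : ∀ i, Continuous fun a : Heisenberg n => a.w i :=
        fun i => (continuous_apply i).comp hw
      have hcc : Continuous fun a : Heisenberg n => (a.c : ℂ) :=
        Complex.continuous_ofReal.comp hc
      have hwc : ∀ i, Continuous fun a : Heisenberg n => conj (a.w i) :=
        fun i => Complex.continuous_conj.comp (hwi i)
      have hF : Continuous fun a : Heisenberg n => (φ : (Fin n → ℂ) → ℂ) (z + a.w) :=
        hφ.comp (continuous_const.add hw)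
      fun_prop
    exact (hcont.tendsto a).comp hs
  · simp only [Function.comp_apply, LinearIsometryEquiv.norm_map]

/-! ### The vacuum vector as a reproducing kernel -/

theorem measurePreserving_smul_circle (u : Circle) :
    MeasureTheory.MeasurePreserving (fun (z : Fin n → ℂ) i => (u : ℂ) * z i) :=
  MeasureTheory.volume_preserving_pi fun _ => (rotation u).measurePreserving

theorem measurableEmbedding_smul_circle (u : Circle) :
    MeasurableEmbedding fun (z : Fin n → ℂ) i => (u : ℂ) * z i := by
  refine Continuous.measurableEmbedding (by fun_prop) fun z z' h => ?_
  funext i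
  exact mul_left_cancel₀ u.coe_ne_zero (congrFun h i)

theorem gaussDensity_smul_circle (ħ : ℝ) (u : Circle) (z : Fin n → ℂ) :
    gaussDensity ħ (fun i => (u : ℂ) * z i) = gaussDensity ħ z := by
  simp only [gaussDensity, norm_mul, Circle.norm_coe, one_mul]

/-- The mean value property of the holomorphic function $t\mapsto\overline{\varphi(tz)}$ on the unit
disc, conjugated back. -/
theorem circleAverage_BF (φ : BF n ħ) (z : Fin n → ℂ) :
    ∫ θ in (0 : ℝ)..2 * Real.pi, (φ : (Fin n → ℂ) → ℂ) (fun i => (Circle.exp θ : ℂ) * z i) =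
      2 * Real.pi * φ 0 := by
  have hd : Differentiable ℂ fun t : ℂ => conj (φ fun i => t * z i) :=
    φ.2.1.comp (differentiable_pi.2 fun i => differentiable_id.mul_const (z i))
  have h := DiffContOnCl.circleAverage (c := 0) (R := 1) (hd.diffContOnCl (s := Metric.ball 0 |1|))
  rw [Real.circleAverage, inv_smul_eq_iff₀ (by positivity)] at h
  have h0 : (fun i => (0 : ℂ) * z i) = 0 := funext fun i => zero_mul _
  rw [h0] at h
  have h2 := congrArg conj h
  rw [← intervalIntegral.intervalIntegral_conj] at h2
  simpa [circleMap, Circle.coe_exp, Complex.conj_ofNat] using h2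

/-- The Gaussian is invariant under $z\mapsto e^{\mathrm{i}\theta}z$. Averaging over $\theta$ and
exchanging integrals replaces $\varphi$ by its circle averages, which all equal $\varphi(0)$; the
Gaussian has total mass 1. -/
theorem integral_gaussDensity_smul_BF (φ : BF n ħ) :
    ∫ z, gaussDensity ħ z • (φ : (Fin n → ℂ) → ℂ) z = φ 0 := by
  set F : ℝ → (Fin n → ℂ) → ℂ := fun θ z =>
    gaussDensity ħ z • (φ : (Fin n → ℂ) → ℂ) (fun i => (Circle.exp θ : ℂ) * z i) with hF
  have hφ : MeasureTheory.Integrable fun z => gaussDensity ħ z • (φ : (Fin n → ℂ) → ℂ) z := by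
    have h := BF.integrable (vacuum n ħ) φ
    have h2 := (integrable_gaussMeasure_iff hħ.out).1 h
    simpa [vacuum] using h2
  have e : ∀ θ, F θ = fun z => (fun z => gaussDensity ħ z • (φ : (Fin n → ℂ) → ℂ) z)
      (fun i => (Circle.exp θ : ℂ) * z i) := fun θ => by
    funext z
    simp only [hF, gaussDensity_smul_circle]
  have hint : ∀ θ, MeasureTheory.Integrable (F θ) := fun θ => by
    rw [e]
    exact (measurePreserving_smul_circle _).integrable_comp_of_integrable hφ
  have hval : ∀ θ, ∫ z, F θ z = ∫ z, gaussDensity ħ z • (φ : (Fin n → ℂ) → ℂ) z := fun θ => by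
    rw [e]
    exact (measurePreserving_smul_circle _).integral_comp (measurableEmbedding_smul_circle _) _
  have hnorm : ∀ θ, ∫ z, ‖F θ z‖ = ∫ z, ‖gaussDensity ħ z • (φ : (Fin n → ℂ) → ℂ) z‖ := fun θ => by
    rw [e]
    exact (measurePreserving_smul_circle _).integral_comp (measurableEmbedding_smul_circle _)
      fun z => ‖gaussDensity ħ z • (φ : (Fin n → ℂ) → ℂ) z‖
  have hc : Continuous (Function.uncurry F) := by
    refine ((continuous_gaussDensity ħ).comp continuous_snd).smul ((BF.continuous φ).comp ?_)
    refine continuous_pi fun i => ?_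
    exact (continuous_subtype_val.comp (Circle.exp.continuous.comp continuous_fst)).mul
      ((continuous_apply i).comp continuous_snd)
  -- The inner $L^1$ norms do not depend on $\theta$, and the interval has finite length.
  have hprod : MeasureTheory.Integrable (Function.uncurry F)
      ((MeasureTheory.volume.restrict (Set.uIoc 0 (2 * Real.pi))).prod MeasureTheory.volume) := by
    rw [MeasureTheory.integrable_prod_iff hc.aestronglyMeasurable]
    refine ⟨Filter.Eventually.of_forall fun θ => hint θ, ?_⟩
    simp only [Function.uncurry_apply_pair, hnorm]
    exact MeasureTheory.integrableOn_const (by simp [Set.uIoc])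
  have hswap := MeasureTheory.intervalIntegral_integral_swap hprod
  have hpi : (2 * Real.pi : ℂ) ≠ 0 := by
    exact_mod_cast (by positivity : (2 * Real.pi : ℝ) ≠ 0)
  have hinner : ∀ z, ∫ θ in (0 : ℝ)..2 * Real.pi, F θ z =
      gaussDensity ħ z • (2 * Real.pi * (φ : (Fin n → ℂ) → ℂ) 0) := fun z => by
    rw [hF, intervalIntegral.integral_smul, circleAverage_BF]
  simp only [hval, hinner] at hswap
  rw [intervalIntegral.integral_const, integral_smul_const, (integral_gaussDensity hħ.out).2,
    one_smul, sub_zero, Complex.real_smul] at hswap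
  push_cast at hswap
  exact mul_left_cancel₀ hpi hswap

theorem inner_vacuum (φ : BF n ħ) : inner ℂ (vacuum n ħ) φ = φ 0 := by
  rw [inner_BF, ← integral_gaussDensity_smul_BF φ]
  simp [vacuum]

end Representation

/-! ### Covariance of the Bargmann-Fock representation -/

section Covariance

variable {n : ℕ} {ħ : ℝ} [hħ : Fact (0 < ħ)] {p : Fin n → ℂ}

theorem mem_bfDomain_iff {φ : BF n ħ} :
    φ ∈ bfDomain n ħ p ↔ ∃ f, IsWick f ∧ (φ : (Fin n → ℂ) → ℂ) = Psi f := by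
  simp only [bfDomain, Set.mem_ofPred_eq, mem_wickAlgebra_iff hħ.out]
  rfl

theorem toBF_Psi {f : (Fin n → ℂ) → ℂ} (hf : IsWick f) :
    (toBF ħ (Psi f) : (Fin n → ℂ) → ℂ) = Psi f := by
  have h : toBF ħ (Psi f) = (⟨Psi f, memBF_Psi hħ.out hf⟩ : BF n ħ) := dif_pos (memBF_Psi hħ.out hf)
  rw [h]

theorem toBF_Psi_mem {f : (Fin n → ℂ) → ℂ} (hf : IsWick f) :
    toBF ħ (Psi f) ∈ bfDomain n ħ p :=
  mem_bfDomain_iff.2 ⟨f, hf, toBF_Psi hf⟩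

/-- A vector in the domain is its own anti-holomorphic Taylor expansion. -/
theorem isWick_of_mem_bfDomain {φ : BF n ħ} (hφ : φ ∈ bfDomain n ħ p) :
    IsWick (φ : (Fin n → ℂ) → ℂ) ∧ Psi (φ : (Fin n → ℂ) → ℂ) = φ := by
  obtain ⟨f, hf, h⟩ := mem_bfDomain_iff.1 hφ
  rw [h]
  exact ⟨hf.Psi, Psi_Psi hf⟩

theorem bfRep_apply {f : (Fin n → ℂ) → ℂ} (hf : IsWick f) {φ : BF n ħ}
    (hφ : φ ∈ bfDomain n ħ p) : (bfRep ħ f φ : (Fin n → ℂ) → ℂ) = Psi (wickMul ħ f φ) :=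
  toBF_Psi (hf.wickMul (isWick_of_mem_bfDomain hφ).1 ħ)

theorem bfRep_mem {f : (Fin n → ℂ) → ℂ} (hf : IsWick f) {φ : BF n ħ}
    (hφ : φ ∈ bfDomain n ħ p) : bfRep ħ f φ ∈ bfDomain n ħ p :=
  toBF_Psi_mem (hf.wickMul (isWick_of_mem_bfDomain hφ).1 ħ)

/-- Multiplicativity of the GNS representation: the inner `Psi` may be dropped because the kernel of
`Psi` is a left ideal, and associativity does the rest. -/
theorem bfRep_bfRep {f g : (Fin n → ℂ) → ℂ} (hf : IsWick f) (hg : IsWick g) {φ : BF n ħ}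
    (hφ : φ ∈ bfDomain n ħ p) : bfRep ħ f (bfRep ħ g φ) = bfRep ħ (wickMul ħ f g) φ := by
  obtain ⟨h1, -⟩ := isWick_of_mem_bfDomain hφ
  rw [bfRep, bfRep_apply hg hφ, Psi_wickMul_Psi hf (hg.wickMul h1 ħ), ← wickMul_assoc hf hg h1]
  rfl

theorem heisRep_eq_bfRep (a : Heisenberg n) {φ : BF n ħ} (hφ : φ ∈ bfDomain n ħ p) :
    heisRep n ħ a φ = bfRep ħ (uHeis ħ a) φ := by
  obtain ⟨h1, h2⟩ := isWick_of_mem_bfDomain hφ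
  refine Subtype.ext ?_
  change heisAct ħ a φ = (bfRep ħ (uHeis ħ a) φ : (Fin n → ℂ) → ℂ)
  rw [bfRep_apply (isWick_uHeis hħ.out a) hφ]
  funext z
  have h := Psi_wickMul_uHeis_Psi hħ.out a h1 z
  rw [h2] at h
  rw [h, heisAct]

theorem heisRep_mem (a : Heisenberg n) {φ : BF n ħ} (hφ : φ ∈ bfDomain n ħ p) :
    heisRep n ħ a φ ∈ bfDomain n ħ p := by
  rw [heisRep_eq_bfRep a hφ]
  exact bfRep_mem (isWick_uHeis hħ.out a) hφ

theorem heisRep_mem_iff (a : Heisenberg n) {φ : BF n ħ} :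
    heisRep n ħ a φ ∈ bfDomain n ħ p ↔ φ ∈ bfDomain n ħ p := by
  refine ⟨fun h => ?_, heisRep_mem a⟩
  have h1 := heisRep_mem a⁻¹ h
  rwa [← heisRep_symm, LinearIsometryEquiv.symm_apply_apply] at h1

/-- Covariance of the Bargmann-Fock representation. -/
theorem bfRep_wickAd (a : Heisenberg n) {f : (Fin n → ℂ) → ℂ} (hf : IsWick f) {φ : BF n ħ}
    (hφ : φ ∈ bfDomain n ħ p) : bfRep ħ (wickAd ħ (uHeis ħ a) f) φ =
      heisRep n ħ a (bfRep ħ f ((heisRep n ħ a).symm φ)) := by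
  have hu := isWick_uHeis hħ.out a
  have hu' := isWick_uHeis hħ.out a⁻¹
  rw [heisRep_symm, heisRep_eq_bfRep a⁻¹ hφ, bfRep_bfRep hf hu' hφ,
    heisRep_eq_bfRep a (bfRep_mem (hf.wickMul hu' ħ) hφ), bfRep_bfRep hu (hf.wickMul hu' ħ) hφ,
    ← wickMul_assoc hu hf hu', wickAd, star_uHeis hħ.out]

theorem isWick_one : IsWick (1 : (Fin n → ℂ) → ℂ) := by
  rw [← uHeis_one 1]
  exact isWick_uHeis one_pos 1

theorem Psi_one : Psi (1 : (Fin n → ℂ) → ℂ) = 1 := by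
  have h := Psi_wickExp 1 (0 : Fin n → ℂ) 0
  have e : wickExp 1 (0 : Fin n → ℂ) 0 = 1 := funext fun z => by simp [wickExp]
  rwa [e] at h

theorem vacuum_mem : vacuum n ħ ∈ bfDomain n ħ p :=
  mem_bfDomain_iff.2 ⟨1, isWick_one, Psi_one.symm⟩

theorem Psi_zero {f : (Fin n → ℂ) → ℂ} (hf : IsWick f) : Psi f 0 = f 0 := by
  obtain ⟨c, hc, rfl⟩ := hf
  rw [Psi_wickFun hc, wickFun, conjGraph_apply]

/-- Since $1=u_{(0,0)}$, the conjugation formula gives $(1\star f)\star1=f$; multiplying by 1 on the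
right and using $1\star1=1$ yields the claim. -/
theorem wickMul_one {ħ : ℝ} (hħ : 0 < ħ) {f : (Fin n → ℂ) → ℂ} (hf : IsWick f) :
    wickMul ħ f 1 = f := by
  have h1 : wickMul ħ (1 : (Fin n → ℂ) → ℂ) 1 = 1 := by
    rw [← uHeis_one ħ, ← uHeis_mul hħ, mul_one]
  have h2 : wickMul ħ (wickMul ħ 1 f) 1 = f := by
    have h := wickAd_uHeis hħ 1 hf
    rw [wickAd, star_uHeis hħ, inv_one, uHeis_one] at h
    rw [h]
    exact funext fun z => congrArg f (add_zero z)
  have h3 := wickMul_assoc (isWick_one.wickMul hf ħ) isWick_one isWick_one ħ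
  rwa [h1, h2] at h3

theorem coherentVector_mem (a : Heisenberg n) :
    coherentVector (heisRep n ħ) a ∈ bfDomain n ħ p := by
  rw [coherentVector, heisRep_symm]
  exact heisRep_mem _ vacuum_mem

/-- Unitarity and covariance move `a` onto `f`, leaving the vacuum expectation of the translate of
`f`, which is its value at 0. -/
theorem inner_coherentVector (a : Heisenberg n) {f : (Fin n → ℂ) → ℂ} (hf : IsWick f) :
    inner ℂ (coherentVector (heisRep n ħ) a) (bfRep ħ f (coherentVector (heisRep n ħ) a)) =
      f a.w := by
  have hA := wickAd_uHeis hħ.out a hf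
  have hv : vacuum n ħ ∈ bfDomain n ħ 0 := vacuum_mem
  have hT := hf.translate a.w
  rw [coherentVector, ← (heisRep n ħ a).inner_map_map, LinearIsometryEquiv.apply_symm_apply,
    ← bfRep_wickAd a hf hv, inner_vacuum, hA, bfRep_apply hT hv]
  change Psi (wickMul ħ _ 1) 0 = _
  rw [wickMul_one hħ.out hT, Psi_zero hT, zero_add]

theorem coherentVector_mul (a b : Heisenberg n) :
    (heisRep n ħ b).symm (coherentVector (heisRep n ħ) a) = coherentVector (heisRep n ħ) (a * b) := by
  simp only [coherentVector, heisRep_symm, map_mul]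
  rfl

theorem heisRep_heisRep (v w : Fin n → ℂ) (φ : BF n ħ) :
    heisRep n ħ ⟨w, 0⟩ (heisRep n ħ ⟨v, 0⟩ φ) =
      Complex.exp (-(Complex.I * (∑ i, conj (w i) * v i).im / (2 * ħ))) •
        heisRep n ħ ⟨w + v, 0⟩ φ := by
  have e : (⟨w, 0⟩ : Heisenberg n) * ⟨v, 0⟩ = ⟨w + v, (∑ i, conj (w i) * v i).im⟩ := by
    change (⟨w + v, 0 + 0 + (∑ i, conj (w i) * v i).im⟩ : Heisenberg n) = _
    rw [add_zero, zero_add]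
  have h : heisRep n ħ ⟨w, 0⟩ (heisRep n ħ ⟨v, 0⟩ φ) =
      heisRep n ħ ⟨w + v, (∑ i, conj (w i) * v i).im⟩ φ := by
    rw [← e, map_mul]
    rfl
  rw [h]
  refine Subtype.ext (funext fun z => ?_)
  change heisAct ħ _ φ z = Complex.exp _ * heisAct ħ _ φ z
  simp only [heisAct, heisConst, Complex.exp_sub, Complex.ofReal_zero, mul_zero, zero_div, neg_zero,
    Complex.exp_zero]
  ring

end Covariance

end WickBF

end

theorem mainTheorem11 (n : ℕ) (ħ : ℝ) [Fact (0 < ħ)] (p : Fin n → ℂ) :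
    -- the Wick star product is well defined on the algebra, with complex conjugation as involution
    (∀ f ∈ wickAlgebra n ħ p, star f ∈ wickAlgebra n ħ p) ∧
    (∀ f ∈ wickAlgebra n ħ p, ∀ g ∈ wickAlgebra n ħ p,
      (∀ z, Summable (wickTerm ħ f g z)) ∧ wickMul ħ f g ∈ wickAlgebra n ħ p) ∧
    -- `(w, c) ↦ u_{(w,c)}` is a group morphism into the unitaries of the algebra
    (∀ a : Heisenberg n, uHeis ħ a ∈ wickAlgebra n ħ p ∧
      wickMul ħ (uHeis ħ a) (star (uHeis ħ a)) = 1 ∧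
      wickMul ħ (star (uHeis ħ a)) (uHeis ħ a) = 1) ∧
    (∀ a b : Heisenberg n, uHeis ħ (a * b) = wickMul ħ (uHeis ħ a) (uHeis ħ b)) ∧
    -- the Heisenberg group acts by the inner `*`-automorphisms `Ad(u_{(w,c)}) = Ad(u_w) = T_w^*`
    (∀ a : Heisenberg n, ∀ f ∈ wickAlgebra n ħ p,
      wickAd ħ (uHeis ħ a) f ∈ wickAlgebra n ħ p ∧
      wickAd ħ (uHeis ħ a) f = wickAd ħ (uTrans ħ a.w) f ∧
      (wickAd ħ (uHeis ħ a) f = fun z => f (z + a.w)) ∧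
      wickAd ħ (uHeis ħ a) (star f) = star (wickAd ħ (uHeis ħ a) f) ∧
      (∀ g ∈ wickAlgebra n ħ p, wickAd ħ (uHeis ħ a) (wickMul ħ f g) =
        wickMul ħ (wickAd ħ (uHeis ħ a) f) (wickAd ħ (uHeis ħ a) g)) ∧
      (∀ b : Heisenberg n, wickAd ħ (uHeis ħ (a * b)) f =
        wickAd ħ (uHeis ħ a) (wickAd ħ (uHeis ħ b) f))) ∧
    -- the representation `π` is well defined on the domain `𝔇` and is the GNS representation
    (∀ f ∈ wickAlgebra n ħ p, (∀ z, Summable (psiTerm f z)) ∧ MemBF ħ (Psi f)) ∧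
    (∀ f ∈ wickAlgebra n ħ p, ∀ φ ∈ bfDomain n ħ p, bfRep ħ f φ ∈ bfDomain n ħ p) ∧
    (∀ f ∈ wickAlgebra n ħ p, ∀ g ∈ wickAlgebra n ħ p,
      (bfRep ħ f (toBF ħ (Psi g)) : (Fin n → ℂ) → ℂ) = Psi (wickMul ħ f g)) ∧
    -- there is a unitary representation `U` of the Heisenberg group with `U_{(w,c)} = π(u_{(w,c)})`
    ∃ U : Heisenberg n →* (BF n ħ ≃ₗᵢ[ℂ] BF n ħ),
      (∀ a : Heisenberg n, ∀ φ ∈ bfDomain n ħ p,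
        U a φ ∈ bfDomain n ħ p ∧ U a φ = bfRep ħ (uHeis ħ a) φ) ∧
      -- `U` on the whole Bargmann-Fock space
      (∀ (a : Heisenberg n) (φ : BF n ħ) (z : Fin n → ℂ),
        (U a φ : (Fin n → ℂ) → ℂ) z =
          Complex.exp (-(Complex.I * a.c / (2 * ħ)) - (∑ i, conj (a.w i) * a.w i) / (4 * ħ)) *
            Complex.exp (-(∑ i, a.w i * conj (z i)) / (2 * ħ)) * φ (z + a.w)) ∧
      -- strong continuity
      (∀ φ : BF n ħ, Continuous fun a : Heisenberg n => U a φ) ∧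
      -- `U_w = U_{(w,0)}` is a projective representation of the translation group
      (∀ (v w : Fin n → ℂ) (φ : BF n ħ), U ⟨w, 0⟩ (U ⟨v, 0⟩ φ) =
        Complex.exp (-(Complex.I * (∑ i, conj (w i) * v i).im / (2 * ħ))) • U ⟨w + v, 0⟩ φ) ∧
      -- covariance, as an equality of operators with domain `𝔇`
      (∀ a : Heisenberg n, ∀ f ∈ wickAlgebra n ħ p,
        (∀ φ : BF n ħ, (U a).symm φ ∈ bfDomain n ħ p ↔ φ ∈ bfDomain n ħ p) ∧
        ∀ φ ∈ bfDomain n ħ p,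
          bfRep ħ (wickAd ħ (uHeis ħ a) f) φ = U a (bfRep ħ f ((U a).symm φ)) ∧
          U a (bfRep ħ f ((U a).symm φ)) =
            U ⟨a.w, 0⟩ (bfRep ħ f ((U ⟨a.w, 0⟩).symm φ))) ∧
      -- `δ_w` is the expectation value functional of the coherent state vector `ψ_{(w,c)}`
      (∀ a : Heisenberg n, coherentVector U a ∈ bfDomain n ħ p ∧
        ∀ f ∈ wickAlgebra n ħ p,
          f a.w = inner ℂ (coherentVector U a) (bfRep ħ f (coherentVector U a))) ∧
      -- the action on coherent state vectors factors to the translations of the coherent states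
      (∀ a b : Heisenberg n, (U b).symm (coherentVector U a) = coherentVector U (a * b) ∧
        ∀ f ∈ wickAlgebra n ħ p,
          inner ℂ ((U b).symm (coherentVector U a))
            (bfRep ħ f ((U b).symm (coherentVector U a))) = f (a.w + b.w)) := by
  have hħ : 0 < ħ := Fact.out
  have hmem : ∀ {f}, f ∈ wickAlgebra n ħ p ↔ IsWick f := fun {f} => mem_wickAlgebra_iff hħ
  have hu := isWick_uHeis (n := n) hħ
  simp only [hmem]
  refine ⟨fun f hf => hf.star, fun f hf g hg => ⟨fun z => (hasSum_wickTerm hf hg ħ z).summable,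
    hf.wickMul hg ħ⟩, fun a => ⟨hu a, ?_, ?_⟩, uHeis_mul hħ, fun a f hf => ?_,
    fun f hf => ⟨summable_psiTerm hf, memBF_Psi hħ hf⟩, fun f hf φ hφ => bfRep_mem hf hφ,
    fun f hf g hg => ?_, heisRep n ħ,
    fun a φ hφ => ⟨heisRep_mem a hφ, heisRep_eq_bfRep a hφ⟩, fun a φ z => rfl, continuous_heisRep,
    heisRep_heisRep, fun a f hf => ⟨fun φ => ?_, fun φ hφ => ⟨bfRep_wickAd a hf hφ, ?_⟩⟩,
    fun a => ⟨coherentVector_mem a, fun f hf => (inner_coherentVector a hf).symm⟩,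
    fun a b => ⟨coherentVector_mul a b, fun f hf => ?_⟩⟩
  · rw [star_uHeis hħ, ← uHeis_mul hħ, mul_inv_cancel, uHeis_one]
  · rw [star_uHeis hħ, ← uHeis_mul hħ, inv_mul_cancel, uHeis_one]
  -- Every claim about `wickAd` becomes a claim about translations once `wickAd_uHeis` is applied.
  · have hT : ∀ b : Heisenberg n, IsWick fun z => f (z + b.w) := fun b => hf.translate b.w
    refine ⟨?_, ?_, wickAd_uHeis hħ a hf, ?_, fun g hg => ?_, fun b => ?_⟩
    · rw [wickAd_uHeis hħ a hf]
      exact hT a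
    · rw [uTrans_eq_uHeis, wickAd_uHeis hħ _ hf, wickAd_uHeis hħ _ hf]
    · rw [wickAd_uHeis hħ a hf, wickAd_uHeis hħ a hf.star]
      rfl
    · rw [wickAd_uHeis hħ a hf, wickAd_uHeis hħ a hg, wickAd_uHeis hħ a (hf.wickMul hg ħ),
        wickMul_translate hf hg]
    · rw [wickAd_uHeis hħ b hf, wickAd_uHeis hħ _ hf, wickAd_uHeis hħ a (hT b)]
      funext z
      change f (z + (a.w + b.w)) = _
      rw [add_assoc]
  · have h := toBF_Psi_mem (ħ := ħ) (p := p) hg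
    rw [bfRep_apply hf h, toBF_Psi hg, Psi_wickMul_Psi hf hg]
  · rw [heisRep_symm, heisRep_mem_iff]
  -- The central part drops out: by covariance both sides represent the same translate of `f`.
  · rw [← bfRep_wickAd a hf hφ, ← bfRep_wickAd _ hf hφ, wickAd_uHeis hħ _ hf, wickAd_uHeis hħ _ hf]
  · rw [coherentVector_mul]
    exact inner_coherentVector (a * b) hf
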